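/- **Theorem.** Let $\mathrm{NN}(c,d)$ denote the Euclidean $c$-approximate near neighbor problem without false negatives: preprocess $n$ input points of $\mathbb{R}^d$ so that for every query point $q\in\mathbb{R}^d$ one can report a set $P$ of input points which is guaranteed (for every outcome of the internal randomness) to contain all input points within distance $1$ of $q$ and to contain no input point at distance more than $c$ from $q$. Time is counted on a randomized real RAM (unit cost for an exact arithmetic operation, square root or comparison of reals, the floor of a real, an addition, subtraction or comparison of integers, a memory access, and a sample of a standard Gaussian); expectations are over the random samples, which are independent of the input points and of the query point. There are an absolute constant $D>0$ and a pair of programs (preprocessing and query), which receive $n$, $d$, $c$ and the number $f(n)$ as parameters, such that the following holds. Let $f$ be any function from the natural numbers to the reals that is eventually positive and satisfies $1/f(n)=o(1)$, and put $\mu=\mu(n)=D\sqrt{f(n)\log\log n}$. Then there are constants $C$, $m$, $N$, depending only on $f$, such that for all $n\ge N$, all $d\ge 1$, all $c>\mu$, and all $n$ input points in $\mathbb{R}^d$, the programs solve $\mathrm{NN}(c,d)$ with - expected preprocessing time at most $C(\log n)^m\,\bigl(d^2n+d\,n^{1+\frac{\ln 3}{\ln(c/\mu)}+\frac1{f(n)}}\bigr)$,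 that is, $\tilde O\bigl(d^2n+d\,n^{1+\frac{\ln 3}{\ln(c/\mu)}+\frac1{f(n)}}\bigr)$; - for every query point, expected query time at most $C(\log n)^m\,\bigl(d^2+d\,n^{1/f(n)}(1+\mathbb{E}|P|)\bigr)$, that is, $\tilde O\bigl(d^2+d\,n^{1/f(n)}(1+\mathbb{E}|P|)\bigr)$, where $P$ is the reported set. -/

import Mathlib

open Filter MeasureTheory ProbabilityTheory Asymptotics
open scoped ENNReal

/-! ## A randomized real RAM with a step count

A program is one finite piece of syntax. It works on finitely many two-dimensional integer arrays
and two-dimensional real arrays. The instruction set has exact real arithmetic, square roots,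
comparisons, the floor of a real number (an integer), addition, subtraction and comparison of
integers, indirect addressing, and sampling of independent standard Gaussians. There is
no multiplication of integers and no conversion of integers to reals, so that integers
cannot be used for packing many data into one cell. As a program is fixed syntax, its expressions
have bounded size, and one step is charged for every executed assignment, sample, output and test. -/

namespace RealRAM

mutual

/-- Integer expressions. `get a i j` reads the integer array `a` at index `(i, j)`. -/
inductive IExpr : Type
  | lit (z : ℤ)
  | get (a : ℕ) (i j : IExpr)
  | add (e₁ e₂ : IExpr)
  | sub (e₁ e₂ : IExpr)
  | floor (r : RExpr)

/-- Real expressions. `get a i j` reads the real array `a` at index `(i, j)`. -/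
inductive RExpr : Type
  | zero
  | one
  | get (a : ℕ) (i j : IExpr)
  | add (r₁ r₂ : RExpr)
  | sub (r₁ r₂ : RExpr)
  | mul (r₁ r₂ : RExpr)
  | div (r₁ r₂ : RExpr)
  | sqrt (r : RExpr)

end

/-- Tests. -/
inductive Test : Type
  | ile (e₁ e₂ : IExpr)
  | rle (r₁ r₂ : RExpr)
  | neg (b : Test)
  | conj (b₁ b₂ : Test)

/-- Programs. -/
inductive Cmd : Type
  | skip
  /-- write the value of `e` to the integer array `a` at index `(i, j)` -/
  | setI (a : ℕ) (i j : IExpr) (e : IExpr)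
  /-- write the value of `r` to the real array `a` at index `(i, j)` -/
  | setR (a : ℕ) (i j : IExpr) (r : RExpr)
  /-- write a fresh standard Gaussian sample to the real array `a` at index `(i, j)` -/
  | gauss (a : ℕ) (i j : IExpr)
  /-- add the value of `e` to the reported set -/
  | emit (e : IExpr)
  | seq (p₁ p₂ : Cmd)
  | ite (b : Test) (p₁ p₂ : Cmd)
  | loop (b : Test) (p : Cmd)

/-- A machine state: the integer arrays, the real arrays, the number of random samples
used so far, and the set of integers reported so far. -/
structure State where
  ints : ℕ → ℤ → ℤ → ℤ
  reals : ℕ → ℤ → ℤ → ℝ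
  pos : ℕ
  out : Finset ℤ

/-- The sequence of all random samples that a run may use. -/
abbrev Tape : Type := ℕ → ℝ

/-- The entries of the tape are independent standard Gaussians. -/
noncomputable def tapeLaw : Measure Tape :=
  Measure.infinitePi (fun _ : ℕ => gaussianReal 0 1)

mutual

/-- The value of an integer expression. -/
noncomputable def IExpr.eval (s : State) : IExpr → ℤ
  | .lit z => z
  | .get a i j => s.ints a (i.eval s) (j.eval s)
  | .add e₁ e₂ => e₁.eval s + e₂.eval s
  | .sub e₁ e₂ => e₁.eval s - e₂.eval s
  | .floor r => ⌊r.eval s⌋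

/-- The value of a real expression. (Division by `0` and the square root of a negative
number give `0`.) -/
noncomputable def RExpr.eval (s : State) : RExpr → ℝ
  | .zero => 0
  | .one => 1
  | .get a i j => s.reals a (i.eval s) (j.eval s)
  | .add r₁ r₂ => r₁.eval s + r₂.eval s
  | .sub r₁ r₂ => r₁.eval s - r₂.eval s
  | .mul r₁ r₂ => r₁.eval s * r₂.eval s
  | .div r₁ r₂ => r₁.eval s / r₂.eval s
  | .sqrt r => Real.sqrt (r.eval s)

end

/-- The truth value of a test. -/
def Test.holds (s : State) : Test → Prop
  | .ile e₁ e₂ => e₁.eval s ≤ e₂.eval s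
  | .rle r₁ r₂ => r₁.eval s ≤ r₂.eval s
  | .neg b => ¬ b.holds s
  | .conj b₁ b₂ => b₁.holds s ∧ b₂.holds s

/-- Overwrite one entry of one array. -/
def write {α : Type} (m : ℕ → ℤ → ℤ → α) (a : ℕ) (i j : ℤ) (v : α) : ℕ → ℤ → ℤ → α :=
  fun a' i' j' => if a' = a ∧ i' = i ∧ j' = j then v else m a' i' j'

/-- `Exec ω p s s' t`: with random samples `ω`, the program `p` started in the state `s`
halts in the state `s'` after exactly `t` steps. -/
inductive Exec (ω : Tape) : Cmd → State → State → ℕ → Prop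
  | skip (s) : Exec ω .skip s s 1
  | setI (s a i j e) : Exec ω (.setI a i j e) s
      { s with ints := write s.ints a (i.eval s) (j.eval s) (e.eval s) } 1
  | setR (s a i j r) : Exec ω (.setR a i j r) s
      { s with reals := write s.reals a (i.eval s) (j.eval s) (r.eval s) } 1
  | gauss (s a i j) : Exec ω (.gauss a i j) s
      { s with reals := write s.reals a (i.eval s) (j.eval s) (ω s.pos), pos := s.pos + 1 } 1
  | emit (s e) : Exec ω (.emit e) s { s with out := insert (e.eval s) s.out } 1
  | seq {p₁ p₂ s s₁ s₂ t₁ t₂} : Exec ω p₁ s s₁ t₁ → Exec ω p₂ s₁ s₂ t₂ →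
      Exec ω (.seq p₁ p₂) s s₂ (t₁ + t₂)
  | iteTrue {b p₁ p₂ s s' t} : b.holds s → Exec ω p₁ s s' t →
      Exec ω (.ite b p₁ p₂) s s' (t + 1)
  | iteFalse {b p₁ p₂ s s' t} : ¬ b.holds s → Exec ω p₂ s s' t →
      Exec ω (.ite b p₁ p₂) s s' (t + 1)
  | loopDone {b p s} : ¬ b.holds s → Exec ω (.loop b p) s s 1
  | loopStep {b p s s₁ s₂ t₁ t₂} : b.holds s → Exec ω p s s₁ t₁ →
      Exec ω (.loop b p) s₁ s₂ t₂ → Exec ω (.loop b p) s s₂ (t₁ + t₂ + 1)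

/-- The final state and the number of steps are determined by the program, the initial state
and the random samples. -/
theorem Exec.det {ω : Tape} {p : Cmd} {s s' s'' : State} {t t' : ℕ}
    (h : Exec ω p s s' t) (h' : Exec ω p s s'' t') : s' = s'' ∧ t = t' := by
  induction h generalizing s'' t' with
  | skip | setI | setR | gauss | emit => cases h'; exact ⟨rfl, rfl⟩
  | seq _ _ ih₁ ih₂ =>
    cases h' with
    | seq k₁ k₂ =>
      obtain ⟨rfl, rfl⟩ := ih₁ k₁
      obtain ⟨rfl, rfl⟩ := ih₂ k₂
      exact ⟨rfl, rfl⟩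
  | iteTrue hb _ ih =>
    cases h' with
    | iteTrue _ k => obtain ⟨rfl, rfl⟩ := ih k; exact ⟨rfl, rfl⟩
    | iteFalse hn _ => exact absurd hb hn
  | iteFalse hb _ ih =>
    cases h' with
    | iteTrue hn _ => exact absurd hn hb
    | iteFalse _ k => obtain ⟨rfl, rfl⟩ := ih k; exact ⟨rfl, rfl⟩
  | loopDone hb =>
    cases h' with
    | loopDone _ => exact ⟨rfl, rfl⟩
    | loopStep hn _ _ => exact absurd hn hb
  | loopStep hb _ _ ih₁ ih₂ =>
    cases h' with
    | loopDone hn => exact absurd hb hn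
    | loopStep _ k₁ k₂ =>
      obtain ⟨rfl, rfl⟩ := ih₁ k₁
      obtain ⟨rfl, rfl⟩ := ih₂ k₂
      exact ⟨rfl, rfl⟩

end RealRAM

/-! ## Approximate near neighbor search without false negatives -/

namespace NearNeighbor

open RealRAM

/-- `P` is a correct answer (for the radius `1` and the approximation factor `c`) to the query `q`
over the input points `X`: every point within distance `1` of `q` is in `P`, and no point at
distance more than `c` is. -/
def IsAnswer {n d : ℕ} (c : ℝ) (X : Fin n → EuclideanSpace ℝ (Fin d))
    (q : EuclideanSpace ℝ (Fin d)) (P : Finset (Fin n)) : Prop :=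
  (∀ i, dist (X i) q ≤ 1 → i ∈ P) ∧ (∀ i ∈ P, dist (X i) q ≤ c)

/-- The state in which preprocessing starts: real array `0` holds the input points (one per row),
row `0` of real array `1` holds `c`, the parameter `φ`, `n` and `d`, row `0` of integer array `0`
holds `n` and `d`, and everything else is `0`. -/
noncomputable def inputState {n d : ℕ} (c φ : ℝ) (X : Fin n → EuclideanSpace ℝ (Fin d)) :
    State where
  ints a i j :=
    if a = 0 ∧ i = 0 ∧ j = 0 then n
    else if a = 0 ∧ i = 0 ∧ j = 1 then d
    else 0
  reals a i j :=
    if a = 0 then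
      if h : (0 ≤ i ∧ i.toNat < n) ∧ (0 ≤ j ∧ j.toNat < d) then
        X ⟨i.toNat, h.1.2⟩ ⟨j.toNat, h.2.2⟩
      else 0
    else if a = 1 ∧ i = 0 ∧ j = 0 then c
    else if a = 1 ∧ i = 0 ∧ j = 1 then φ
    else if a = 1 ∧ i = 0 ∧ j = 2 then n
    else if a = 1 ∧ i = 0 ∧ j = 3 then d
    else 0
  pos := 0
  out := ∅

/-- The state in which a query starts: the memory `s` left by preprocessing, with the query
point written into row `0` of real array `2` and nothing reported yet. -/
noncomputable def queryState {d : ℕ} (s : State) (q : EuclideanSpace ℝ (Fin d)) : State where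
  ints := s.ints
  reals a i j :=
    if h : (a = 2 ∧ i = 0) ∧ (0 ≤ j ∧ j.toNat < d) then q ⟨j.toNat, h.2.2⟩ else s.reals a i j
  pos := s.pos
  out := ∅

/-- The programs `pre` (preprocessing) and `query` solve the `c`-approximate near neighbor problem
without false negatives for `n` points of `ℝ^d`, with expected preprocessing time at
most `A` and expected query time at most `B p`, where `p` is the expected number of reported points.

Both programs halt and the answer is correct for all values of the random samples. The input
points and the query are fixed before the samples are drawn. By `Exec.det` the functions
`σ, t, ρ, u, P` are determined by the programs and the inputs. -/
def SolvedBy (pre query : Cmd) (n d : ℕ) (c φ : ℝ) (A : ℝ≥0∞) (B : ℝ≥0∞ → ℝ≥0∞) : Prop :=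
  ∀ X : Fin n → EuclideanSpace ℝ (Fin d),
    ∃ (σ : Tape → State) (t : Tape → ℕ),
      (∀ ω, Exec ω pre (inputState c φ X) (σ ω) (t ω)) ∧
      ∫⁻ ω, (t ω : ℝ≥0∞) ∂tapeLaw ≤ A ∧
      ∀ q : EuclideanSpace ℝ (Fin d),
        ∃ (ρ : Tape → State) (u : Tape → ℕ) (P : Tape → Finset (Fin n)),
          (∀ ω, Exec ω query (queryState (σ ω) q) (ρ ω) (u ω)) ∧
          (∀ ω, (ρ ω).out = (P ω).image (fun i : Fin n => ((i : ℕ) : ℤ))) ∧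
          (∀ ω, IsAnswer c X q (P ω)) ∧
          ∫⁻ ω, (u ω : ℝ≥0∞) ∂tapeLaw ≤ B (∫⁻ ω, ((P ω).card : ℝ≥0∞) ∂tapeLaw)

/-- The threshold `μ = D √(f(n) log log n)`, where `φ = f(n)`. -/
noncomputable def threshold (D φ : ℝ) (n : ℕ) : ℝ :=
  D * Real.sqrt (φ * Real.log (Real.log n))

end NearNeighbor

-- The data structure is a randomized grid of dimension `L` that never separates close points. Let
-- `l = ⌈log₂ n⌉`. A Gaussian matrix `A` with `J * L` rows, `J = d + l`, is scaled so that `‖A‖² ≤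
-- 1/2` holds except with probability `1/n` (`tapeLaw_sampleEnergy_gt_le`). Absence of false
-- negatives must hold for every sample, so preprocessing certifies `‖A‖ ≤ 1`: it forms
-- `(AᵀA)^(2^l)` by repeated squaring and tests whether its trace is at most `1`. The test proves
-- the norm bound (`energy_le_of_trace_le_one`) and passes when `‖A‖² ≤ 1/2` (`trace_le_one`). If it
-- fails, every query scans all points, which adds only `O(d)` to the expected query time. For `n ≤
-- d` scanning is always affordable.
--
-- Near points. If `|x - q| ≤ 1`, then `y = A (x - q)` satisfies `|y|² ≤ 1`, and one of the `J`
-- blocks of `L` coordinates has energy at most `1/J`. The energy may be concentrated on few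
-- coordinates, so a uniform grid would not do. Instead the block is cut into windows of length
-- about `K = f(n)⌈log₂ l⌉ + 1`, and window energies are rounded to multiples of `unit = K / (J L)`.
-- At most `R = ⌊L/K⌋` units are used, so one of `L^R` profiles (sequences of `R` windows) satisfies
-- `y_i² ≤ profile_i * unit` throughout the block. In the grid of cell width `√(profile_i * unit)`
-- the labels of `x` and `q` then differ by at most one in every coordinate (`exists_collides`).
-- Each point is stored in a trie under all `3^L` neighbouring label sequences, for each unit, that
-- is, each pair of a block and a profile; a query looks up just its own sequence.
--
-- Far points. A collision in a unit forces all `L` independent Gaussian coordinates of the block to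
-- be small. The product of a profile is at most `2^L`, so by the choice of `L` this has probability
-- at most `1/(4^L n)` (`tapeLaw_box_le`). As there are `J L^R ≤ J 4^L` units and `n` points, a
-- query meets at most `J` far points in expectation (`exists_farCount_le`).
--
-- Costs. `L` is least with `(c²/(16384 K))^L ≥ n²`. The constant in `μ` makes the base at least `4
-- (c/μ)²`, whence `3^L = O(n^(ln 3 / ln (c/μ)))`. Since `log₂ L^R ≤ R ⌈log₂ l⌉ ≤ L / f(n)` and `2^L
-- ≤ 2n`, also `L^R ≤ 2 n^(1/f(n))` (`exists_paramBounds`). This is why windows of length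
-- proportional to `f(n) log log n` are used, and why that quantity appears in `μ`.
--
-- The programs are verified by a total-correctness calculus with step counts (`wp`), which reduces
-- the theorem to the estimates above.

namespace RealRAM

/-! ## Weakest preconditions -/

/-- Overwrite one entry of an integer array. -/
def State.setI (s : State) (a : ℕ) (i j v : ℤ) : State := { s with ints := write s.ints a i j v }

/-- Overwrite one entry of a real array. -/
noncomputable def State.setR (s : State) (a : ℕ) (i j : ℤ) (v : ℝ) : State :=
  { s with reals := write s.reals a i j v }

@[simp] theorem State.setI_ints (s : State) (a : ℕ) (i j v : ℤ) (a' : ℕ) (i' j' : ℤ) :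
    (s.setI a i j v).ints a' i' j' =
      if a' = a ∧ i' = i ∧ j' = j then v else s.ints a' i' j' := rfl
@[simp] theorem State.setI_reals (s : State) (a : ℕ) (i j v : ℤ) :
    (s.setI a i j v).reals = s.reals := rfl
@[simp] theorem State.setI_pos (s : State) (a : ℕ) (i j v : ℤ) :
    (s.setI a i j v).pos = s.pos := rfl
@[simp] theorem State.setI_out (s : State) (a : ℕ) (i j v : ℤ) :
    (s.setI a i j v).out = s.out := rfl
@[simp] theorem State.setR_reals (s : State) (a : ℕ) (i j : ℤ) (v : ℝ) (a' : ℕ) (i' j' : ℤ) :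
    (s.setR a i j v).reals a' i' j' =
      if a' = a ∧ i' = i ∧ j' = j then v else s.reals a' i' j' := rfl
@[simp] theorem State.setR_ints (s : State) (a : ℕ) (i j : ℤ) (v : ℝ) :
    (s.setR a i j v).ints = s.ints := rfl
@[simp] theorem State.setR_pos (s : State) (a : ℕ) (i j : ℤ) (v : ℝ) :
    (s.setR a i j v).pos = s.pos := rfl
@[simp] theorem State.setR_out (s : State) (a : ℕ) (i j : ℤ) (v : ℝ) :
    (s.setR a i j v).out = s.out := rfl

theorem State.setI_ints_ne (s : State) {a a' : ℕ} (i j v : ℤ) (h : a' ≠ a) :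
    (s.setI a i j v).ints a' = s.ints a' := by
  funext i' j'; simp [h]

theorem State.setR_reals_ne (s : State) {a a' : ℕ} (i j : ℤ) (v : ℝ) (h : a' ≠ a) :
    (s.setR a i j v).reals a' = s.reals a' := by
  funext i' j'; simp [h]

/-- The program `p` halts from the state `s`, and its final state and its number of steps
satisfy `Q`. -/
def wp (ω : Tape) (p : Cmd) (s : State) (Q : State → ℕ → Prop) : Prop :=
  ∃ s' t, Exec ω p s s' t ∧ Q s' t

variable {ω : Tape} {p p₁ p₂ : Cmd} {s : State} {Q Q' : State → ℕ → Prop}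

theorem wp.mono (h : wp ω p s Q) (hQ : ∀ s' t, Q s' t → Q' s' t) : wp ω p s Q' := by
  obtain ⟨s', t, h, hq⟩ := h
  exact ⟨s', t, h, hQ _ _ hq⟩

@[simp] theorem wp_skip : wp ω .skip s Q ↔ Q s 1 := by
  constructor
  · rintro ⟨s', t, h, hq⟩; cases h; exact hq
  · intro h; exact ⟨_, _, .skip _, h⟩

@[simp] theorem wp_setI {a i j e} :
    wp ω (.setI a i j e) s Q ↔ Q (s.setI a (i.eval s) (j.eval s) (e.eval s)) 1 := by
  constructor
  · rintro ⟨s', t, h, hq⟩; cases h; exact hq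
  · intro h; exact ⟨_, _, .setI _ _ _ _ _, h⟩

@[simp] theorem wp_setR {a i j e} :
    wp ω (.setR a i j e) s Q ↔ Q (s.setR a (i.eval s) (j.eval s) (e.eval s)) 1 := by
  constructor
  · rintro ⟨s', t, h, hq⟩; cases h; exact hq
  · intro h; exact ⟨_, _, .setR _ _ _ _ _, h⟩

@[simp] theorem wp_gauss {a i j} : wp ω (.gauss a i j) s Q ↔
    Q { s.setR a (i.eval s) (j.eval s) (ω s.pos) with pos := s.pos + 1 } 1 := by
  constructor
  · rintro ⟨s', t, h, hq⟩; cases h; exact hq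
  · intro h; exact ⟨_, _, .gauss _ _ _ _, h⟩

@[simp] theorem wp_emit {e} :
    wp ω (.emit e) s Q ↔ Q { s with out := insert (e.eval s) s.out } 1 := by
  constructor
  · rintro ⟨s', t, h, hq⟩; cases h; exact hq
  · intro h; exact ⟨_, _, .emit _ _, h⟩

@[simp] theorem wp_seq : wp ω (.seq p₁ p₂) s Q ↔
    wp ω p₁ s (fun s₁ t₁ => wp ω p₂ s₁ (fun s₂ t₂ => Q s₂ (t₁ + t₂))) := by
  constructor
  · rintro ⟨s', t, h, hq⟩
    cases h with
    | seq h₁ h₂ => exact ⟨_, _, h₁, _, _, h₂, hq⟩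
  · rintro ⟨s₁, t₁, h₁, s₂, t₂, h₂, hq⟩
    exact ⟨_, _, .seq h₁ h₂, hq⟩

theorem wp_ite {b} : wp ω (.ite b p₁ p₂) s Q ↔
    (b.holds s → wp ω p₁ s (fun s' t => Q s' (t + 1))) ∧
    (¬ b.holds s → wp ω p₂ s (fun s' t => Q s' (t + 1))) := by
  constructor
  · rintro ⟨s', t, h, hq⟩
    cases h with
    | iteTrue hb h => exact ⟨fun _ => ⟨_, _, h, hq⟩, fun hn => absurd hb hn⟩
    | iteFalse hb h => exact ⟨fun hn => absurd hn hb, fun _ => ⟨_, _, h, hq⟩⟩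
  · rintro ⟨h₁, h₂⟩
    by_cases hb : b.holds s
    · obtain ⟨s', t, h, hq⟩ := h₁ hb
      exact ⟨_, _, .iteTrue hb h, hq⟩
    · obtain ⟨s', t, h, hq⟩ := h₂ hb
      exact ⟨_, _, .iteFalse hb h, hq⟩

/-! ## Frames -/

/-- The integer arrays that a program may write to. -/
def Cmd.modI : Cmd → List ℕ
  | .setI a _ _ _ => [a]
  | .seq p q => p.modI ++ q.modI
  | .ite _ p q => p.modI ++ q.modI
  | .loop _ p => p.modI
  | _ => []

/-- The real arrays that a program may write to. -/
def Cmd.modR : Cmd → List ℕ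
  | .setR a _ _ _ => [a]
  | .gauss a _ _ => [a]
  | .seq p q => p.modR ++ q.modR
  | .ite _ p q => p.modR ++ q.modR
  | .loop _ p => p.modR
  | _ => []

/-- Whether a program may use random samples. -/
def Cmd.usesTape : Cmd → Bool
  | .gauss _ _ _ => true
  | .seq p q => p.usesTape || q.usesTape
  | .ite _ p q => p.usesTape || q.usesTape
  | .loop _ p => p.usesTape
  | _ => false

/-- Whether a program may report something. -/
def Cmd.emits : Cmd → Bool
  | .emit _ => true
  | .seq p q => p.emits || q.emits
  | .ite _ p q => p.emits || q.emits
  | .loop _ p => p.emits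
  | _ => false

/-- What a run of `p` leaves unchanged. -/
structure Frame (p : Cmd) (s s' : State) : Prop where
  ints : ∀ a, a ∉ p.modI → s'.ints a = s.ints a
  reals : ∀ a, a ∉ p.modR → s'.reals a = s.reals a
  pos : p.usesTape = false → s'.pos = s.pos
  out : p.emits = false → s'.out = s.out

theorem Frame.refl (p : Cmd) (s : State) : Frame p s s :=
  ⟨fun _ _ => rfl, fun _ _ => rfl, fun _ => rfl, fun _ => rfl⟩

theorem Frame.trans {s₁ s₂ s₃ : State} (h : Frame p s₁ s₂) (h' : Frame p s₂ s₃) :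
    Frame p s₁ s₃ :=
  ⟨fun a ha => (h'.ints a ha).trans (h.ints a ha),
    fun a ha => (h'.reals a ha).trans (h.reals a ha),
    fun ha => (h'.pos ha).trans (h.pos ha), fun ha => (h'.out ha).trans (h.out ha)⟩

theorem Frame.seq_left {s₁ s₂ : State} (h : Frame p₁ s₁ s₂) : Frame (.seq p₁ p₂) s₁ s₂ := by
  constructor
  · intro a ha; exact h.ints a fun hc => ha (by simp [Cmd.modI, hc])
  · intro a ha; exact h.reals a fun hc => ha (by simp [Cmd.modR, hc])
  · intro ha; exact h.pos (by simp [Cmd.usesTape] at ha; simp [ha])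
  · intro ha; exact h.out (by simp [Cmd.emits] at ha; simp [ha])

theorem Frame.seq_right {s₁ s₂ : State} (h : Frame p₂ s₁ s₂) : Frame (.seq p₁ p₂) s₁ s₂ := by
  constructor
  · intro a ha; exact h.ints a fun hc => ha (by simp [Cmd.modI, hc])
  · intro a ha; exact h.reals a fun hc => ha (by simp [Cmd.modR, hc])
  · intro ha; exact h.pos (by simp [Cmd.usesTape] at ha; simp [ha])
  · intro ha; exact h.out (by simp [Cmd.emits] at ha; simp [ha])

/-- The write sets `modI` and `modR` are read off the syntax, so for a concrete program the claim
that a variable survives a run is settled by `decide`. -/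
theorem Exec.frame {s s' : State} {t : ℕ} (h : Exec ω p s s' t) : Frame p s s' := by
  induction h with
  | skip | loopDone => exact Frame.refl _ _
  | setI s a i j e =>
    exact ⟨fun a' ha => State.setI_ints_ne s _ _ _ (by simpa [Cmd.modI] using ha),
      fun _ _ => rfl, fun _ => rfl, fun _ => rfl⟩
  | setR s a i j e =>
    exact ⟨fun _ _ => rfl, fun a' ha => State.setR_reals_ne s _ _ _ (by simpa [Cmd.modR] using ha),
      fun _ => rfl, fun _ => rfl⟩
  | gauss s a i j =>
    exact ⟨fun _ _ => rfl, fun a' ha => State.setR_reals_ne s _ _ _ (by simpa [Cmd.modR] using ha),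
      fun h => by simp [Cmd.usesTape] at h, fun _ => rfl⟩
  | emit => exact ⟨fun _ _ => rfl, fun _ _ => rfl, fun _ => rfl, fun h => by simp [Cmd.emits] at h⟩
  | seq _ _ ih₁ ih₂ => exact ih₁.seq_left.trans ih₂.seq_right
  | iteTrue _ _ ih => exact ⟨(ih.seq_left).ints, ih.seq_left.reals, ih.seq_left.pos, ih.seq_left.out⟩
  | iteFalse _ _ ih =>
    exact ⟨(ih.seq_right).ints, ih.seq_right.reals, ih.seq_right.pos, ih.seq_right.out⟩
  | loopStep _ _ _ ih₁ ih₂ => exact Frame.trans ⟨ih₁.ints, ih₁.reals, ih₁.pos, ih₁.out⟩ ih₂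

theorem wp.frame (h : wp ω p s Q) : wp ω p s (fun s' t => Frame p s s' ∧ Q s' t) := by
  obtain ⟨s', t, h, hq⟩ := h
  exact ⟨s', t, h, h.frame, hq⟩

/-! ## Loops -/

/-- The integer variable `a`. -/
def iv (a : ℕ) : IExpr := .get a (.lit 0) (.lit 0)

/-- The real variable `a`. -/
def rv (a : ℕ) : RExpr := .get a (.lit 0) (.lit 0)

@[simp] theorem iv_eval (a : ℕ) : (iv a).eval s = s.ints a 0 0 := by simp [iv, IExpr.eval]
@[simp] theorem rv_eval (a : ℕ) : (rv a).eval s = s.reals a 0 0 := by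
  simp [rv, RExpr.eval, IExpr.eval]

attribute [simp] IExpr.eval RExpr.eval Test.holds

/-- Assign to the integer variable `a`. -/
def assignI (a : ℕ) (e : IExpr) : Cmd := .setI a (.lit 0) (.lit 0) e

/-- Assign to the real variable `a`. -/
def assignR (a : ℕ) (e : RExpr) : Cmd := .setR a (.lit 0) (.lit 0) e

@[simp] theorem wp_assignI {a e} : wp ω (assignI a e) s Q ↔ Q (s.setI a 0 0 (e.eval s)) 1 := by
  simp [assignI]
@[simp] theorem wp_assignR {a e} : wp ω (assignR a e) s Q ↔ Q (s.setR a 0 0 (e.eval s)) 1 := by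
  simp [assignR]

theorem Exec.assignI (s : State) (a : ℕ) (e : IExpr) :
    Exec ω (assignI a e) s (s.setI a 0 0 (e.eval s)) 1 := by
  have := Exec.setI (ω := ω) s a (.lit 0) (.lit 0) e
  simp only [IExpr.eval] at this
  exact this

theorem Exec.assignR (s : State) (a : ℕ) (e : RExpr) :
    Exec ω (assignR a e) s (s.setR a 0 0 (e.eval s)) 1 := by
  have := Exec.setR (ω := ω) s a (.lit 0) (.lit 0) e
  simp only [IExpr.eval] at this
  exact this

/-- Run `p` with the variable `x` equal to `0, 1, 2, …` as long as `x < e`. -/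
def forLoop (x : ℕ) (e : IExpr) (p : Cmd) : Cmd :=
  .seq (assignI x (.lit 0))
    (.loop (.ile (.add (iv x) (.lit 1)) e) (.seq p (assignI x (.add (iv x) (.lit 1)))))

/-- The third argument of `Inv` is the time spent so far. An iteration costs two steps besides its
body, the test and the increment; two more pay for the initial assignment and the last test.
Hypothesis `he` keeps the bound fixed while the loop runs. -/
theorem wp_for {x : ℕ} {e : IExpr} (N : ℕ) (Inv : ℕ → State → ℕ → Prop)
    (he : ∀ s', Frame (forLoop x e p) s s' → e.eval s' = N)
    (hx : x ∉ p.modI)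
    (h0 : Inv 0 (s.setI x 0 0 0) 0)
    (hstep : ∀ i < N, ∀ s' T, Frame (forLoop x e p) s s' → s'.ints x 0 0 = i → Inv i s' T →
      wp ω p s' (fun s'' t => Inv (i + 1) (s''.setI x 0 0 (i + 1)) (T + t + 2)))
    (hQ : ∀ s' T, Frame (forLoop x e p) s s' → Inv N s' T → Q s' (T + 2)) :
    wp ω (forLoop x e p) s Q := by
  have key : ∀ m i, i + m = N → ∀ s' T, Frame (forLoop x e p) s s' → s'.ints x 0 0 = i →
      Inv i s' T → wp ω (.loop (.ile (.add (iv x) (.lit 1)) e)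
        (.seq p (assignI x (.add (iv x) (.lit 1))))) s' (fun s'' t => Q s'' (T + t + 1)) := by
    intro m
    induction m with
    | zero =>
      intro i hi s' T hf hxi hinv
      refine ⟨s', 1, .loopDone ?_, hQ _ _ hf ?_⟩
      · have := he _ hf
        simp [hxi, this]; omega
      · rwa [show N = i by omega]
    | succ m ih =>
      intro i hi s' T hf hxi hinv
      obtain ⟨s₁, t₁, h₁, hinv₁⟩ := hstep i (by omega) s' T hf hxi hinv
      have hb : (Test.ile (.add (iv x) (.lit 1)) e).holds s' := by
        have := he _ hf
        simp [hxi, this]; omega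
      have hx₁ : s₁.ints x 0 0 = i := by rw [h₁.frame.ints x hx, hxi]
      have h₂ : Exec ω (.seq p (assignI x (.add (iv x) (.lit 1)))) s'
          (s₁.setI x 0 0 (i + 1)) (t₁ + 1) := by
        refine .seq h₁ ?_
        have := Exec.assignI (ω := ω) s₁ x (.add (iv x) (.lit 1))
        simpa [hx₁] using this
      have hf₂ : Frame (forLoop x e p) s (s₁.setI x 0 0 (i + 1)) := by
        refine hf.trans ?_
        have := h₂.frame
        refine Frame.seq_right ⟨?_, ?_, ?_, ?_⟩
        · exact this.ints
        · exact this.reals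
        · exact this.pos
        · exact this.out
      obtain ⟨s₃, t₃, h₃, hq⟩ := ih (i + 1) (by omega) _ _ hf₂ (by simp) hinv₁
      refine ⟨s₃, _, .loopStep hb h₂ h₃, ?_⟩
      convert hq using 1
      ring
  have hf0 : Frame (forLoop x e p) s (s.setI x 0 0 0) := by
    refine Frame.seq_left ?_
    exact (Exec.assignI (ω := ω) s x (.lit 0)).frame
  obtain ⟨s₁, t₁, h₁, hq⟩ := key N 0 (by omega) _ _ hf0 (by simp) h0
  refine ⟨s₁, 1 + t₁, .seq ?_ h₁, ?_⟩
  · exact Exec.assignI s x (.lit 0)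
  · convert hq using 1
    ring

/-- A `for` loop all of whose iterations take at most `τ` steps. -/
theorem wp_for_const {x : ℕ} {e : IExpr} (N τ : ℕ) (Inv : ℕ → State → Prop)
    (he : ∀ s', Frame (forLoop x e p) s s' → e.eval s' = N)
    (hx : x ∉ p.modI)
    (h0 : Inv 0 (s.setI x 0 0 0))
    (hstep : ∀ i < N, ∀ s', Frame (forLoop x e p) s s' → s'.ints x 0 0 = i → Inv i s' →
      wp ω p s' (fun s'' t => Inv (i + 1) (s''.setI x 0 0 (i + 1)) ∧ t ≤ τ))
    (hQ : ∀ s' t, Frame (forLoop x e p) s s' → Inv N s' → t ≤ N * (τ + 2) + 2 → Q s' t) :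
    wp ω (forLoop x e p) s Q := by
  refine wp_for N (fun i s' T => Inv i s' ∧ T ≤ i * (τ + 2)) he hx ⟨h0, by simp⟩ ?_ ?_
  · rintro i hi s' T hf hxi ⟨hinv, hT⟩
    refine (hstep i hi s' hf hxi hinv).mono ?_
    rintro s'' t ⟨h, ht⟩
    refine ⟨h, ?_⟩
    nlinarith
  · rintro s' T hf ⟨hinv, hT⟩
    exact hQ _ _ hf hinv (by omega)

/-- Add up `r` over `x = 0, 1, 2, …` as long as `x < e`, in the real variable `acc`. -/
def sumLoop (acc x : ℕ) (e : IExpr) (r : RExpr) : Cmd :=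
  .seq (assignR acc .zero) (forLoop x e (assignR acc (.add (rv acc) r)))

theorem wp_sumLoop {acc x : ℕ} {e : IExpr} {r : RExpr} (N : ℕ) (g : ℕ → ℝ)
    (he : ∀ s', Frame (sumLoop acc x e r) s s' → e.eval s' = N)
    (hr : ∀ i < N, ∀ s', Frame (sumLoop acc x e r) s s' → s'.ints x 0 0 = i → r.eval s' = g i)
    (hQ : ∀ s' t, Frame (sumLoop acc x e r) s s' → s'.reals acc 0 0 = ∑ i ∈ Finset.range N, g i →
      t ≤ 3 * N + 3 → Q s' t) :
    wp ω (sumLoop acc x e r) s Q := by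
  have hf0 : Frame (sumLoop acc x e r) s (s.setR acc 0 0 0) := by
    refine Frame.seq_left ?_
    exact (Exec.assignR (ω := ω) s acc .zero).frame
  rw [sumLoop, wp_seq, wp_assignR]
  refine wp_for_const N 1 (fun i s' => s'.reals acc 0 0 = ∑ k ∈ Finset.range i, g k)
    (fun s' hf => he s' (hf0.trans hf.seq_right)) (by simp [Cmd.modI, assignR]) (by simp) ?_ ?_
  · intro i hi s' hf hxi hinv
    have := hr i hi s' (hf0.trans hf.seq_right) hxi
    simp [hinv, this, Finset.sum_range_succ]
  · intro s' t hf hinv ht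
    exact hQ _ _ (hf0.trans hf.seq_right) hinv (by omega)

/-- Multiply the real variable `pw`, which is `1` at first, by `b` until it is at least `g`;
the variables `xi` and `xr` count the multiplications. -/
def logLoop (pw xi xr : ℕ) (b g : RExpr) : Cmd :=
  .seq (assignR pw .one) (.seq (assignI xi (.lit 0)) (.seq (assignR xr .zero)
    (.loop (.neg (.rle g (rv pw))) (.seq (assignR pw (.mul (rv pw) b))
      (.seq (assignI xi (.add (iv xi) (.lit 1))) (assignR xr (.add (rv xr) .one)))))))

/-- The exponent `m` is the least with `γ ≤ β ^ m`, that is, a rounded-up logarithm. It is counted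
both as an integer and as a real because the machine cannot convert integers to reals. -/
theorem wp_logLoop {pw xi xr : ℕ} {b g : RExpr} (hne : pw ≠ xr) (β γ : ℝ) (m : ℕ)
    (hb : ∀ s', Frame (logLoop pw xi xr b g) s s' → b.eval s' = β)
    (hg : ∀ s', Frame (logLoop pw xi xr b g) s s' → g.eval s' = γ)
    (hm : γ ≤ β ^ m) (hlt : ∀ i < m, β ^ i < γ)
    (hQ : ∀ s' t, Frame (logLoop pw xi xr b g) s s' → s'.ints xi 0 0 = m → s'.reals xr 0 0 = m →
      t ≤ 4 * m + 4 → Q s' t) :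
    wp ω (logLoop pw xi xr b g) s Q := by
  have key : ∀ k i, i + k = m → ∀ s', Frame (logLoop pw xi xr b g) s s' →
      s'.reals pw 0 0 = β ^ i → s'.ints xi 0 0 = i → s'.reals xr 0 0 = i →
      wp ω (.loop (.neg (.rle g (rv pw))) (.seq (assignR pw (.mul (rv pw) b))
      (.seq (assignI xi (.add (iv xi) (.lit 1))) (assignR xr (.add (rv xr) .one))))) s'
      (fun s'' t => Frame (logLoop pw xi xr b g) s s'' ∧ s''.ints xi 0 0 = m ∧
        s''.reals xr 0 0 = m ∧ t ≤ 4 * k + 1) := by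
    intro k
    induction k with
    | zero =>
      intro i hi s' hf h1 h2 h3
      obtain rfl : i = m := by omega
      exact ⟨s', 1, .loopDone (by simpa [hg _ hf, h1] using hm), hf, h2, h3, by omega⟩
    | succ k ih =>
      intro i hi s' hf h1 h2 h3
      have hex : wp ω (.seq (assignR pw (.mul (rv pw) b))
        (.seq (assignI xi (.add (iv xi) (.lit 1))) (assignR xr (.add (rv xr) .one)))) s'
        (fun s'' t => s''.reals pw 0 0 = β ^ (i + 1) ∧ s''.ints xi 0 0 = (i + 1 : ℕ) ∧
          s''.reals xr 0 0 = (i + 1 : ℕ) ∧ t = 3) := by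
        simp [h1, h2, h3, hb _ hf, pow_succ, hne, hne.symm]
      obtain ⟨s₁, t₁, e₁, r1, r2, r3, rfl⟩ := hex
      have hf₁ : Frame (logLoop pw xi xr b g) s s₁ := by
        refine hf.trans (Frame.seq_right (Frame.seq_right (Frame.seq_right ?_)))
        have := e₁.frame
        exact ⟨this.ints, this.reals, this.pos, this.out⟩
      obtain ⟨s₂, t₂, e₂, q1, q2, q3, q4⟩ := ih (i + 1) (by omega) s₁ hf₁ r1 r2 r3
      refine ⟨s₂, _, .loopStep ?_ e₁ e₂, q1, q2, q3, by omega⟩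
      simpa [hg _ hf, h1] using hlt i (by omega)
  rw [logLoop, wp_seq, wp_assignR, wp_seq, wp_assignI, wp_seq, wp_assignR]
  refine (key m 0 (by omega) _ ?_ ?_ ?_ ?_).mono ?_
  · exact (Frame.seq_left (Exec.assignR (ω := ω) s pw .one).frame).trans
      ((Frame.seq_right (Frame.seq_left (Exec.assignI (ω := ω) _ xi (.lit 0)).frame)).trans
        (Frame.seq_right (Frame.seq_right
          (Frame.seq_left (Exec.assignR (ω := ω) _ xr .zero).frame))))
  · simp [hne]
  · simp
  · simp
  · rintro s' t ⟨h1, h2, h3, h4⟩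
    exact hQ _ _ h1 h2 h3 (by omega)

/-- The natural number `k` as a real expression. -/
def natR : ℕ → RExpr
  | 0 => .zero
  | k + 1 => .add (natR k) .one

@[simp] theorem natR_eval (k : ℕ) : (natR k).eval s = k := by
  induction k with
  | zero => simp [natR]
  | succ k ih => simp [natR, ih]

end RealRAM

/-! ## The programs -/

namespace NearNeighbor

open RealRAM

/-! The numbers of the variables and arrays. -/

notation "vClog" => 1
notation "vWin" => 2
notation "vLen" => 3
notation "vRounds" => 4
notation "vBlocks" => 5
notation "vBrute" => 6
notation "vRows" => 7
notation "vBase" => 8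
notation "vHeight" => 9
notation "vLow" => 10
notation "vHigh" => 11
notation "vSize" => 12
notation "vX" => 13
notation "vR" => 14
notation "vU" => 15
notation "vV" => 16
notation "vT" => 17
notation "vA" => 18
notation "vB" => 19
notation "vI" => 20
notation "vJ" => 21
notation "vP" => 22
notation "vCount" => 23
notation "vRoot" => 24
notation "vOff" => 25
notation "vLabel" => 26
notation "vFront" => 27
notation "vNext" => 28
notation "vNode" => 29
notation "aTrie" => 30
notation "aFront" => 31
notation "aList" => 32
notation "aListLen" => 33
notation "aMark" => 34

notation "rPoint" => 0
notation "rParam" => 1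
notation "rQuery" => 2
notation "rMat" => 3
notation "rProf" => 4
notation "rProj" => 5
notation "rPow" => 6
notation "rClog" => 7
notation "rLoglog" => 8
notation "rWin" => 9
notation "rLen" => 10
notation "rBlocks" => 11
notation "rUnit" => 12
notation "rScale" => 13
notation "rAcc" => 14

/-- The number of points. -/
def nE : IExpr := .get 0 (.lit 0) (.lit 0)
/-- The dimension. -/
def dE : IExpr := .get 0 (.lit 0) (.lit 1)
/-- The approximation factor. -/
def cE : RExpr := .get rParam (.lit 0) (.lit 0)
/-- The value `f(n)`. -/
def phiE : RExpr := .get rParam (.lit 0) (.lit 1)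
/-- The number of points, as a real. -/
def nR : RExpr := .get rParam (.lit 0) (.lit 2)
/-- The dimension, as a real. -/
def dR : RExpr := .get rParam (.lit 0) (.lit 3)

attribute [simp] nE dE cE phiE nR dR

/-- Compute the parameters. -/
def paramCmd : Cmd :=
  .seq (logLoop rPow vClog rClog (natR 2) nR) <|
  .seq (logLoop rPow vWin rLoglog (natR 2) (rv rClog)) <|
  .seq (assignR rWin (.add (.mul phiE (rv rLoglog)) .one)) <|
  .seq (assignI vWin (.floor (rv rWin))) <|
  .seq (logLoop rPow vLen rLen (.div (.mul cE cE) (.mul (natR 16384) (rv rWin))) (.mul nR nR)) <|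
  .seq (assignI vRounds (.floor (.div (rv rLen) (rv rWin)))) <|
  .seq (assignI vBlocks (.add dE (iv vClog))) <|
  .seq (assignR rBlocks (.add dR (rv rClog))) <|
  .seq (assignR rUnit (.div (rv rWin) (.mul (rv rBlocks) (rv rLen)))) <|
  .seq (assignR rScale (.sqrt (.mul (natR 128) (.mul (rv rBlocks) (rv rLen))))) <|
  -- Integers cannot be multiplied, so the number of rows, blocks times block length, is found by
  -- repeated addition.
  .seq (assignI vRows (.lit 0)) <|
  forLoop vJ (iv vBlocks) (assignI vRows (.add (iv vRows) (iv vLen)))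

/-- Sample the scaled Gaussian matrix. -/
def sampleCmd : Cmd :=
  forLoop vR (iv vRows) <| forLoop vU dE <|
    .seq (.gauss rMat (iv vR) (iv vU))
      (.setR rMat (iv vR) (iv vU) (.div (.get rMat (iv vR) (iv vU)) (rv rScale)))

/-- Append the Gram matrix of the last matrix in `rMat`. -/
def gramCmd : Cmd :=
  .seq (forLoop vU dE <| forLoop vV dE <|
    .seq (sumLoop rAcc vR (iv vHeight)
      (.mul (.get rMat (.add (iv vBase) (iv vR)) (iv vU))
        (.get rMat (.add (iv vBase) (iv vR)) (iv vV))))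
      (.setR rMat (.add (.add (iv vBase) (iv vHeight)) (iv vU)) (iv vV) (rv rAcc))) <|
  .seq (assignI vBase (.add (iv vBase) (iv vHeight))) (assignI vHeight dE)

/-- Iterate Gram matrices and set `rAcc` to the trace of the last one. -/
def traceCmd : Cmd :=
  .seq (assignI vBase (.lit 0)) <| .seq (assignI vHeight (iv vRows)) <|
  .seq (forLoop vT (.add (iv vClog) (.lit 1)) gramCmd) <|
  sumLoop rAcc vU dE (.get rMat (.add (iv vBase) (iv vU)) (iv vU))

/-- Make the list of profiles. -/
def profileCmd : Cmd :=
  .seq (assignI vLow (.lit 0)) <| .seq (assignI vSize (.lit 1)) <| .seq (assignI vHigh (.lit 1)) <|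
  .seq (forLoop vI (iv vLen) (.setR rProf (.lit 0) (iv vI) .one)) <|
  forLoop vT (iv vRounds) <|
    .seq (forLoop vA (iv vSize) <| forLoop vB (iv vLen) <|
      .seq (forLoop vI (iv vLen) <|
        .ite (.conj (.ile (iv vB) (iv vI)) (.ile (.add (iv vI) (.lit 1)) (.add (iv vB) (iv vWin))))
          (.setR rProf (iv vHigh) (iv vI)
            (.add (.get rProf (.add (iv vLow) (iv vA)) (iv vI)) .one))
          (.setR rProf (iv vHigh) (iv vI) (.get rProf (.add (iv vLow) (iv vA)) (iv vI)))) <|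
      assignI vHigh (.add (iv vHigh) (.lit 1))) <|
    .seq (assignI vLow (.add (iv vLow) (iv vSize))) (assignI vSize (.sub (iv vHigh) (iv vLow)))

/-- Project row `x` of the array `a`. -/
def projectCmd (a : ℕ) (x : IExpr) : Cmd :=
  forLoop vR (iv vRows) <|
    .seq (sumLoop rAcc vU dE (.mul (.get rMat (iv vR) (iv vU)) (.get a x (iv vU))))
      (.setR rProj (.lit 0) (iv vR) (rv rAcc))

/-- The label of the current projection at coordinate `vI` of profile `vP`. -/
def labelE : IExpr :=
  .floor (.div (.get rProj (.lit 0) (.add (iv vOff) (iv vI)))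
    (.sqrt (.mul (.get rProf (.add (iv vLow) (iv vP)) (iv vI)) (rv rUnit))))

/-- Go from the node `vNode` to its child with label `z`, which is created if it does not exist,
and append that child to the next frontier. -/
def childCmd (z : IExpr) : Cmd :=
  .seq (.ite (.ile (.get aTrie (iv vNode) z) (.lit 0))
    (.seq (assignI vCount (.add (iv vCount) (.lit 1))) (.setI aTrie (iv vNode) z (iv vCount)))
    .skip) <|
  .seq (.setI aFront (.add (iv vI) (.lit 1)) (iv vNext) (.get aTrie (iv vNode) z))
    (assignI vNext (.add (iv vNext) (.lit 1)))

/-- Expand the frontier of level `vI`. -/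
def expandCmd : Cmd :=
  .seq (assignI vLabel labelE) <| .seq (assignI vNext (.lit 0)) <|
  .seq (forLoop vA (iv vFront) <|
    .seq (assignI vNode (.get aFront (iv vI) (iv vA))) <|
    .seq (childCmd (.sub (iv vLabel) (.lit 1))) <|
    .seq (childCmd (iv vLabel)) (childCmd (.add (iv vLabel) (.lit 1)))) <|
  assignI vFront (iv vNext)

/-- Append the point `vX` to the lists of all nodes of the last frontier. -/
def appendCmd : Cmd :=
  forLoop vA (iv vFront) <|
    .seq (assignI vNode (.get aFront (iv vLen) (iv vA))) <|
    .seq (.setI aList (iv vNode) (.get aListLen (iv vNode) (.lit 0)) (iv vX))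
      (.setI aListLen (iv vNode) (.lit 0) (.add (.get aListLen (iv vNode) (.lit 0)) (.lit 1)))

/-- Insert the point `vX` into the trie with root `vRoot`. -/
def insertCmd : Cmd :=
  .seq (.setI aFront (.lit 0) (.lit 0) (iv vRoot)) <| .seq (assignI vFront (.lit 1)) <|
  .seq (forLoop vI (iv vLen) expandCmd) appendCmd

/-- For each block and each profile run `p`. -/
def unitsCmd (p : Cmd) : Cmd :=
  .seq (assignI vRoot (.lit 0)) <| .seq (assignI vOff (.lit 0)) <|
  forLoop vJ (iv vBlocks) <|
    -- Each unit owns a trie; the roots are the negative integers, the other nodes are positive, and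
    -- `0` means that there is no node.
    .seq (forLoop vP (iv vSize) (.seq (assignI vRoot (.sub (iv vRoot) (.lit 1))) p))
      (assignI vOff (.add (iv vOff) (iv vLen)))

/-- Insert all points. -/
def buildCmd : Cmd :=
  .seq (assignI vCount (.lit 0)) <|
  forLoop vX nE (.seq (projectCmd rPoint (iv vX)) (unitsCmd insertCmd))

/-- Preprocessing. -/
def preCmd : Cmd :=
  -- For `n ≤ d` a scan of all points takes time `O(d n) = O(d²)`, which a query may spend.
  .ite (.ile nE dE) (assignI vBrute (.lit 1)) <|
  .seq paramCmd <| .seq sampleCmd <| .seq traceCmd <|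
  .ite (.rle (rv rAcc) .one) (.seq profileCmd buildCmd) (assignI vBrute (.lit 1))

/-- Report the point `vX` if this has not been done yet and it is close to the query. -/
def checkCmd : Cmd :=
  .ite (.ile (.get aMark (iv vX) (.lit 0)) (.lit 0))
    (.seq (sumLoop rAcc vU dE
        (.mul (.sub (.get rPoint (iv vX) (iv vU)) (.get rQuery (.lit 0) (iv vU)))
          (.sub (.get rPoint (iv vX) (iv vU)) (.get rQuery (.lit 0) (iv vU)))))
      (.ite (.rle (rv rAcc) (.mul cE cE))
        -- Only accepted points are marked. A far point is tested again in every list that contains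
        -- it, which the bound on far collisions pays for.
        (.seq (.emit (iv vX)) (.setI aMark (iv vX) (.lit 0) (.lit 1))) .skip))
    .skip

/-- Check all points in the list of the query in the trie with root `vRoot`. -/
def lookupCmd : Cmd :=
  .seq (assignI vNode (iv vRoot)) <|
  .seq (forLoop vI (iv vLen) (assignI vNode (.get aTrie (iv vNode) labelE))) <|
  forLoop vA (.get aListLen (iv vNode) (.lit 0))
    (.seq (assignI vX (.get aList (iv vNode) (iv vA))) checkCmd)

/-- Queries. -/
def queryCmd : Cmd :=
  .ite (.ile (.lit 1) (iv vBrute)) (forLoop vX nE checkCmd)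
    (.seq (projectCmd rQuery (.lit 0)) (unitsCmd lookupCmd))

end NearNeighbor

-- Parameters of the data structure and their computation

namespace NearNeighbor

open RealRAM

variable {ω : Tape} {s s' : State} {Q : State → ℕ → Prop}

/-- The values of the parameters of the data structure. -/
structure Params where
  (n d l k L R J M : ℕ)
  (c unit scale : ℝ)
  X : ℕ → ℕ → ℝ

/-- The state `s` holds the parameters `P`. -/
structure Params.InState (P : Params) (s : State) : Prop where
  n : s.ints 0 0 0 = P.n
  d : s.ints 0 0 1 = P.d
  l : s.ints vClog 0 0 = P.l
  k : s.ints vWin 0 0 = P.k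
  L : s.ints vLen 0 0 = P.L
  R : s.ints vRounds 0 0 = P.R
  J : s.ints vBlocks 0 0 = P.J
  M : s.ints vRows 0 0 = P.M
  c : s.reals rParam 0 0 = P.c
  unit : s.reals rUnit 0 0 = P.unit
  scale : s.reals rScale 0 0 = P.scale
  X : ∀ i < P.n, ∀ u < P.d, s.reals rPoint i u = P.X i u

theorem Params.InState.frame {P : Params} (h : P.InState s) {p : Cmd} (hf : Frame p s s')
    (hI : ∀ a ∈ [0, vClog, vWin, vLen, vRounds, vBlocks, vRows], a ∉ p.modI)
    (hR : ∀ a ∈ [rParam, rUnit, rScale, rPoint], a ∉ p.modR) : P.InState s' := by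
  simp only [List.mem_cons, List.not_mem_nil, or_false, forall_eq_or_imp, forall_eq] at hI hR
  obtain ⟨h0, h1, h2, h3, h4, h5, h6⟩ := hI
  obtain ⟨g0, g1, g2, g3⟩ := hR
  constructor
  · rw [hf.ints _ h0, h.n]
  · rw [hf.ints _ h0, h.d]
  · rw [hf.ints _ h1, h.l]
  · rw [hf.ints _ h2, h.k]
  · rw [hf.ints _ h3, h.L]
  · rw [hf.ints _ h4, h.R]
  · rw [hf.ints _ h5, h.J]
  · rw [hf.ints _ h6, h.M]
  · rw [hf.reals _ g0, h.c]
  · rw [hf.reals _ g1, h.unit]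
  · rw [hf.reals _ g2, h.scale]
  · intro i hi u hu; rw [hf.reals _ g3, h.X i hi u hu]

/-- The hypotheses on powers say that `l = ⌈log₂ n⌉`, `ll = ⌈log₂ l⌉`, and that `L` is the least
exponent for which the power of `c² / (16384 K)` reaches `n²`, where `K = φ ll + 1`. -/
theorem wp_paramCmd (n d l ll L : ℕ) (c φ : ℝ)
    (hn : s.reals rParam 0 2 = n) (hd : s.reals rParam 0 3 = d) (hdi : s.ints 0 0 1 = d)
    (hc : s.reals rParam 0 0 = c) (hφ : s.reals rParam 0 1 = φ)
    (hl : (n : ℝ) ≤ 2 ^ l) (hl' : ∀ i < l, (2 : ℝ) ^ i < n)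
    (hll : (l : ℝ) ≤ 2 ^ ll) (hll' : ∀ i < ll, (2 : ℝ) ^ i < l)
    (hL : (n : ℝ) * n ≤ (c * c / (16384 * (φ * ll + 1))) ^ L)
    (hL' : ∀ i < L, (c * c / (16384 * (φ * ll + 1))) ^ i < (n : ℝ) * n)
    (hQ : ∀ s' t, Frame paramCmd s s' → s'.ints vClog 0 0 = l → s'.ints vLen 0 0 = L →
      s'.ints vWin 0 0 = ⌊φ * ll + 1⌋ → s'.ints vRounds 0 0 = ⌊(L : ℝ) / (φ * ll + 1)⌋ →
      s'.ints vBlocks 0 0 = (d + l : ℕ) → s'.ints vRows 0 0 = ((d + l) * L : ℕ) →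
      s'.reals rUnit 0 0 = (φ * ll + 1) / ((d + l : ℕ) * L) →
      s'.reals rScale 0 0 = √(128 * ((d + l : ℕ) * L)) →
      t ≤ 4 * l + 4 * ll + 4 * L + 3 * (d + l) + 30 → Q s' t) :
    wp ω paramCmd s Q := by
  -- The frame of the whole run is supplied here once, so that it need not be assembled from the
  -- frames of the parts.
  refine (wp.frame (Q := fun s' t => Frame paramCmd s s' → Q s' t) ?_).mono fun _ _ h => h.2 h.1
  rw [paramCmd, wp_seq]
  refine wp_logLoop (by decide) 2 n l (fun s' _ => by simp)
    (fun s' hf => by simp [hf.reals 1 (by decide), hn]) hl hl' ?_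
  intro s₁ t₁ f₁ e₁ e₁' ht₁
  rw [wp_seq]
  refine wp_logLoop (by decide) 2 l ll (fun s' _ => by simp)
    (fun s' hf => by simp [hf.reals 7 (by decide), e₁']) hll hll' ?_
  intro s₂ t₂ f₂ e₂ e₂' ht₂
  have hK : φ * (ll : ℝ) + 1 = s₂.reals 1 0 1 * s₂.reals 8 0 0 + 1 := by
    rw [f₂.reals 1 (by decide), f₁.reals 1 (by decide), hφ, e₂']
  simp only [wp_seq, wp_assignI, wp_assignR]
  refine wp_logLoop (by decide) (c * c / (16384 * (φ * ll + 1))) ((n : ℝ) * n) L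
    (fun s' hf => ?_) (fun s' hf => ?_) hL hL' ?_
  · simp [hf.reals 1 (by decide), hf.reals 9 (by decide), f₂.reals 1 (by decide),
      f₁.reals 1 (by decide), hc, hφ, e₂']
  · simp [hf.reals 1 (by decide), f₂.reals 1 (by decide), f₁.reals 1 (by decide), hn]
  intro s₃ t₃ f₃ e₃ e₃' ht₃
  have hJ : s₃.ints 0 0 1 + s₃.ints 1 0 0 = (d + l : ℕ) := by
    rw [f₃.ints 0 (by decide), f₃.ints 1 (by decide)]
    simp [f₂.ints 0 (by decide), f₁.ints 0 (by decide), f₂.ints 1 (by decide), hdi, e₁]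
  have hJr : s₃.reals 1 0 3 + s₃.reals 7 0 0 = (d + l : ℕ) := by
    rw [f₃.reals 1 (by decide), f₃.reals 7 (by decide)]
    simp [f₂.reals 1 (by decide), f₁.reals 1 (by decide), f₂.reals 7 (by decide), hd, e₁']
  have hK3 : s₃.reals 9 0 0 = φ * ll + 1 := by
    rw [f₃.reals 9 (by decide)]
    simp [hK]
  have hk3 : s₃.ints 2 0 0 = ⌊φ * ll + 1⌋ := by
    rw [f₃.ints 2 (by decide)]
    simp [hK]
  have hl3 : s₃.ints 1 0 0 = l := by
    rw [f₃.ints 1 (by decide)]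
    simp [f₂.ints 1 (by decide), e₁]
  refine wp_for_const (d + l) 1 (fun i s' => s'.ints 7 0 0 = (i * L : ℕ)) ?_ (by decide)
    (by simp) ?_ ?_
  · intro s' hf
    simp only [iv_eval]
    rw [hf.ints 5 (by decide)]
    simp only [State.setI_ints, State.setR_ints]
    simpa using hJ
  · intro i hi s' hf hxi hinv
    have hL3 : s'.ints 3 0 0 = L := by
      rw [hf.ints 3 (by decide)]
      simp [e₃]
    simp [hinv, hL3]
    ring
  · intro s' t hf hinv ht hfr
    refine hQ s' _ hfr ?_ ?_ ?_ ?_ ?_ ?_ ?_ ?_ ?_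
    · rw [hf.ints 1 (by decide)]; simp [hl3]
    · rw [hf.ints 3 (by decide)]; simp [e₃]
    · rw [hf.ints 2 (by decide)]; simp [hk3]
    · rw [hf.ints 4 (by decide)]; simp [e₃', hK3]
    · rw [hf.ints 5 (by decide)]; simp; simpa using hJ
    · simpa using hinv
    · rw [hf.reals 12 (by decide)]
      simp [e₃', hK3, hJr] 
    · rw [hf.reals 13 (by decide)]
      simp [e₃', hJr]
    · omega

end NearNeighbor

namespace NearNeighbor

open RealRAM

variable {ω : Tape} {s s' : State} {Q : State → ℕ → Prop} {P : Params}

/-! ## Sampling and Gram matrices -/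

/-- Entry `(r, u)` consumes sample number `r * d + u`; the invariant follows the tape position.
Different entries therefore use different samples, which gives independence later. -/
theorem wp_sampleCmd (hP : P.InState s) (hpos : s.pos = 0)
    (hQ : ∀ s' t, Frame sampleCmd s s' →
      (∀ r < P.M, ∀ u < P.d, s'.reals rMat r u = ω (r * P.d + u) / P.scale) →
      t ≤ P.M * (P.d * 4 + 4) + 2 → Q s' t) :
    wp ω sampleCmd s Q := by
  have hPs : ∀ s', Frame sampleCmd s s' → P.InState s' := fun s' hf =>
    hP.frame hf (by decide) (by decide)
  refine wp_for_const P.M (P.d * 4 + 2) (fun r s' => s'.pos = r * P.d ∧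
    ∀ r' < r, ∀ u < P.d, s'.reals 3 r' u = ω (r' * P.d + u) / P.scale)
    (fun s' hf => by simpa using (hPs s' hf).M) (by decide) (by simpa using hpos) ?_ ?_
  · rintro r hr s₁ hf₁ hr₁ ⟨hp, hinv⟩
    have hPs₁ := hPs s₁ hf₁
    refine wp_for_const P.d 2 (fun u s' => s'.pos = r * P.d + u ∧
      (∀ r' < r, ∀ u < P.d, s'.reals 3 r' u = ω (r' * P.d + u) / P.scale) ∧
      ∀ u' < u, s'.reals 3 r u' = ω (r * P.d + u') / P.scale)
      (fun s' hf => by simpa using (hPs₁.frame hf (by decide) (by decide)).d) (by decide)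
      (by simp [hp]; exact hinv) ?_ ?_
    · rintro u hu s₂ hf₂ hu₂ ⟨hp₂, hi₂, hj₂⟩
      have hPs₂ : P.InState s₂ := hPs₁.frame hf₂ (by decide) (by decide)
      have hr₂ : s₂.ints 14 0 0 = r := by rw [hf₂.ints 14 (by decide), hr₁]
      simp only [wp_seq, wp_gauss, wp_setR]
      refine ⟨⟨?_, ?_, ?_⟩, by omega⟩
      · simp [hp₂]; ring
      · intro r' hr' u' hu'
        have : (r' : ℤ) ≠ r := by exact_mod_cast hr'.ne
        simp [hr₂, this, hi₂ r' hr' u' hu']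
      · intro u' hu'
        simp [hr₂, hu₂]
        split_ifs with h
        · have : u' = u := by exact_mod_cast h
          simp [hPs₂.scale, hp₂, this]
        · exact hj₂ u' (by have : u' ≠ u := fun hh => h (by simp [hh])
                           omega)
    · rintro s' t hf ⟨hp₂, hi₂, hj₂⟩ ht
      refine ⟨⟨?_, ?_⟩, by omega⟩
      · simp [hp₂]; ring
      · intro r' hr' u hu
        rcases Nat.lt_succ_iff_lt_or_eq.mp hr' with h | rfl
        · exact hi₂ r' h u hu
        · exact hj₂ u hu
  · rintro s' t hf ⟨_, hinv⟩ ht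
    exact hQ s' t hf hinv (by simpa using ht)

/-- The Gram matrix of the columns of the first `N` rows of `A`. -/
noncomputable def gram (N : ℕ) (A : ℕ → ℕ → ℝ) (u v : ℕ) : ℝ :=
  ∑ r ∈ Finset.range N, A r u * A r v

/-- Iterated Gram matrices. -/
noncomputable def gramSeq (M d : ℕ) (A : ℕ → ℕ → ℝ) : ℕ → ℕ → ℕ → ℝ
  | 0 => A
  | t + 1 => gram (if t = 0 then M else d) (gramSeq M d A t)

/-- The new matrix is written below the rows in use, so all earlier matrices survive; in particular
the sampled matrix does, which is still needed for projections. -/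
theorem wp_gramCmd (hP : P.InState s) (b h : ℕ) (A : ℕ → ℕ → ℝ)
    (hb : s.ints vBase 0 0 = b) (hh : s.ints vHeight 0 0 = h)
    (hA : ∀ r < h, ∀ u < P.d, s.reals rMat (b + r : ℕ) u = A r u)
    (hQ : ∀ s' t, Frame gramCmd s s' → s'.ints vBase 0 0 = (b + h : ℕ) →
      s'.ints vHeight 0 0 = P.d →
      (∀ u < P.d, ∀ v < P.d, s'.reals rMat (b + h + u : ℕ) v = gram h A u v) →
      (∀ i < b + h, ∀ j, s'.reals rMat (i : ℕ) j = s.reals rMat (i : ℕ) j) →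
      t ≤ P.d * (P.d * (3 * h + 6) + 4) + 4 → Q s' t) :
    wp ω gramCmd s Q := by
  refine (wp.frame (Q := fun s' t => Frame gramCmd s s' → Q s' t) ?_).mono fun _ _ h => h.2 h.1
  rw [gramCmd, wp_seq]
  refine wp_for_const P.d (P.d * (3 * h + 6) + 2) (fun u s' =>
    (∀ u' < u, ∀ v < P.d, s'.reals 3 (b + h + u' : ℕ) v = gram h A u' v) ∧
    (∀ i < b + h, ∀ j, s'.reals 3 (i : ℕ) j = s.reals 3 (i : ℕ) j))
    (fun s' hf => by simpa using (hP.frame hf (by decide) (by decide)).d) (by decide)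
    (by simp) ?_ ?_
  · rintro u hu s₁ hf₁ hu₁ ⟨hi₁, hj₁⟩
    have hP₁ : P.InState s₁ := hP.frame hf₁ (by decide) (by decide)
    refine wp_for_const P.d (3 * h + 4) (fun v s' =>
      (∀ u' < u, ∀ v < P.d, s'.reals 3 (b + h + u' : ℕ) v = gram h A u' v) ∧
      (∀ v' < v, s'.reals 3 (b + h + u : ℕ) v' = gram h A u v') ∧
      (∀ i < b + h, ∀ j, s'.reals 3 (i : ℕ) j = s.reals 3 (i : ℕ) j))
      (fun s' hf => by simpa using (hP₁.frame hf (by decide) (by decide)).d) (by decide)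
      (by simp only [State.setI_reals]; exact ⟨hi₁, by simp, hj₁⟩) ?_ ?_
    · rintro v hv s₂ hf₂ hv₂ ⟨hi₂, hk₂, hj₂⟩
      have hb₂ : s₂.ints 8 0 0 = b := by
        rw [hf₂.ints 8 (by decide), hf₁.ints 8 (by decide), hb]
      have hh₂ : s₂.ints 9 0 0 = h := by
        rw [hf₂.ints 9 (by decide), hf₁.ints 9 (by decide), hh]
      have hu₂ : s₂.ints 15 0 0 = u := by rw [hf₂.ints 15 (by decide), hu₁]
      rw [wp_seq]
      refine wp_sumLoop h (fun r => A r u * A r v)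
        (fun s' hf => by simp [hf.ints 9 (by decide), hh₂]) ?_ ?_
      · intro r hr s' hf hr'
        have e : (b : ℤ) + r = (b + r : ℕ) := by simp
        simp only [RExpr.eval, IExpr.eval, iv_eval]
        rw [hf.reals 3 (by decide), hf.ints 8 (by decide), hf.ints 15 (by decide),
          hf.ints 16 (by decide), hb₂, hu₂, hv₂, hr', e, hj₂ _ (by omega), hj₂ _ (by omega),
          hA r hr u hu, hA r hr v hv]
      · intro s₃ t₃ hf₃ hs₃ ht₃
        have e : (b : ℤ) + h + u = (b + h + u : ℕ) := by simp
        rw [wp_setR]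
        simp only [IExpr.eval, iv_eval, rv_eval, State.setI_reals, State.setR_reals]
        rw [hf₃.reals 3 (by decide), hf₃.ints 8 (by decide), hf₃.ints 9 (by decide),
          hf₃.ints 15 (by decide), hf₃.ints 16 (by decide), hb₂, hh₂, hu₂, hv₂, hs₃, e]
        refine ⟨⟨?_, ?_, ?_⟩, by omega⟩
        · intro u' hu' v' hv'
          rw [if_neg, hi₂ u' hu' v' hv']
          simp; omega
        · intro v' hv'
          split_ifs with hc
          · have : v' = v := by exact_mod_cast hc.2.2
            rw [this, gram]
          · exact hk₂ v' (by
              have : v' ≠ v := fun hh => hc (by simp [hh])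
              omega)
        · intro i hi j
          rw [if_neg, hj₂ i hi j]
          push Not
          intro _ hc
          norm_cast at hc; omega
    · rintro s' t hf ⟨hi₂, hk₂, hj₂⟩ ht
      refine ⟨⟨?_, hj₂⟩, by simpa using ht⟩
      intro u' hu' v hv
      rcases Nat.lt_succ_iff_lt_or_eq.mp hu' with h | rfl
      · exact hi₂ u' h v hv
      · exact hk₂ v hv
  · rintro s₁ t₁ hf₁ ⟨hi₁, hj₁⟩ ht₁
    simp only [wp_seq, wp_assignI]
    intro hf
    have hP₁ : P.InState s₁ := hP.frame hf₁ (by decide) (by decide)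
    refine hQ _ _ hf ?_ ?_ ?_ ?_ ?_
    · simp [hf₁.ints 8 (by decide), hf₁.ints 9 (by decide), hb, hh]
    · simp [hP₁.d]
    · exact hi₁
    · exact hj₁
    · linarith

theorem wp_traceCmd (hP : P.InState s) (A : ℕ → ℕ → ℝ)
    (hA : ∀ r < P.M, ∀ u < P.d, s.reals rMat r u = A r u)
    (hQ : ∀ s' t, Frame traceCmd s s' →
      s'.reals rAcc 0 0 = ∑ u ∈ Finset.range P.d, gramSeq P.M P.d A (P.l + 1) u u →
      (∀ r < P.M, ∀ u < P.d, s'.reals rMat r u = A r u) →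
      t ≤ (P.l + 1) * (P.d * (P.d * (3 * (P.M + P.d) + 6) + 4) + 6) + 3 * P.d + 7 → Q s' t) :
    wp ω traceCmd s Q := by
  refine (wp.frame (Q := fun s' t => Frame traceCmd s s' → Q s' t) ?_).mono fun _ _ h => h.2 h.1
  simp only [traceCmd, wp_seq, wp_assignI]
  -- The current matrix starts at row `b`. The inequality `M ≤ b + height` places the next one
  -- beyond the rows of `A`.
  refine wp_for_const (P.l + 1) (P.d * (P.d * (3 * (P.M + P.d) + 6) + 4) + 4) (fun t s' =>
    P.InState s' ∧ (∀ r < P.M, ∀ u < P.d, s'.reals 3 r u = A r u) ∧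
    s'.ints 9 0 0 = ((if t = 0 then P.M else P.d : ℕ) : ℤ) ∧
    ∃ b : ℕ, s'.ints 8 0 0 = b ∧ P.M ≤ b + (if t = 0 then P.M else P.d) ∧
      (∀ r < (if t = 0 then P.M else P.d), ∀ u < P.d,
        s'.reals 3 (b + r : ℕ) u = gramSeq P.M P.d A t r u)) ?_ (by decide) ?_ ?_ ?_
  · intro s' hf
    have : s'.ints 1 0 0 = P.l := by
      rw [hf.ints 1 (by decide)]; simp [hP.l]
    simp [this]
  · have hPM : P.InState (((s.setI 8 0 0 0).setI 9 0 0 P.M).setI 17 0 0 0) := by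
      constructor <;> simp [hP.n, hP.d, hP.l, hP.k, hP.L, hP.R, hP.J, hP.M, hP.c, hP.unit,
        hP.scale]
      exact hP.X
    have e : (iv 7).eval (s.setI 8 0 0 (IExpr.eval s (.lit 0))) = P.M := by simp [hP.M]
    rw [e]
    refine ⟨hPM, ?_, by simp, 0, by simp, by simp, ?_⟩
    · simpa using hA
    · simpa [gramSeq] using hA
  · rintro t ht s₁ hf₁ ht₁ ⟨hP₁, hA₁, hh₁, b, hb₁, hMb, hG₁⟩
    refine wp_gramCmd hP₁ b _ _ hb₁ hh₁ hG₁ ?_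
    intro s₂ t₂ hf₂ hb₂ hh₂ hG₂ hj₂ ht₂
    refine ⟨⟨?_, ?_, ?_, ?_⟩, ?_⟩
    · have hP₂ : P.InState s₂ := hP₁.frame hf₂ (by decide) (by decide)
      constructor <;> simp [hP₂.n, hP₂.d, hP₂.l, hP₂.k, hP₂.L, hP₂.R, hP₂.J, hP₂.M, hP₂.c,
        hP₂.unit, hP₂.scale]
      exact hP₂.X
    · intro r hr u hu
      rw [State.setI_reals, hj₂ r (by omega), hA₁ r hr u hu]
    · simp [hh₂]
    · refine ⟨_, by rw [State.setI_ints, if_neg (by decide), hb₂], by simp; omega, ?_⟩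
      intro r hr u hu
      simp only [Nat.add_eq_zero_iff, one_ne_zero, and_false, if_false] at hr
      exact hG₂ r hr u hu
    · refine ht₂.trans ?_
      gcongr
      split_ifs <;> omega
  · rintro s₁ t₁ hf₁ ⟨hP₁, hA₁, hh₁, b, hb₁, hMb, hG₁⟩ ht₁
    refine wp_sumLoop P.d (fun u => gramSeq P.M P.d A (P.l + 1) u u)
      (fun s' hf => by simp [hf.ints 0 (by decide), hP₁.d]) ?_ ?_
    · intro u hu s' hf hu'
      have e : (b : ℤ) + u = (b + u : ℕ) := by simp
      simp only [RExpr.eval, IExpr.eval, iv_eval]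
      rw [hf.reals 3 (by decide), hf.ints 8 (by decide), hu', hb₁, e]
      exact hG₁ u (by simpa using hu) u hu
    · intro s₂ t₂ hf₂ hs₂ ht₂ hf
      refine hQ s₂ _ hf hs₂ ?_ ?_
      · intro r hr u hu
        rw [hf₂.reals 3 (by decide), hA₁ r hr u hu]
      · linarith

/-! ## Profiles -/

/-- The profiles with `t` windows of length `k`: profile number `a` is given by the `t` digits of
`a` in base `L`, which are the left ends of the windows, and its value at `i` is one more than the
number of windows that contain `i`. -/
noncomputable def profile (L k : ℕ) : ℕ → ℕ → ℕ → ℝ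
  | 0, _, _ => 1
  | t + 1, a, i => profile L k t (a / L) i + if a % L ≤ i ∧ i < a % L + k then 1 else 0

/-- Each generation is written after the previous one. The old row `a`, extended by a window
starting at `b`, becomes the new row `a * L + b`, in accordance with the base `L` digits in
`profile`. -/
theorem wp_profileCmd (hP : P.InState s) (hL : 1 ≤ P.L)
    (hQ : ∀ s' t, Frame profileCmd s s' →
      (∃ lo : ℕ, s'.ints vLow 0 0 = lo ∧ ∀ a < P.L ^ P.R, ∀ i < P.L,
        s'.reals rProf (lo + a : ℕ) i = profile P.L P.k P.R a i) →
      s'.ints vSize 0 0 = (P.L ^ P.R : ℕ) →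
      t ≤ P.R * (P.L ^ P.R * (P.L * (4 * P.L + 5) + 4) + 6) + 3 * P.L + 7 → Q s' t) :
    wp ω profileCmd s Q := by
  refine (wp.frame (Q := fun s' t => Frame profileCmd s s' → Q s' t) ?_).mono
    fun _ _ h => h.2 h.1
  simp only [profileCmd, wp_seq, wp_assignI]
  set s₀ := ((s.setI 10 0 0 (IExpr.eval s (.lit 0))).setI 12 0 0
    (IExpr.eval (s.setI 10 0 0 (IExpr.eval s (.lit 0))) (.lit 1))) with hs₀
  have hPs : P.InState (s₀.setI 11 0 0 (IExpr.eval s₀ (.lit 1))) := by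
    constructor <;> simp [hs₀, hP.n, hP.d, hP.l, hP.k, hP.L, hP.R, hP.J, hP.M, hP.c, hP.unit,
      hP.scale]
    exact hP.X
  refine wp_for_const P.L 1 (fun i s' => ∀ i' < i, s'.reals 4 0 i' = 1)
    (fun s' hf => by simpa using (hPs.frame hf (by decide) (by decide)).L) (by decide)
    (by simp) ?_ ?_
  · intro i hi s₁ hf₁ hi₁ hinv
    simp only [wp_setR, IExpr.eval, iv_eval, RExpr.eval, hi₁, State.setI_reals, State.setR_reals,
      le_refl, and_true]
    intro i' hi'
    split_ifs with hc
    · rfl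
    · exact hinv i' (by
        have : i' ≠ i := fun hh => hc (by simp [hh])
        omega)
  intro s₁ t₁ hf₁ hi₁ ht₁
  have hP₁ : P.InState s₁ := hPs.frame hf₁ (by decide) (by decide)
  refine wp_for_const P.R (P.L ^ P.R * (P.L * (4 * P.L + 5) + 4) + 4) (fun t s' =>
    s'.ints 12 0 0 = (P.L ^ t : ℕ) ∧ ∃ lo : ℕ, s'.ints 10 0 0 = lo ∧
      s'.ints 11 0 0 = (lo + P.L ^ t : ℕ) ∧
      ∀ a < P.L ^ t, ∀ i < P.L, s'.reals 4 (lo + a : ℕ) i = profile P.L P.k t a i)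
    (fun s' hf => by simpa using (hP₁.frame hf (by decide) (by decide)).R) (by decide) ?_ ?_ ?_
  · simp only [State.setI_ints, State.setI_reals]
    rw [hf₁.ints 12 (by decide), hf₁.ints 10 (by decide), hf₁.ints 11 (by decide)]
    simp only [hs₀, State.setI_ints, IExpr.eval]
    refine ⟨by simp, 0, by simp, by simp, ?_⟩
    intro a ha i hi
    have : a = 0 := by simpa using ha
    simp only [this, Nat.add_zero, profile, Nat.cast_zero]
    exact hi₁ i hi
  · rintro t ht s₂ hf₂ ht₂ ⟨hsz₂, lo, hlo₂, hhi₂, hV₂⟩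
    have hP₂ : P.InState s₂ := hP₁.frame hf₂ (by decide) (by decide)
    rw [wp_seq]
    refine wp_for_const (P.L ^ t) (P.L * (4 * P.L + 5) + 2) (fun a s' =>
      s'.ints 11 0 0 = (lo + P.L ^ t + a * P.L : ℕ) ∧
      (∀ a < P.L ^ t, ∀ i < P.L, s'.reals 4 (lo + a : ℕ) i = profile P.L P.k t a i) ∧
      (∀ a' < a * P.L, ∀ i < P.L,
        s'.reals 4 (lo + P.L ^ t + a' : ℕ) i = profile P.L P.k (t + 1) a' i))
      (fun s' hf => by simp [hf.ints 12 (by decide), hsz₂]) (by decide)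
      ⟨by simp [hhi₂], hV₂, by simp⟩ ?_ ?_
    · rintro a ha s₃ hf₃ ha₃ ⟨hhi₃, hV₃, hW₃⟩
      have hP₃ : P.InState s₃ := hP₂.frame hf₃ (by decide) (by decide)
      have hlo₃ : s₃.ints 10 0 0 = lo := by rw [hf₃.ints 10 (by decide), hlo₂]
      refine wp_for_const P.L (4 * P.L + 3) (fun b s' =>
        s'.ints 11 0 0 = (lo + P.L ^ t + (a * P.L + b) : ℕ) ∧
        (∀ a < P.L ^ t, ∀ i < P.L, s'.reals 4 (lo + a : ℕ) i = profile P.L P.k t a i) ∧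
        (∀ a' < a * P.L + b, ∀ i < P.L,
          s'.reals 4 (lo + P.L ^ t + a' : ℕ) i = profile P.L P.k (t + 1) a' i))
        (fun s' hf => by simpa using (hP₃.frame hf (by decide) (by decide)).L) (by decide)
        ⟨by simpa using hhi₃, hV₃, hW₃⟩ ?_ ?_
      · rintro b hb s₄ hf₄ hb₄ ⟨hhi₄, hV₄, hW₄⟩
        have hP₄ : P.InState s₄ := hP₃.frame hf₄ (by decide) (by decide)
        have hlo₄ : s₄.ints 10 0 0 = lo := by rw [hf₄.ints 10 (by decide), hlo₃]
        have ha₄ : s₄.ints 18 0 0 = a := by rw [hf₄.ints 18 (by decide), ha₃]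
        rw [wp_seq]
        refine wp_for_const P.L 2 (fun i s' =>
          (∀ a < P.L ^ t, ∀ i < P.L, s'.reals 4 (lo + a : ℕ) i = profile P.L P.k t a i) ∧
          (∀ a' < a * P.L + b, ∀ i < P.L,
            s'.reals 4 (lo + P.L ^ t + a' : ℕ) i = profile P.L P.k (t + 1) a' i) ∧
          ∀ i' < i, s'.reals 4 (lo + P.L ^ t + (a * P.L + b) : ℕ) i' =
            profile P.L P.k (t + 1) (a * P.L + b) i')
          (fun s' hf => by simpa using (hP₄.frame hf (by decide) (by decide)).L) (by decide)
          ⟨hV₄, hW₄, by simp⟩ ?_ ?_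
        · rintro i hi s₅ hf₅ hi₅ ⟨hV₅, hW₅, hU₅⟩
          have hP₅ : P.InState s₅ := hP₄.frame hf₅ (by decide) (by decide)
          have hlo₅ : s₅.ints 10 0 0 = lo := by rw [hf₅.ints 10 (by decide), hlo₄]
          have hhi₅ : s₅.ints 11 0 0 = (lo + P.L ^ t + (a * P.L + b) : ℕ) := by
            rw [hf₅.ints 11 (by decide), hhi₄]
          have ha₅ : s₅.ints 18 0 0 = a := by rw [hf₅.ints 18 (by decide), ha₄]
          have hb₅ : s₅.ints 19 0 0 = b := by rw [hf₅.ints 19 (by decide), hb₄]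
          have hdiv : (a * P.L + b) / P.L = a := by
            rw [mul_comm, Nat.mul_add_div (by omega), Nat.div_eq_of_lt hb]; simp
          have hmod : (a * P.L + b) % P.L = b := by
            rw [mul_comm, Nat.mul_add_mod, Nat.mod_eq_of_lt hb]
          have hold : s₅.reals 4 ((lo : ℤ) + a) i = profile P.L P.k t a i := by
            have := hV₅ a ha i hi
            rwa [Nat.cast_add] at this
          -- all branches write the same cell
          have key : ∀ v, v = profile P.L P.k (t + 1) (a * P.L + b) i →
              (∀ a' < P.L ^ t, ∀ i' < P.L,
                ((s₅.setR 4 (lo + P.L ^ t + (a * P.L + b) : ℕ) i v).setI 20 0 0 (i + 1)).reals 4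
                  (lo + a' : ℕ) i' = profile P.L P.k t a' i') ∧
              (∀ a' < a * P.L + b, ∀ i' < P.L,
                ((s₅.setR 4 (lo + P.L ^ t + (a * P.L + b) : ℕ) i v).setI 20 0 0 (i + 1)).reals 4
                  (lo + P.L ^ t + a' : ℕ) i' = profile P.L P.k (t + 1) a' i') ∧
              ∀ i' < i + 1,
                ((s₅.setR 4 (lo + P.L ^ t + (a * P.L + b) : ℕ) i v).setI 20 0 0 (i + 1)).reals 4
                  (lo + P.L ^ t + (a * P.L + b) : ℕ) i' =
                  profile P.L P.k (t + 1) (a * P.L + b) i' := by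
            intro v hv
            simp only [State.setI_reals, State.setR_reals]
            refine ⟨?_, ?_, ?_⟩
            · intro a' ha' i' hi'
              rw [if_neg, hV₅ a' ha' i' hi']
              push Not; intro _ hc; norm_cast at hc; omega
            · intro a' ha' i' hi'
              rw [if_neg, hW₅ a' ha' i' hi']
              push Not; intro _ hc; norm_cast at hc; omega
            · intro i' hi'
              split_ifs with hc
              · have : i' = i := by exact_mod_cast hc.2.2
                rw [hv, this]
              · exact hU₅ i' (by
                  have : i' ≠ i := fun hh => hc (by simp [hh])
                  omega)
          rw [wp_ite]
          simp only [wp_setR, Test.holds, IExpr.eval, iv_eval, RExpr.eval, hhi₅, hi₅, hb₅, hlo₅,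
            ha₅, hP₅.k, hold]
          refine ⟨fun hc => ⟨key _ ?_, by omega⟩, fun hc => ⟨key _ ?_, by omega⟩⟩
          · rw [profile, hdiv, hmod, if_pos]; omega
          · rw [profile, hdiv, hmod, if_neg, add_zero]; omega
        · rintro s₅ t₅ hf₅ ⟨hV₅, hW₅, hU₅⟩ ht₅
          rw [wp_assignI]
          refine ⟨⟨?_, hV₅, ?_⟩, by omega⟩
          · simp [hf₅.ints 11 (by decide), hhi₄]; ring
          · intro a' ha' i hi
            rcases Nat.lt_succ_iff_lt_or_eq.mp (show a' < (a * P.L + b) + 1 by omega) with h | rfl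
            · exact hW₅ a' h i hi
            · exact hU₅ i hi
      · rintro s₄ t₄ hf₄ ⟨hhi₄, hV₄, hW₄⟩ ht₄
        have e : (a + 1) * P.L = a * P.L + P.L := by ring
        rw [e]
        exact ⟨⟨by simpa using hhi₄, hV₄, hW₄⟩, by linarith⟩
    · rintro s₃ t₃ hf₃ ⟨hhi₃, hV₃, hW₃⟩ ht₃
      simp only [wp_seq, wp_assignI]
      have hlo₃ : s₃.ints 10 0 0 = lo := by rw [hf₃.ints 10 (by decide), hlo₂]
      have hsz₃ : s₃.ints 12 0 0 = (P.L ^ t : ℕ) := by rw [hf₃.ints 12 (by decide), hsz₂]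
      refine ⟨⟨?_, lo + P.L ^ t, ?_, ?_, ?_⟩, ?_⟩
      · simp [hlo₃, hsz₃, hhi₃, pow_succ]
      · simp [hlo₃, hsz₃]
      · simp [hhi₃, pow_succ]
      · rw [pow_succ]; exact hW₃
      · have : P.L ^ t ≤ P.L ^ P.R := Nat.pow_le_pow_right hL ht.le
        have := Nat.mul_le_mul_right (P.L * (4 * P.L + 5) + 4) this
        linarith
  · rintro s₂ t₂ hf₂ ⟨hsz₂, lo, hlo₂, hhi₂, hV₂⟩ ht₂ hf
    refine hQ _ _ hf ⟨lo, hlo₂, hV₂⟩ hsz₂ ?_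
    linarith

/-! ## Tries -/

/-- The node that is reached from `u` along a list of labels. -/
def walk (T : ℤ → ℤ → ℤ) (u : ℤ) (zs : List ℤ) : ℤ := zs.foldl T u

@[simp] theorem walk_nil (T : ℤ → ℤ → ℤ) (u : ℤ) : walk T u [] = u := rfl

@[simp] theorem walk_concat (T : ℤ → ℤ → ℤ) (u : ℤ) (zs : List ℤ) (z : ℤ) :
    walk T u (zs ++ [z]) = T (walk T u zs) z := by
  simp [walk]

/-- `T` is a forest, whose nodes that are not roots are numbered from `1` to `m`. -/
structure IsTrie (T : ℤ → ℤ → ℤ) (m : ℤ) : Prop where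
  count_nonneg : 0 ≤ m
  nonneg : ∀ u z, 0 ≤ T u z
  le : ∀ u z, T u z ≤ m
  inj : ∀ u z u' z', T u z = T u' z' → T u z ≠ 0 → u = u' ∧ z = z'
  src : ∀ u z, T u z ≠ 0 → u ≠ 0 ∧ u ≤ m

/-- The trie `T'` arises from `T` by adding nodes whose numbers exceed `m`. -/
structure Extends (T : ℤ → ℤ → ℤ) (m : ℤ) (T' : ℤ → ℤ → ℤ) (m' : ℤ) : Prop where
  le : m ≤ m'
  old : ∀ u z, T u z ≠ 0 → T' u z = T u z
  new : ∀ u z, T u z = 0 → T' u z = 0 ∨ m < T' u z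

theorem Extends.refl (T : ℤ → ℤ → ℤ) (m : ℤ) : Extends T m T m :=
  ⟨le_rfl, fun _ _ _ => rfl, fun _ _ h => Or.inl h⟩

theorem Extends.trans {T T' T'' : ℤ → ℤ → ℤ} {m m' m'' : ℤ} (hT' : IsTrie T m)
    (h : Extends T m T' m') (h' : Extends T' m' T'' m'') : Extends T m T'' m'' := by
  refine ⟨h.le.trans h'.le, ?_, ?_⟩
  · intro u z hu
    have := h.old u z hu
    rw [h'.old u z (by rwa [this]), this]
  · intro u z hu
    rcases h.new u z hu with h0 | h0
    · rcases h'.new u z h0 with h1 | h1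
      · exact Or.inl h1
      · exact Or.inr (h.le.trans_lt h1)
    · right
      rwa [h'.old u z (by have := hT'.count_nonneg; omega)]

/-- A missing child is encoded by `0`; hence a walk that leaves the trie stays at `0`. -/
theorem IsTrie.zero {T : ℤ → ℤ → ℤ} {m : ℤ} (h : IsTrie T m) (z : ℤ) : T 0 z = 0 := by
  by_contra hc
  exact (h.src 0 z hc).1 rfl

theorem IsTrie.walk_le {T : ℤ → ℤ → ℤ} {m : ℤ} (h : IsTrie T m) {r : ℤ} (hr : r < 0)
    (zs : List ℤ) : walk T r zs ≤ m := by
  induction zs using List.reverseRecOn with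
  | nil => have := h.count_nonneg; simp; omega
  | append_singleton zs z _ => rw [walk_concat]; exact h.le _ _

/-- Every node has a unique parent and label, so the path can be recovered from its end. The end
must be nonzero, as all failed walks meet at `0`. -/
theorem IsTrie.walk_inj {T : ℤ → ℤ → ℤ} {m : ℤ} (h : IsTrie T m) {r r' : ℤ} (zs : List ℤ) :
    ∀ zs' : List ℤ, zs.length = zs'.length → walk T r zs = walk T r' zs' → walk T r zs ≠ 0 →
      r = r' ∧ zs = zs' := by
  induction zs using List.reverseRecOn with
  | nil =>
    intro zs' hl he _
    obtain rfl : zs' = [] := by simpa using hl.symm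
    exact ⟨he, rfl⟩
  | append_singleton zs z ih =>
    intro zs' hl he h0
    induction zs' using List.reverseRecOn with
    | nil => simp at hl
    | append_singleton zs' z' _ =>
      rw [walk_concat, walk_concat] at he
      rw [walk_concat] at h0
      obtain ⟨h1, rfl⟩ := h.inj _ _ _ _ he h0
      obtain ⟨h2, rfl⟩ := ih zs' (by simpa using hl) h1 (h.src _ _ h0).1
      exact ⟨h2, rfl⟩

/-- Successful walks are unaffected by new nodes. A walk that used to fail can now only end at `0`
or at a new node, because nodes numbered above `m` had no children in `T`. -/
theorem Extends.walk {T T' : ℤ → ℤ → ℤ} {m m' : ℤ} (h : Extends T m T' m') (hT : IsTrie T m)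
    (hT' : IsTrie T' m') (r : ℤ) (zs : List ℤ) :
    walk T' r zs = walk T r zs ∨ walk T r zs = 0 ∧ (walk T' r zs = 0 ∨ m < walk T' r zs) := by
  induction zs using List.reverseRecOn with
  | nil => left; rfl
  | append_singleton zs z ih =>
    rw [walk_concat, walk_concat]
    rcases ih with ih | ⟨ih, ih'⟩
    · rw [ih]
      by_cases h0 : T (NearNeighbor.walk T r zs) z = 0
      · exact Or.inr ⟨h0, h.new _ _ h0⟩
      · exact Or.inl (h.old _ _ h0)
    · right
      rw [ih]
      refine ⟨hT.zero z, ?_⟩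
      rcases ih' with ih' | ih'
      · left; rw [ih', hT'.zero]
      · apply h.new
        by_contra hc
        have := (hT.src _ _ hc).2
        omega

theorem Extends.walk_eq {T T' : ℤ → ℤ → ℤ} {m m' : ℤ} (h : Extends T m T' m') (hT : IsTrie T m)
    (hT' : IsTrie T' m') {r : ℤ} {zs : List ℤ} (h0 : NearNeighbor.walk T r zs ≠ 0) :
    NearNeighbor.walk T' r zs = NearNeighbor.walk T r zs := by
  rcases h.walk hT hT' r zs with h | h
  · exact h
  · exact absurd h.1 h0

theorem IsTrie.add {T T' : ℤ → ℤ → ℤ} {m u z : ℤ} (h : IsTrie T m) (hu : u ≠ 0) (hum : u ≤ m)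
    (h0 : T u z = 0)
    (hT' : ∀ u' z', T' u' z' = if u' = u ∧ z' = z then m + 1 else T u' z') :
    IsTrie T' (m + 1) ∧ Extends T m T' (m + 1) := by
  have hm := h.count_nonneg
  refine ⟨⟨by omega, ?_, ?_, ?_, ?_⟩, by omega, ?_, ?_⟩
  · intro u' z'; rw [hT']; split_ifs
    · omega
    · exact h.nonneg _ _
  · intro u' z'; rw [hT']; split_ifs
    · omega
    · have := h.le u' z'; omega
  · intro u₁ z₁ u₂ z₂
    rw [hT', hT']
    have h1 := h.le u₁ z₁
    have h2 := h.le u₂ z₂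
    split_ifs with c₁ c₂ c₂
    · intro _ _; exact ⟨c₁.1.trans c₂.1.symm, c₁.2.trans c₂.2.symm⟩
    · intro hc; omega
    · intro hc; omega
    · exact h.inj _ _ _ _
  · intro u' z'; rw [hT']; split_ifs with hc
    · intro _; rw [hc.1]; exact ⟨hu, by omega⟩
    · intro hn; have := h.src u' z' hn; exact ⟨this.1, by omega⟩
  · intro u' z' hn
    rw [hT', if_neg]
    rintro ⟨rfl, rfl⟩; exact hn h0
  · intro u' z' hn
    rw [hT']; split_ifs
    · right; omega
    · exact Or.inl hn

/-! ## Neighbouring labels -/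

/-- The sequences of length `i` of labels that differ from `h` by at most one everywhere. -/
def nbrs (h : ℕ → ℤ) : ℕ → List (List ℤ)
  | 0 => [[]]
  | i + 1 => (nbrs h i).flatMap fun zs => [zs ++ [h i - 1], zs ++ [h i], zs ++ [h i + 1]]

theorem length_nbrs (h : ℕ → ℤ) (i : ℕ) : (nbrs h i).length = 3 ^ i := by
  induction i with
  | zero => rfl
  | succ i ih => simp [nbrs, List.length_flatMap, ih, pow_succ]

theorem length_of_mem_nbrs (h : ℕ → ℤ) (i : ℕ) : ∀ zs ∈ nbrs h i, zs.length = i := by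
  induction i with
  | zero => simp [nbrs]
  | succ i ih =>
    intro zs hzs
    simp only [nbrs, List.mem_flatMap, List.mem_cons, List.not_mem_nil, or_false] at hzs
    obtain ⟨ws, hws, rfl | rfl | rfl⟩ := hzs <;> simp [ih ws hws]

theorem nodup_nbrs (h : ℕ → ℤ) (i : ℕ) : (nbrs h i).Nodup := by
  induction i with
  | zero => simp [nbrs]
  | succ i ih =>
    rw [nbrs, List.nodup_flatMap]
    refine ⟨?_, ih.imp ?_⟩
    · intro zs _
      simp
      omega
    · intro zs ws hne
      simp only [Function.onFun, List.disjoint_left]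
      intro us h1 h2
      apply hne
      simp only [List.mem_cons, List.not_mem_nil, or_false] at h1 h2
      rcases h1 with rfl | rfl | rfl <;> rcases h2 with h2 | h2 | h2 <;>
        exact (List.append_inj' h2 rfl).1

/-- A point with labels `h` is stored along all sequences in `nbrs`, and a query follows only its
own sequence `g`; this is the criterion for the query to find the point. -/
theorem map_mem_nbrs (h g : ℕ → ℤ) (i : ℕ) :
    (List.range i).map g ∈ nbrs h i ↔ ∀ j < i, |g j - h j| ≤ 1 := by
  induction i with
  | zero => simp [nbrs]
  | succ i ih =>
    have key : (List.range (i + 1)).map g ∈ nbrs h (i + 1) ↔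
        (List.range i).map g ∈ nbrs h i ∧ |g i - h i| ≤ 1 := by
      rw [List.range_succ, List.map_append, nbrs]
      simp only [List.mem_flatMap, List.mem_cons, List.not_mem_nil, or_false, List.map_cons,
        List.map_nil]
      constructor
      · rintro ⟨zs, hzs, hh⟩
        rcases hh with hh | hh | hh <;> obtain ⟨rfl, h2⟩ := List.append_inj' hh rfl <;>
          refine ⟨hzs, ?_⟩ <;> simp only [List.cons.injEq, and_true] at h2 <;> rw [h2, abs_le] <;>
          constructor <;> omega
      · rintro ⟨hzs, hh⟩
        refine ⟨_, hzs, ?_⟩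
        rw [abs_le] at hh
        have : g i = h i - 1 ∨ g i = h i ∨ g i = h i + 1 := by omega
        rcases this with e | e | e <;> simp [e]
    rw [key, ih]
    constructor
    · rintro ⟨h1, h2⟩ j hj
      rcases Nat.lt_succ_iff_lt_or_eq.mp hj with hj | rfl
      · exact h1 j hj
      · exact h2
    · intro hh
      exact ⟨fun j hj => hh j (by omega), hh i (by omega)⟩

/-! ## Stores of lists -/

/-- The row `row` of length `len` consists of the entries of `l`. -/
def RowIs (len : ℤ) (row : ℤ → ℤ) (l : List ℤ) : Prop :=
  len = l.length ∧ ∀ i (h : i < l.length), row i = l[i]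

/-- Row `i` of the frontier consists of the nodes that are reached along the label lists `l`. -/
def FrontIs (s : State) (r : ℤ) (i : ℕ) (l : List (List ℤ)) : Prop :=
  ∀ a (h : a < l.length), s.ints aFront i a = walk (s.ints aTrie) r l[a] ∧
    walk (s.ints aTrie) r l[a] ≠ 0

theorem FrontIs.mono {r : ℤ} {i : ℕ} {l : List (List ℤ)} (h : FrontIs s r i l)
    (hs : IsTrie (s.ints aTrie) (s.ints vCount 0 0))
    (hs' : IsTrie (s'.ints aTrie) (s'.ints vCount 0 0))
    (he : Extends (s.ints aTrie) (s.ints vCount 0 0) (s'.ints aTrie) (s'.ints vCount 0 0))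
    (hF : s'.ints aFront i = s.ints aFront i) : FrontIs s' r i l := by
  intro a ha
  obtain ⟨h1, h2⟩ := h a ha
  rw [hF, he.walk_eq hs hs' h2]
  exact ⟨h1, h2⟩

/-- Whether the child existed or is created by `IsTrie.add`, afterwards it is nonzero and the trie
has only grown; from there both branches are finished by `fin`. -/
theorem wp_childCmd {z : IExpr} (zv : ℤ) (i : ℕ) (r : ℤ) (hr : r < 0) (zs : List ℤ)
    (l : List (List ℤ)) (hz : ∀ s', Frame (childCmd z) s s' → z.eval s' = zv)
    (hT : IsTrie (s.ints aTrie) (s.ints vCount 0 0)) (hi : s.ints vI 0 0 = i)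
    (hl : s.ints vNext 0 0 = l.length) (hF : FrontIs s r (i + 1) l)
    (hn : s.ints vNode 0 0 = walk (s.ints aTrie) r zs) (hn0 : s.ints vNode 0 0 ≠ 0)
    (hQ : ∀ s' t, Frame (childCmd z) s s' → IsTrie (s'.ints aTrie) (s'.ints vCount 0 0) →
      Extends (s.ints aTrie) (s.ints vCount 0 0) (s'.ints aTrie) (s'.ints vCount 0 0) →
      s'.ints vNext 0 0 = (l ++ [zs ++ [zv]]).length → FrontIs s' r (i + 1) (l ++ [zs ++ [zv]]) →
      (∀ j : ℕ, j ≠ i + 1 → s'.ints aFront j = s.ints aFront j) → t ≤ 5 → Q s' t) :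
    wp ω (childCmd z) s Q := by
  refine (wp.frame (Q := fun s' t => Frame (childCmd z) s s' → Q s' t) ?_).mono
    fun _ _ h => h.2 h.1
  -- the effect of the last two commands
  have fin : ∀ s₁ (t₁ : ℕ), t₁ ≤ 3 → Frame (childCmd z) s s₁ →
      IsTrie (s₁.ints aTrie) (s₁.ints vCount 0 0) →
      Extends (s.ints aTrie) (s.ints vCount 0 0) (s₁.ints aTrie) (s₁.ints vCount 0 0) →
      s₁.ints aTrie (s.ints vNode 0 0) zv ≠ 0 → s₁.ints aFront = s.ints aFront →
      s₁.ints vNext = s.ints vNext →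
      wp ω (.seq (.setI aFront (.add (iv vI) (.lit 1)) (iv vNext) (.get aTrie (iv vNode) z))
        (assignI vNext (.add (iv vNext) (.lit 1)))) s₁
        (fun s' t => Frame (childCmd z) s s' → Q s' (t₁ + t)) := by
    intro s₁ t₁ ht₁ hf hT₁ hE hne hFr hNx
    simp only [wp_seq, wp_setI, wp_assignI]
    intro hf'
    have hE' : walk (s₁.ints 30) r zs = walk (s.ints 30) r zs :=
      hE.walk_eq hT hT₁ (by rw [← hn]; exact hn0)
    have e1 : s₁.ints 20 0 0 = i := by rw [hf.ints 20 (by simp [childCmd, Cmd.modI, assignI]), hi]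
    have e2 : s₁.ints 28 0 0 = l.length := by rw [hNx, hl]
    have e3 : s₁.ints 29 = s.ints 29 := hf.ints 29 (by simp [childCmd, Cmd.modI, assignI])
    have hF₁ : FrontIs s₁ r (i + 1) l := hF.mono hT hT₁ hE (by rw [hFr])
    have e : ((i : ℤ) + 1) = ((i + 1 : ℕ) : ℤ) := by simp
    refine hQ _ _ hf' ?_ ?_ ?_ ?_ ?_ (by omega)
    · simpa [State.setI_ints_ne] using hT₁
    · simpa [State.setI_ints_ne] using hE
    · simp [e2]
    · intro a ha
      simp only [List.length_append, List.length_singleton] at ha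
      simp only [IExpr.eval, iv_eval, hz s₁ hf, e1, e2, e3, State.setI_ints_ne _ _ _ _
        (show 30 ≠ 28 by decide), State.setI_ints_ne _ _ _ _ (show 30 ≠ 31 by decide),
        State.setI_ints_ne _ _ _ _ (show 31 ≠ 28 by decide)]
      rw [State.setI_ints, e]
      rcases Nat.lt_succ_iff_lt_or_eq.mp ha with h | rfl
      · rw [if_neg, List.getElem_append_left h]
        · exact hF₁ a h
        · push Not; intro _ _ hc; norm_cast at hc; omega
      · simp only [and_self, if_true, List.getElem_concat_length, walk_concat]
        rw [hE', ← hn]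
        exact ⟨rfl, hne⟩
    · intro j hj
      rw [State.setI_ints_ne _ _ _ _ (by decide)]
      funext b
      rw [State.setI_ints, if_neg, hFr]
      simp only [IExpr.eval, iv_eval, e1]
      push Not; intro _ hc; norm_cast at hc
  rw [childCmd, wp_seq, wp_ite]
  have hz0 := hz s (Frame.refl _ _)
  constructor
  · intro hb
    rw [wp_seq, wp_assignI, wp_setI]
    set s₁ := s.setI 23 0 0 ((iv 23).add (IExpr.lit 1) |>.eval s) with hs₁
    have hf₁ : Frame (childCmd z) s s₁ := by
      refine ⟨?_, fun _ _ => rfl, fun _ => rfl, fun _ => rfl⟩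
      intro a ha
      exact State.setI_ints_ne _ _ _ _ fun hc => ha (by simp [childCmd, Cmd.modI, assignI, hc])
    have hz₁ := hz s₁ hf₁
    have hf₂ : Frame (childCmd z) s
        (s₁.setI 30 (IExpr.eval s₁ (iv 29)) (IExpr.eval s₁ z) (IExpr.eval s₁ (iv 23))) := by
      refine hf₁.trans ⟨?_, fun _ _ => rfl, fun _ => rfl, fun _ => rfl⟩
      intro a ha
      exact State.setI_ints_ne _ _ _ _ fun hc => ha (by simp [childCmd, Cmd.modI, assignI, hc])
    have hb0 : s.ints 30 (s.ints 29 0 0) zv = 0 := by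
      have h1 := hT.nonneg (s.ints 29 0 0) zv
      simp [hz0] at hb
      omega
    have hle : s.ints 29 0 0 ≤ s.ints 23 0 0 := by rw [hn]; exact hT.walk_le hr zs
    have hadd := hT.add (T' := (s₁.setI 30 (IExpr.eval s₁ (iv 29)) (IExpr.eval s₁ z)
      (IExpr.eval s₁ (iv 23))).ints 30) hn0 hle hb0 (by
        intro u' z'
        rw [State.setI_ints, hz₁]
        simp [hs₁])
    have hcnt : (s₁.setI 30 (IExpr.eval s₁ (iv 29)) (IExpr.eval s₁ z)
      (IExpr.eval s₁ (iv 23))).ints 23 0 0 = s.ints 23 0 0 + 1 := by simp [hs₁]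
    refine fin _ 3 (by omega) hf₂ ?_ ?_ ?_ ?_ ?_
    · rw [hcnt]; exact hadd.1
    · rw [hcnt]; exact hadd.2
    · rw [State.setI_ints, hz₁]
      simp [hs₁]
      have := hT.count_nonneg; omega
    · rw [State.setI_ints_ne _ _ _ _ (by decide), hs₁, State.setI_ints_ne _ _ _ _ (by decide)]
    · rw [State.setI_ints_ne _ _ _ _ (by decide), hs₁, State.setI_ints_ne _ _ _ _ (by decide)]
  · intro hb
    rw [wp_skip]
    refine fin s 2 (by omega) (Frame.refl _ _) hT (Extends.refl _ _) ?_ rfl rfl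
    simp [hz0] at hb
    omega

/-! ## Insertion into the trie -/

/-- The label of the projection in `rProj` at coordinate `i` of the current block and profile. -/
noncomputable def labelAt (s : State) (i : ℕ) : ℤ :=
  ⌊s.reals rProj 0 (s.ints vOff 0 0 + i) /
    √(s.reals rProf (s.ints vLow 0 0 + s.ints vP 0 0) i * s.reals rUnit 0 0)⌋

theorem labelAt_congr (h5 : s'.reals rProj = s.reals rProj) (h4 : s'.reals rProf = s.reals rProf)
    (hu : s'.reals rUnit = s.reals rUnit) (ho : s'.ints vOff = s.ints vOff)
    (hl : s'.ints vLow = s.ints vLow) (hp : s'.ints vP = s.ints vP) :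
    labelAt s' = labelAt s := by
  funext i
  rw [labelAt, labelAt, h5, h4, hu, ho, hl, hp]

theorem labelE_eval {i : ℕ} (hi : s.ints vI 0 0 = i) : labelE.eval s = labelAt s i := by
  simp [labelE, labelAt, hi]

/-- After `a` iterations the next frontier consists of the children of the first `a` nodes. The
walks of the current frontier remain valid since the trie only grows. -/
theorem wp_expandCmd (i : ℕ) (r : ℤ) (hr : r < 0) (h : ℕ → ℤ) (hh : labelAt s i = h i)
    (hT : IsTrie (s.ints aTrie) (s.ints vCount 0 0)) (hi : s.ints vI 0 0 = i)
    (hl : s.ints vFront 0 0 = (nbrs h i).length) (hF : FrontIs s r i (nbrs h i))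
    (hQ : ∀ s' t, Frame expandCmd s s' → IsTrie (s'.ints aTrie) (s'.ints vCount 0 0) →
      Extends (s.ints aTrie) (s.ints vCount 0 0) (s'.ints aTrie) (s'.ints vCount 0 0) →
      s'.ints vFront 0 0 = (nbrs h (i + 1)).length → FrontIs s' r (i + 1) (nbrs h (i + 1)) →
      t ≤ 18 * 3 ^ i + 5 → Q s' t) :
    wp ω expandCmd s Q := by
  refine (wp.frame (Q := fun s' t => Frame expandCmd s s' → Q s' t) ?_).mono fun _ _ h => h.2 h.1
  simp only [expandCmd, wp_seq, wp_assignI]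
  rw [labelE_eval hi, hh]
  set step : List ℤ → List (List ℤ) := fun zs => [zs ++ [h i - 1], zs ++ [h i], zs ++ [h i + 1]]
    with hstep
  set s₀ := (s.setI 26 0 0 (h i)).setI 28 0 0 (IExpr.eval (s.setI 26 0 0 (h i)) (IExpr.lit 0))
    with hs₀
  have e30 : s₀.ints 30 = s.ints 30 := by
    rw [hs₀, State.setI_ints_ne _ _ _ _ (by decide), State.setI_ints_ne _ _ _ _ (by decide)]
  have e31 : s₀.ints 31 = s.ints 31 := by
    rw [hs₀, State.setI_ints_ne _ _ _ _ (by decide), State.setI_ints_ne _ _ _ _ (by decide)]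
  have e23 : s₀.ints 23 = s.ints 23 := by
    rw [hs₀, State.setI_ints_ne _ _ _ _ (by decide), State.setI_ints_ne _ _ _ _ (by decide)]
  have e20 : s₀.ints 20 = s.ints 20 := by
    rw [hs₀, State.setI_ints_ne _ _ _ _ (by decide), State.setI_ints_ne _ _ _ _ (by decide)]
  have e27 : s₀.ints 27 = s.ints 27 := by
    rw [hs₀, State.setI_ints_ne _ _ _ _ (by decide), State.setI_ints_ne _ _ _ _ (by decide)]
  have e26 : s₀.ints 26 0 0 = h i := by simp [hs₀]
  have e28 : s₀.ints 28 0 0 = 0 := by simp [hs₀]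
  refine wp_for_const (nbrs h i).length 16 (fun a s' =>
    IsTrie (s'.ints 30) (s'.ints 23 0 0) ∧
    Extends (s.ints 30) (s.ints 23 0 0) (s'.ints 30) (s'.ints 23 0 0) ∧
    s'.ints 28 0 0 = (((nbrs h i).take a).flatMap step).length ∧
    FrontIs s' r (i + 1) (((nbrs h i).take a).flatMap step) ∧ s'.ints 31 i = s.ints 31 i) 
    (fun s' hf => by simp [hf.ints 27 (by decide), e27, hl]) (by decide) ?_ ?_ ?_
  · simp only [State.setI_ints_ne _ _ _ _ (show 30 ≠ 18 by decide),
      State.setI_ints_ne _ _ _ _ (show 23 ≠ 18 by decide),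
      State.setI_ints_ne _ _ _ _ (show 28 ≠ 18 by decide),
      State.setI_ints_ne _ _ _ _ (show 31 ≠ 18 by decide), e30, e31, e23, e28]
    refine ⟨hT, Extends.refl _ _, by simp, ?_, trivial⟩
    intro a ha
    simp at ha
  · rintro a ha s₁ hf₁ ha₁ ⟨hT₁, hE₁, hl₁, hF₁, hR₁⟩
    have i₁ : s₁.ints 20 0 0 = i := by rw [hf₁.ints 20 (by decide), e20, hi]
    have h₁ : s₁.ints 26 0 0 = h i := by rw [hf₁.ints 26 (by decide), e26]
    obtain ⟨hFa, hF0⟩ := hF a ha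
    set zs := (nbrs h i)[a] with hzs
    have hw₁ : walk (s₁.ints 30) r zs = walk (s.ints 30) r zs := hE₁.walk_eq hT hT₁ hF0
    simp only [wp_seq, wp_assignI]
    set s₂ := s₁.setI 29 0 0 (IExpr.eval s₁ (IExpr.get 31 (iv 20) (iv 18))) with hs₂
    have ne₂ : ∀ b, b ≠ 29 → s₂.ints b = s₁.ints b := fun b hb =>
      State.setI_ints_ne _ _ _ _ hb
    have n₂ : s₂.ints 29 0 0 = walk (s.ints 30) r zs := by
      simp [hs₂, i₁, ha₁, hR₁, hFa]
    have hF₂ : FrontIs s₂ r (i + 1) (((nbrs h i).take a).flatMap step) := by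
      intro b hb
      rw [ne₂ 30 (by decide), ne₂ 31 (by decide)]
      exact hF₁ b hb
    refine wp_childCmd (h i - 1) i r hr zs _
      (fun s' hf => by simp [hf.ints 26 (by decide), ne₂ 26 (by decide), h₁])
      (by rw [ne₂ 30 (by decide), ne₂ 23 (by decide)]; exact hT₁)
      (by rw [ne₂ 20 (by decide), i₁]) (by rw [ne₂ 28 (by decide), hl₁]) hF₂
      (by rw [n₂, ne₂ 30 (by decide), hw₁]) (by rwa [n₂]) ?_
    intro s₃ t₃ hf₃ hT₃ hE₃ hl₃ hF₃ hR₃ ht₃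
    have n₃ : s₃.ints 29 0 0 = walk (s.ints 30) r zs := by rw [hf₃.ints 29 (by decide), n₂]
    rw [ne₂ 30 (by decide), ne₂ 23 (by decide)] at hE₃
    have hE₃' := hE₁.trans hT hE₃
    refine wp_childCmd (h i) i r hr zs _
      (fun s' hf => by simp [hf.ints 26 (by decide), hf₃.ints 26 (by decide), ne₂ 26 (by decide),
        h₁])
      hT₃ (by rw [hf₃.ints 20 (by decide), ne₂ 20 (by decide), i₁]) hl₃ hF₃
      (by rw [n₃, hE₃'.walk_eq hT hT₃ hF0]) (by rwa [n₃]) ?_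
    intro s₄ t₄ hf₄ hT₄ hE₄ hl₄ hF₄ hR₄ ht₄
    have n₄ : s₄.ints 29 0 0 = walk (s.ints 30) r zs := by rw [hf₄.ints 29 (by decide), n₃]
    have hE₄' := hE₃'.trans hT hE₄
    refine wp_childCmd (h i + 1) i r hr zs _
      (fun s' hf => by simp [hf.ints 26 (by decide), hf₄.ints 26 (by decide),
        hf₃.ints 26 (by decide), ne₂ 26 (by decide), h₁])
      hT₄ (by rw [hf₄.ints 20 (by decide), hf₃.ints 20 (by decide), ne₂ 20 (by decide), i₁])
      hl₄ hF₄ (by rw [n₄, hE₄'.walk_eq hT hT₄ hF0]) (by rwa [n₄]) ?_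
    intro s₅ t₅ hf₅ hT₅ hE₅ hl₅ hF₅ hR₅ ht₅
    have hE₅' := hE₄'.trans hT hE₅
    have hlist : ((nbrs h i).take a).flatMap step ++ [zs ++ [h i - 1]] ++ [zs ++ [h i]] ++
        [zs ++ [h i + 1]] = ((nbrs h i).take (a + 1)).flatMap step := by
      rw [List.take_succ_eq_append_getElem ha, List.flatMap_append]
      simp [hstep, hzs]
    rw [hlist] at hl₅ hF₅
    simp only [State.setI_ints_ne _ _ _ _ (show 30 ≠ 18 by decide),
      State.setI_ints_ne _ _ _ _ (show 23 ≠ 18 by decide),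
      State.setI_ints_ne _ _ _ _ (show 28 ≠ 18 by decide),
      State.setI_ints_ne _ _ _ _ (show 31 ≠ 18 by decide)]
    refine ⟨⟨hT₅, hE₅', hl₅, ?_, ?_⟩, by omega⟩
    · intro b hb
      exact hF₅ b hb
    · rw [hR₅ i (by omega), hR₄ i (by omega), hR₃ i (by omega), ne₂ 31 (by decide), hR₁]
  · rintro s₁ t₁ hf₁ ⟨hT₁, hE₁, hl₁, hF₁, hR₁⟩ ht₁ hf
    rw [List.take_length] at hl₁ hF₁
    simp only [iv_eval] at hf ⊢
    refine hQ _ _ hf ?_ ?_ ?_ ?_ ?_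
    · simpa [State.setI_ints_ne] using hT₁
    · simpa [State.setI_ints_ne] using hE₁
    · simp only [State.setI_ints, and_self, if_true]; exact hl₁
    · intro b hb
      simp only [State.setI_ints_ne _ _ _ _ (show 30 ≠ 27 by decide),
        State.setI_ints_ne _ _ _ _ (show 31 ≠ 27 by decide)]
      exact hF₁ b hb
    · rw [length_nbrs] at ht₁
      omega

/-- The lists at the nodes of depth `L` are given by `F`. -/
structure IsStore (L : ℕ) (s : State) (F : ℤ → List ℤ → List ℤ) : Prop where
  trie : IsTrie (s.ints aTrie) (s.ints vCount 0 0)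
  fresh : ∀ v, v = 0 ∨ s.ints vCount 0 0 < v → s.ints aListLen v 0 = 0
  rows : ∀ r < 0, ∀ zs : List ℤ, zs.length = L →
    RowIs (s.ints aListLen (walk (s.ints aTrie) r zs) 0)
      (s.ints aList (walk (s.ints aTrie) r zs)) (F r zs)

/-- A walk whose end changes ended at `0` before, so its prescribed list is empty; it now ends at
`0` or at a new node, and the lists there are empty by `fresh`. -/
theorem IsStore.extends {L : ℕ} {F : ℤ → List ℤ → List ℤ} (h : IsStore L s F)
    (hT : IsTrie (s'.ints aTrie) (s'.ints vCount 0 0))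
    (hE : Extends (s.ints aTrie) (s.ints vCount 0 0) (s'.ints aTrie) (s'.ints vCount 0 0))
    (hl : s'.ints aList = s.ints aList) (hn : s'.ints aListLen = s.ints aListLen) :
    IsStore L s' F := by
  refine ⟨hT, ?_, ?_⟩
  · intro v hv
    rw [hn]
    have := hE.le
    exact h.fresh v (by omega)
  · intro r hr zs hzs
    have hrow := h.rows r hr zs hzs
    rw [hl, hn]
    rcases hE.walk h.trie hT r zs with he | ⟨h0, h1⟩
    · rwa [he]
    · have hF : F r zs = [] := by
        have := hrow.1
        rw [h0, h.fresh 0 (Or.inl rfl)] at this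
        exact List.eq_nil_of_length_eq_zero (by exact_mod_cast this.symm)
      rw [hF]
      refine ⟨?_, by simp⟩
      rw [h.fresh _ h1]
      simp

theorem IsStore.congr {L : ℕ} {F : ℤ → List ℤ → List ℤ} (h : IsStore L s F)
    (h0 : s'.ints aTrie = s.ints aTrie) (h1 : s'.ints vCount = s.ints vCount)
    (h2 : s'.ints aList = s.ints aList) (h3 : s'.ints aListLen = s.ints aListLen) :
    IsStore L s' F := by
  refine h.extends ?_ ?_ h2 h3
  · rw [h0, h1]; exact h.trie
  · rw [h0, h1]; exact Extends.refl _ _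

theorem RowIs.concat {len : ℤ} {row row' : ℤ → ℤ} {l : List ℤ} (h : RowIs len row l) (x : ℤ)
    (hrow : ∀ i, row' i = if i = len then x else row i) : RowIs (len + 1) row' (l ++ [x]) := by
  refine ⟨by simp [h.1], ?_⟩
  intro i hi
  rw [hrow, h.1]
  simp only [List.length_append, List.length_singleton] at hi
  rcases Nat.lt_succ_iff_lt_or_eq.mp hi with hi | rfl
  · rw [if_neg (by exact_mod_cast hi.ne), List.getElem_append_left hi, h.2 i hi]
  · simp

-- Different label sequences of length `L` lead to different nodes by `walk_inj`, so each iteration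
-- extends one list and leaves all others alone.
open Classical in
theorem wp_appendCmd {L : ℕ} {F : ℤ → List ℤ → List ℤ} (r : ℤ) (hr : r < 0) (x : ℤ)
    (l : List (List ℤ)) (hlen : ∀ zs ∈ l, zs.length = L) (hnd : l.Nodup)
    (hS : IsStore L s F) (hx : s.ints vX 0 0 = x) (hL : s.ints vLen 0 0 = L)
    (hl : s.ints vFront 0 0 = l.length) (hF : FrontIs s r L l)
    (hQ : ∀ s' t, Frame appendCmd s s' →
      IsStore L s' (fun r' zs => F r' zs ++ if r' = r ∧ zs ∈ l then [x] else []) →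
      t ≤ 5 * l.length + 2 → Q s' t) :
    wp ω appendCmd s Q := by
  refine wp_for_const l.length 3 (fun a s' =>
    IsStore L s' (fun r' zs => F r' zs ++ if r' = r ∧ zs ∈ l.take a then [x] else []))
    (fun s' hf => by simp [hf.ints 27 (by decide), hl]) (by decide) ?_ ?_ ?_
  · have : IsStore L (s.setI 18 0 0 0) F :=
      hS.congr (State.setI_ints_ne _ _ _ _ (by decide)) (State.setI_ints_ne _ _ _ _ (by decide))
        (State.setI_ints_ne _ _ _ _ (by decide)) (State.setI_ints_ne _ _ _ _ (by decide))
    simpa using this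
  · intro a ha s₁ hf₁ ha₁ hS₁
    have e30 : s₁.ints 30 = s.ints 30 := hf₁.ints 30 (by decide)
    have e31 : s₁.ints 31 = s.ints 31 := hf₁.ints 31 (by decide)
    have e3 : s₁.ints 3 0 0 = L := by rw [hf₁.ints 3 (by decide), hL]
    have e13 : s₁.ints 13 0 0 = x := by rw [hf₁.ints 13 (by decide), hx]
    obtain ⟨hFa, hF0⟩ := hF a ha
    set zs := l[a] with hzs
    set v := walk (s.ints 30) r zs with hv
    have hzl : zs.length = L := hlen zs (List.getElem_mem ha)
    have hvle : v ≤ s₁.ints 23 0 0 := by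
      have := hS₁.trie.walk_le hr zs
      rwa [e30] at this
    simp only [wp_seq, wp_assignI, wp_setI]
    refine ⟨?_, by omega⟩
    have hnode : IExpr.eval s₁ (IExpr.get 31 (iv 3) (iv 18)) = v := by
      simp [e3, ha₁, e31, hFa]
    rw [hnode]
    set s₂ := (((s₁.setI 29 0 0 v).setI 32 (IExpr.eval (s₁.setI 29 0 0 v) (iv 29))
      (IExpr.eval (s₁.setI 29 0 0 v) (IExpr.get 33 (iv 29) (IExpr.lit 0)))
      (IExpr.eval (s₁.setI 29 0 0 v) (iv 13)))) with hs₂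
    have c1 : ∀ b, b ≠ 29 → b ≠ 32 → s₂.ints b = s₁.ints b := by
      intro b h1 h2
      rw [hs₂, State.setI_ints_ne _ _ _ _ h2, State.setI_ints_ne _ _ _ _ h1]
    have c2 : s₂.ints 29 0 0 = v := by simp [hs₂]
    have c3 : ∀ u i, s₂.ints 32 u i = if u = v ∧ i = s₁.ints 33 v 0 then x else s₁.ints 32 u i := by
      intro u i
      simp [hs₂, e13]
    set s₃ := (s₂.setI 33 (IExpr.eval s₂ (iv 29)) (IExpr.eval s₂ (IExpr.lit 0))
      (IExpr.eval s₂ ((IExpr.get 33 (iv 29) (IExpr.lit 0)).add (IExpr.lit 1)))).setI 18 0 0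
      (a + 1) with hs₃
    have d1 : ∀ b, b ≠ 29 → b ≠ 32 → b ≠ 33 → b ≠ 18 → s₃.ints b = s₁.ints b := by
      intro b h1 h2 h3 h4
      rw [hs₃, State.setI_ints_ne _ _ _ _ h4, State.setI_ints_ne _ _ _ _ h3, c1 b h1 h2]
    have d2 : ∀ u i, s₃.ints 32 u i = if u = v ∧ i = s₁.ints 33 v 0 then x else s₁.ints 32 u i := by
      intro u i
      rw [hs₃, State.setI_ints_ne _ _ _ _ (by decide), State.setI_ints_ne _ _ _ _ (by decide), c3]
    have d3 : ∀ u, s₃.ints 33 u 0 = if u = v then s₁.ints 33 v 0 + 1 else s₁.ints 33 u 0 := by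
      intro u
      rw [hs₃, State.setI_ints_ne _ _ _ _ (by decide)]
      simp [c2, c1]
    have d30 : s₃.ints 30 = s.ints 30 := by
      rw [d1 30 (by decide) (by decide) (by decide) (by decide), e30]
    have d23 : s₃.ints 23 = s₁.ints 23 := d1 23 (by decide) (by decide) (by decide) (by decide)
    refine ⟨?_, ?_, ?_⟩
    · rw [d30, d23, ← e30]; exact hS₁.trie
    · intro u hu
      rw [d23] at hu
      rw [d3, if_neg (by rintro rfl; rcases hu with hu | hu; exacts [hF0 hu, by omega])]
      exact hS₁.fresh u hu
    · intro r' hr' ws hws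
      have hrow := hS₁.rows r' hr' ws hws
      rw [e30] at hrow
      rw [d30, d3]
      have hta : l.take (a + 1) = l.take a ++ [zs] := List.take_succ_eq_append_getElem ha
      by_cases hw : walk (s.ints 30) r' ws = v
      · have hinj := hS₁.trie.walk_inj (r := r') (r' := r) ws zs (by rw [hws, hzl])
          (by rw [e30, hw]) (by rw [e30, hw]; exact hF0)
        obtain ⟨rfl, rfl⟩ := hinj
        -- As `l` has no duplicates, this node has not been served before, and `x` enters its list
        -- exactly once.
        have hnot : zs ∉ l.take a := by
          intro hm
          rw [List.mem_take_iff_getElem] at hm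
          obtain ⟨j, hj, hje⟩ := hm
          have := (List.Nodup.getElem_inj_iff hnd).mp (hje.trans hzs)
          omega
        have e1 : (if r' = r' ∧ zs ∈ l.take a then [x] else []) = [] := by simp [hnot]
        have e2 : (if r' = r' ∧ zs ∈ l.take (a + 1) then [x] else []) = [x] := by simp [hta]
        rw [e1, List.append_nil] at hrow
        rw [e2, if_pos hw, hw]
        rw [hw] at hrow
        exact hrow.concat x fun i => by rw [d2]; simp
      · rw [if_neg hw]
        have e1 : (if r' = r ∧ ws ∈ l.take (a + 1) then [x] else []) =
            if r' = r ∧ ws ∈ l.take a then [x] else [] := by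
          refine if_congr ?_ rfl rfl
          rw [hta]
          simp only [List.mem_append, List.mem_singleton]
          constructor
          · rintro ⟨rfl, h | rfl⟩
            · exact ⟨rfl, h⟩
            · exact absurd rfl hw
          · rintro ⟨h1, h2⟩; exact ⟨h1, Or.inl h2⟩
        rw [e1]
        refine ⟨hrow.1, ?_⟩
        intro i hi
        rw [d2, if_neg (fun hc => hw hc.1)]
        exact hrow.2 i hi
  · intro s₁ t₁ hf₁ hS₁ ht₁
    rw [List.take_length] at hS₁
    exact hQ _ _ hf₁ hS₁ (by omega)

open Classical in
theorem wp_insertCmd {F : ℤ → List ℤ → List ℤ} (hP : P.InState s) (r : ℤ) (hr : r < 0) (x : ℤ)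
    (hS : IsStore P.L s F) (hx : s.ints vX 0 0 = x) (hroot : s.ints vRoot 0 0 = r)
    (hQ : ∀ s' t, Frame insertCmd s s' →
      IsStore P.L s' (fun r' zs => F r' zs ++
        if r' = r ∧ zs ∈ nbrs (labelAt s) P.L then [x] else []) →
      t ≤ (P.L + 1) * (18 * 3 ^ P.L + 7) + 2 → Q s' t) :
    wp ω insertCmd s Q := by
  refine (wp.frame (Q := fun s' t => Frame insertCmd s s' → Q s' t) ?_).mono fun _ _ h => h.2 h.1
  simp only [insertCmd, wp_seq, wp_assignI, wp_setI]
  set h := labelAt s with hh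
  set s₀ := (s.setI 31 (IExpr.eval s (IExpr.lit 0)) (IExpr.eval s (IExpr.lit 0))
    (IExpr.eval s (iv 24))).setI 27 0 0 (IExpr.eval (s.setI 31 (IExpr.eval s (IExpr.lit 0))
    (IExpr.eval s (IExpr.lit 0)) (IExpr.eval s (iv 24))) (IExpr.lit 1)) with hs₀
  have ne₀ : ∀ b, b ≠ 31 → b ≠ 27 → s₀.ints b = s.ints b := by
    intro b h1 h2
    rw [hs₀, State.setI_ints_ne _ _ _ _ h2, State.setI_ints_ne _ _ _ _ h1]
  refine wp_for_const P.L (18 * 3 ^ P.L + 5) (fun i s' =>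
    IsStore P.L s' F ∧ s'.ints 27 0 0 = (nbrs h i).length ∧ FrontIs s' r i (nbrs h i)) ?_
    (by decide) ⟨?_, ?_, ?_⟩ ?_ ?_
  · intro s' hf
    simp [hf.ints 3 (by decide), ne₀ 3 (by decide) (by decide), hP.L]
  · refine hS.congr ?_ ?_ ?_ ?_ <;> rw [State.setI_ints_ne _ _ _ _ (by decide)] <;>
      exact ne₀ _ (by decide) (by decide)
  · simp [hs₀, nbrs]
  · intro a ha
    have : a = 0 := by simpa [nbrs] using ha
    subst this
    simp [nbrs, hs₀, hroot, hr.ne]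
  · rintro i hi s₁ hf₁ hi₁ ⟨hS₁, hl₁, hF₁⟩
    have hlab : labelAt s₁ i = h i := by
      rw [hh, labelAt_congr (hf₁.reals _ (by decide)) (hf₁.reals _ (by decide))
        (hf₁.reals _ (by decide)) (hf₁.ints _ (by decide)) (hf₁.ints _ (by decide))
        (hf₁.ints _ (by decide))]
      rw [labelAt_congr (s := s) (s' := s₀) rfl rfl rfl (ne₀ 25 (by decide) (by decide))
        (ne₀ 10 (by decide) (by decide)) (ne₀ 22 (by decide) (by decide))]
    refine wp_expandCmd i r hr h hlab hS₁.trie hi₁ hl₁ hF₁ ?_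
    intro s₂ t₂ hf₂ hT₂ hE₂ hl₂ hF₂ ht₂
    refine ⟨⟨?_, ?_, ?_⟩, ?_⟩
    · refine (hS₁.extends hT₂ hE₂ (hf₂.ints _ (by decide)) (hf₂.ints _ (by decide))).congr
        ?_ ?_ ?_ ?_ <;> exact State.setI_ints_ne _ _ _ _ (by decide)
    · rw [State.setI_ints_ne _ _ _ _ (by decide), hl₂]
    · intro a ha
      rw [State.setI_ints_ne _ _ _ _ (by decide), State.setI_ints_ne _ _ _ _ (by decide)]
      exact hF₂ a ha
    -- Every level is charged like the last one; the extra factor `L` is logarithmic in `n`.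
    · have : 3 ^ i ≤ 3 ^ P.L := Nat.pow_le_pow_right (by norm_num) hi.le
      omega
  · rintro s₁ t₁ hf₁ ⟨hS₁, hl₁, hF₁⟩ ht₁
    refine wp_appendCmd r hr x _ (length_of_mem_nbrs h P.L) (nodup_nbrs h P.L) hS₁
      (by rw [hf₁.ints 13 (by decide), ne₀ 13 (by decide) (by decide), hx])
      (by rw [hf₁.ints 3 (by decide), ne₀ 3 (by decide) (by decide), hP.L]) hl₁ hF₁ ?_
    intro s₂ t₂ hf₂ hS₂ ht₂ hf
    refine hQ _ _ hf hS₂ ?_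
    rw [length_nbrs] at ht₂
    have : 0 < 3 ^ P.L := by positivity
    linarith

/-! ## Building the data structure -/

/-- The matrix-vector product. -/
noncomputable def project (d : ℕ) (A : ℕ → ℕ → ℝ) (z : ℕ → ℝ) (r : ℕ) : ℝ :=
  ∑ u ∈ Finset.range d, A r u * z u

theorem wp_projectCmd {a : ℕ} {x : IExpr} (hP : P.InState s) (A : ℕ → ℕ → ℝ) (z : ℕ → ℝ)
    (xv : ℤ) (ha : a ∉ (projectCmd a x).modR)
    (hx : ∀ s', Frame (projectCmd a x) s s' → x.eval s' = xv)
    (hA : ∀ r < P.M, ∀ u < P.d, s.reals rMat r u = A r u)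
    (hz : ∀ u < P.d, s.reals a xv u = z u)
    (hQ : ∀ s' t, Frame (projectCmd a x) s s' →
      (∀ r < P.M, s'.reals rProj 0 r = project P.d A z r) →
      t ≤ P.M * (3 * P.d + 6) + 2 → Q s' t) :
    wp ω (projectCmd a x) s Q := by
  have ha' : a ≠ 14 ∧ a ≠ 5 := by
    simp [projectCmd, forLoop, sumLoop, Cmd.modR, assignI, assignR] at ha
    tauto
  have hI : ∀ b, b ≠ 14 → b ≠ 15 → b ∉ (projectCmd a x).modI := by
    intro b h1 h2
    simp [projectCmd, forLoop, sumLoop, Cmd.modI, assignI, assignR, h1, h2]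
  have hR : ∀ b, b ≠ 14 → b ≠ 5 → b ∉ (projectCmd a x).modR := by
    intro b h1 h2
    simp [projectCmd, forLoop, sumLoop, Cmd.modR, assignI, assignR, h1, h2]
  refine wp_for_const P.M (3 * P.d + 4) (fun r s' =>
    ∀ r' < r, s'.reals 5 0 r' = project P.d A z r')
    (fun s' hf => by simp [hf.ints 7 (hI 7 (by decide) (by decide)), hP.M]) (by
      simp [sumLoop, forLoop, Cmd.modI, assignI, assignR]) (by simp) ?_ ?_
  · intro r hr s₁ hf₁ hr₁ hinv
    rw [wp_seq]
    have hf₂ : ∀ s₂, Frame (sumLoop 14 15 dE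
        ((RExpr.get 3 (iv 14) (iv 15)).mul (RExpr.get a x (iv 15)))) s₁ s₂ →
        Frame (projectCmd a x) s s₂ := fun s₂ hf₂ => by
      refine hf₁.trans (Frame.seq_right ?_)
      have := (hf₂.seq_left (p₂ := Cmd.setR 5 (IExpr.lit 0) (iv 14) (rv 14))).seq_left
        (p₂ := assignI 14 (.add (iv 14) (.lit 1)))
      exact ⟨this.ints, this.reals, this.pos, this.out⟩
    refine wp_sumLoop P.d (fun u => A r u * z u) ?_ ?_ ?_
    · intro s₂ hf
      simp [(hf₂ s₂ hf).ints 0 (hI 0 (by decide) (by decide)), hP.d]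
    · intro u hu s₂ hf hu₂
      have hF := hf₂ s₂ hf
      have hr₂ : s₂.ints 14 0 0 = r := by
        rw [hf.ints 14 (by simp [sumLoop, forLoop, Cmd.modI, assignI, assignR]), hr₁]
      simp only [RExpr.eval, iv_eval, hx s₂ hF, hu₂, hr₂]
      rw [hF.reals 3 (hR 3 (by decide) (by decide)), hF.reals a (hR a ha'.1 ha'.2), hA r hr u hu,
        hz u hu]
    · intro s₂ t₂ hf hs₂ ht₂
      have hF := hf₂ s₂ hf
      have hr₂ : s₂.ints 14 0 0 = r := by
        rw [hf.ints 14 (by simp [sumLoop, forLoop, Cmd.modI, assignI, assignR]), hr₁]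
      rw [wp_setR]
      refine ⟨?_, by omega⟩
      intro r' hr'
      simp only [State.setI_reals, State.setR_reals, IExpr.eval, iv_eval, rv_eval, hr₂]
      split_ifs with hc
      · have : r' = r := by exact_mod_cast hc.2.2
        rw [hs₂, this, project]
      · rw [hf.reals 5 (by simp [sumLoop, forLoop, Cmd.modR, assignI, assignR])]
        exact hinv r' (by
          have : r' ≠ r := fun hh => hc (by simp [hh])
          omega)
  · intro s₁ t₁ hf₁ hinv ht₁
    exact hQ s₁ t₁ hf₁ hinv (by linarith)

/-- Block `j` with profile `i` is unit `j * N + i`, with root `-(j * N + i + 1)`. The time in `Inv`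
counts the runs of `p` only; the overhead of the loops is added at the end. By `hc` the invariant
does not see the loop variables. -/
theorem wp_unitsCmd {p : Cmd} {J N L : ℕ} (Inv : ℕ → State → ℕ → Prop)
    (hm : ∀ a ∈ [vRoot, vOff, vJ, vP, vBlocks, vSize, vLen], a ∉ p.modI)
    (hJ : s.ints vBlocks 0 0 = J) (hN : s.ints vSize 0 0 = N) (hL : s.ints vLen 0 0 = L)
    (hc : ∀ q s₁ s₂ T, (∀ a, a ≠ vRoot → a ≠ vOff → a ≠ vJ → a ≠ vP → s₂.ints a = s₁.ints a) →
      s₂.reals = s₁.reals → s₂.out = s₁.out → Inv q s₁ T → Inv q s₂ T)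
    (h0 : Inv 0 s 0)
    (hstep : ∀ j < J, ∀ i < N, ∀ s' T, Frame (unitsCmd p) s s' →
      s'.ints vRoot 0 0 = -((j * N + i + 1 : ℕ) : ℤ) → s'.ints vOff 0 0 = (j * L : ℕ) →
      s'.ints vP 0 0 = i → Inv (j * N + i) s' T →
      wp ω p s' (fun s'' t => Inv (j * N + i + 1) s'' (T + t)))
    (hQ : ∀ s' T t, Frame (unitsCmd p) s s' → Inv (J * N) s' T → t ≤ T + J * (3 * N + 5) + 4 →
      Q s' t) :
    wp ω (unitsCmd p) s Q := by
  simp only [List.mem_cons, List.not_mem_nil, or_false, forall_eq_or_imp, forall_eq] at hm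
  obtain ⟨m24, m25, m21, m22, m5, m12, m3⟩ := hm
  have hmod : ∀ b, b ∉ p.modI → b ≠ 24 → b ≠ 25 → b ≠ 21 → b ≠ 22 →
      b ∉ (unitsCmd p).modI := by
    intro b h0 h1 h2 h3 h4
    simp [unitsCmd, forLoop, Cmd.modI, assignI, h0, h1, h2, h3, h4]
  refine (wp.frame (Q := fun s' t => Frame (unitsCmd p) s s' → Q s' t) ?_).mono
    fun _ _ h => h.2 h.1
  simp only [unitsCmd, wp_seq, wp_assignI]
  set s₀ := (s.setI 24 0 0 (IExpr.eval s (IExpr.lit 0))).setI 25 0 0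
    (IExpr.eval (s.setI 24 0 0 (IExpr.eval s (IExpr.lit 0))) (IExpr.lit 0)) with hs₀
  have hF₀ : ∀ s₁, Frame (forLoop 21 (iv 5) (.seq (forLoop 22 (iv 12)
      (.seq (assignI 24 (.sub (iv 24) (.lit 1))) p))
      (assignI 25 (.add (iv 25) (iv 3))))) s₀ s₁ → Frame (unitsCmd p) s s₁ := by
    intro s₁ hf
    refine Frame.trans (s₂ := s₀) ?_ (Frame.seq_right (Frame.seq_right hf))
    refine (Frame.seq_left (Exec.assignI (ω := ω) s 24 (.lit 0)).frame).trans ?_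
    exact Frame.seq_right (Frame.seq_left (Exec.assignI (ω := ω) _ 25 (.lit 0)).frame)
  refine wp_for J (fun j s' T' => s'.ints 24 0 0 = -((j * N : ℕ) : ℤ) ∧
    s'.ints 25 0 0 = (j * L : ℕ) ∧ ∃ T, Inv (j * N) s' T ∧ T' ≤ T + j * (3 * N + 5)) ?_ ?_ ?_ ?_ ?_
  · intro s₁ hf
    simp [(hF₀ s₁ hf).ints 5 (hmod 5 m5 (by decide) (by decide) (by decide) (by decide)), hJ]
  · simp [forLoop, Cmd.modI, assignI, m21]
  · refine ⟨by simp [hs₀], by simp [hs₀], 0, ?_, by simp⟩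
    rw [zero_mul]
    refine hc 0 s _ 0 ?_ rfl rfl h0
    intro a h1 h2 h3 _
    rw [State.setI_ints_ne _ _ _ _ h3, hs₀, State.setI_ints_ne _ _ _ _ h2,
      State.setI_ints_ne _ _ _ _ h1]
  · rintro j hj s₁ T₁ hf₁ hj₁ ⟨hr₁, ho₁, T, hI₁, hT₁⟩
    have hG₁ := hF₀ s₁ hf₁
    rw [wp_seq]
    refine wp_for N (fun i s' T' => s'.ints 24 0 0 = -((j * N + i : ℕ) : ℤ) ∧
      ∃ T, Inv (j * N + i) s' T ∧ T₁ + T' ≤ T + j * (3 * N + 5) + 3 * i) ?_ ?_ ?_ ?_ ?_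
    · intro s₂ hf₂
      have : s₂.ints 12 = s₁.ints 12 := hf₂.ints 12 (by simp [forLoop, Cmd.modI, assignI, m12])
      simp [this, hG₁.ints 12 (hmod 12 m12 (by decide) (by decide) (by decide) (by decide)), hN]
    · simp [Cmd.modI, assignI, m22]
    · refine ⟨by simpa using hr₁, T, ?_, by simpa using hT₁⟩
      refine hc _ s₁ _ T ?_ rfl rfl hI₁
      intro a _ _ _ h4
      rw [State.setI_ints_ne _ _ _ _ h4]
    · rintro i hi s₂ T₂ hf₂ hi₂ ⟨hr₂, T', hI₂, hT₂⟩
      rw [wp_seq, wp_assignI]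
      set s₃ := s₂.setI 24 0 0 (IExpr.eval s₂ ((iv 24).sub (IExpr.lit 1))) with hs₃
      have hf₃ : Frame (unitsCmd p) s s₃ := by
        have h2 : Frame (unitsCmd p) s₁ s₂ := by
          have := Frame.seq_right (p₁ := assignI 24 (.lit 0)) (Frame.seq_right
            (p₁ := assignI 25 (.lit 0)) (Frame.seq_right (p₁ := assignI 21 (.lit 0))
            ((hf₂.seq_left (p₂ := assignI 25 (.add (iv 25) (iv 3)))).seq_left
            (p₂ := assignI 21 (.add (iv 21) (.lit 1))))))
          exact ⟨this.ints, this.reals, this.pos, this.out⟩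
        refine hG₁.trans (h2.trans ?_)
        refine ⟨?_, fun _ _ => rfl, fun _ => rfl, fun _ => rfl⟩
        intro a ha
        exact State.setI_ints_ne _ _ _ _ fun hcc => ha (by
          simp [unitsCmd, forLoop, Cmd.modI, assignI, hcc])
      have ho₂ : s₂.ints 25 = s₁.ints 25 :=
        hf₂.ints 25 (by simp [forLoop, Cmd.modI, assignI, m25])
      refine (hstep j hj i hi s₃ T' hf₃ ?_ ?_ ?_ ?_).frame.mono ?_
      · simp [hs₃, hr₂]; ring
      · rw [hs₃, State.setI_ints_ne _ _ _ _ (by decide), ho₂, ho₁]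
      · rw [hs₃, State.setI_ints_ne _ _ _ _ (by decide), hi₂]
      · refine hc _ s₂ _ T' ?_ rfl rfl hI₂
        intro a h1 _ _ _
        rw [hs₃, State.setI_ints_ne _ _ _ _ h1]
      · rintro s₄ t₄ ⟨hf₄, hI₄⟩
        refine ⟨?_, T' + t₄, ?_, by omega⟩
        · rw [State.setI_ints_ne _ _ _ _ (by decide), hf₄.ints 24 m24]
          simp [hs₃, hr₂]; ring
        · refine hc _ s₄ _ _ ?_ rfl rfl hI₄
          intro a _ _ _ h4
          rw [State.setI_ints_ne _ _ _ _ h4]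
    · rintro s₂ T₂ hf₂ ⟨hr₂, T', hI₂, hT₂⟩
      rw [wp_assignI]
      have e : (j + 1) * N = j * N + N := by ring
      have ho₂ : s₂.ints 25 = s₁.ints 25 :=
        hf₂.ints 25 (by simp [forLoop, Cmd.modI, assignI, m25])
      have hl₂ : s₂.ints 3 0 0 = L := by
        rw [hf₂.ints 3 (by simp [forLoop, Cmd.modI, assignI, m3]),
          hG₁.ints 3 (hmod 3 m3 (by decide) (by decide) (by decide) (by decide)), hL]
      refine ⟨?_, ?_, T', ?_, by linarith⟩
      · rw [State.setI_ints_ne _ _ _ _ (by decide), State.setI_ints_ne _ _ _ _ (by decide), hr₂, e]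
      · simp [ho₂, ho₁, hl₂]; ring
      · rw [e]
        refine hc _ s₂ _ _ ?_ rfl rfl hI₂
        intro a _ h2 h3 _
        rw [State.setI_ints_ne _ _ _ _ h3, State.setI_ints_ne _ _ _ _ h2]
  · rintro s₁ T₁ hf₁ ⟨_, _, T, hI₁, hT₁⟩ hf
    exact hQ s₁ T _ hf hI₁ (by omega)

theorem nbrs_congr {h h' : ℕ → ℤ} (i : ℕ) (hh : ∀ j < i, h j = h' j) : nbrs h i = nbrs h' i := by
  induction i with
  | zero => rfl
  | succ i ih => rw [nbrs, nbrs, ih fun j hj => hh j (by omega), hh i (by omega)]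

/-- The labels of the projection `y` in unit `q`, that is, in block `q / N` with
profile `q % N`. -/
noncomputable def unitLabel (P : Params) (y : ℕ → ℝ) (q i : ℕ) : ℤ :=
  ⌊y (q / P.L ^ P.R * P.L + i) / √(profile P.L P.k P.R (q % P.L ^ P.R) i * P.unit)⌋

open Classical in
/-- The list at the node reached from the root `r` along `zs`, if all points before `x` have been
inserted, and the point `x` has been inserted in the first `q` units. -/
noncomputable def storeFun (P : Params) (A : ℕ → ℕ → ℝ) (x q : ℕ) (r : ℤ) (zs : List ℤ) :
    List ℤ :=
  ((List.range (if r.natAbs ≤ q then x + 1 else x)).filter fun y =>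
    r.natAbs ≤ P.J * P.L ^ P.R ∧
      zs ∈ nbrs (unitLabel P (project P.d A (P.X y)) (r.natAbs - 1)) P.L).map Nat.cast

/-- The root `-(q + 1)` belongs to unit `q`, so only lists below this root gain the point `x`. -/
theorem storeFun_succ (P : Params) (A : ℕ → ℕ → ℝ) (x : ℕ) {q : ℕ}
    (hq : q + 1 ≤ P.J * P.L ^ P.R) {r : ℤ} (hr : r < 0) (zs : List ℤ)
    [Decidable (r = -((q + 1 : ℕ) : ℤ) ∧ zs ∈ nbrs (unitLabel P (project P.d A (P.X x)) q) P.L)] :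
    storeFun P A x (q + 1) r zs = storeFun P A x q r zs ++
      if r = -((q + 1 : ℕ) : ℤ) ∧ zs ∈ nbrs (unitLabel P (project P.d A (P.X x)) q) P.L then
        [(x : ℤ)] else [] := by
  by_cases h : r = -((q + 1 : ℕ) : ℤ)
  · have hn : r.natAbs = q + 1 := by omega
    rw [storeFun, storeFun, hn, if_pos le_rfl, if_neg (by omega), List.range_succ,
      List.filter_append, List.map_append]
    congr 1
    by_cases hz : zs ∈ nbrs (unitLabel P (project P.d A (P.X x)) q) P.L
    · simp [h, hz, hq]
    · simp [hz]
  · rw [if_neg fun hc => h hc.1, List.append_nil, storeFun, storeFun]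
    have : (r.natAbs ≤ q + 1) ↔ (r.natAbs ≤ q) := by omega
    simp only [this]

/-- After the last unit the point is present in every trie in use, and below all further roots both
sides are empty. -/
theorem storeFun_last (P : Params) (A : ℕ → ℕ → ℝ) (x : ℕ) {r : ℤ} (hr : r < 0) (zs : List ℤ) :
    storeFun P A (x + 1) 0 r zs = storeFun P A x (P.J * P.L ^ P.R) r zs := by
  rw [storeFun, storeFun, if_neg (by omega)]
  by_cases h : r.natAbs ≤ P.J * P.L ^ P.R
  · rw [if_pos h]
  · simp [h]

theorem IsStore.congr_fun {L : ℕ} {F F' : ℤ → List ℤ → List ℤ} (h : IsStore L s F)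
    (hF : ∀ r < 0, ∀ zs, F' r zs = F r zs) : IsStore L s F' :=
  ⟨h.trie, h.fresh, fun r hr zs hzs => by rw [hF r hr zs]; exact h.rows r hr zs hzs⟩

/-- The state `s` holds the matrix `A` and the list of profiles. -/
structure HasTables (P : Params) (A : ℕ → ℕ → ℝ) (s : State) : Prop where
  params : P.InState s
  mat : ∀ r < P.M, ∀ u < P.d, s.reals rMat r u = A r u
  prof : ∃ lo : ℕ, s.ints vLow 0 0 = lo ∧ ∀ a < P.L ^ P.R, ∀ i < P.L,
    s.reals rProf (lo + a : ℕ) i = profile P.L P.k P.R a i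
  size : s.ints vSize 0 0 = (P.L ^ P.R : ℕ)

theorem HasTables.frame {A : ℕ → ℕ → ℝ} (h : HasTables P A s) {p : Cmd} (hf : Frame p s s')
    (hI : ∀ a ∈ [0, vClog, vWin, vLen, vRounds, vBlocks, vRows, vLow, vSize], a ∉ p.modI)
    (hR : ∀ a ∈ [rParam, rUnit, rScale, rPoint, rMat, rProf], a ∉ p.modR) :
    HasTables P A s' := by
  have hP := h.params.frame hf (fun a ha => hI a (by simp at ha ⊢; tauto))
    (fun a ha => hR a (by simp at ha ⊢; tauto))
  refine ⟨hP, ?_, ?_, ?_⟩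
  · rw [hf.reals 3 (hR 3 (by decide))]; exact h.mat
  · rw [hf.reals 4 (hR 4 (by decide)), hf.ints 10 (hI 10 (by decide))]; exact h.prof
  · rw [hf.ints 12 (hI 12 (by decide))]; exact h.size

theorem labelAt_eq_unitLabel {A : ℕ → ℕ → ℝ} (hT : HasTables P A s) (hM : P.M = P.J * P.L)
    (y : ℕ → ℝ) (hy : ∀ r < P.M, s.reals rProj 0 r = y r) {j a i : ℕ} (hj : j < P.J)
    (ha : a < P.L ^ P.R) (hi : i < P.L) (ho : s.ints vOff 0 0 = (j * P.L : ℕ))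
    (hp : s.ints vP 0 0 = a) : labelAt s i = unitLabel P y (j * P.L ^ P.R + a) i := by
  obtain ⟨lo, hlo, hV⟩ := hT.prof
  have hdiv : (j * P.L ^ P.R + a) / P.L ^ P.R = j := by
    rw [mul_comm, Nat.mul_add_div (by omega), Nat.div_eq_of_lt ha, add_zero]
  have hmod : (j * P.L ^ P.R + a) % P.L ^ P.R = a := by
    rw [mul_comm, Nat.mul_add_mod, Nat.mod_eq_of_lt ha]
  have hlt : j * P.L + i < P.M := by
    rw [hM]
    calc j * P.L + i < j * P.L + P.L := by omega
      _ = (j + 1) * P.L := by ring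
      _ ≤ P.J * P.L := Nat.mul_le_mul_right _ hj
  have h1 := hV a ha i hi
  have h2 := hy _ hlt
  push_cast at h1 h2
  rw [labelAt, unitLabel, hdiv, hmod, ho, hp, hlo, h1, hT.params.unit]
  push_cast
  rw [h2]

/-- Zero arrays represent an empty forest with empty lists. `unitsCmd` restarts the numbering of the
roots, so all points enter the same tries. -/
theorem wp_buildCmd {A : ℕ → ℕ → ℝ} (hT : HasTables P A s) (hM : P.M = P.J * P.L)
    (hz : ∀ a ∈ [aTrie, aList, aListLen], s.ints a = fun _ _ => 0)
    (hQ : ∀ s' t, Frame buildCmd s s' → HasTables P A s' → IsStore P.L s' (storeFun P A P.n 0) →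
      t ≤ P.n * (P.M * (3 * P.d + 6) + P.J * P.L ^ P.R * ((P.L + 1) * (18 * 3 ^ P.L + 7) + 2) +
        P.J * (3 * P.L ^ P.R + 5) + 8) + 3 → Q s' t) :
    wp ω buildCmd s Q := by
  refine (wp.frame (Q := fun s' t => Frame buildCmd s s' → Q s' t) ?_).mono
    fun _ _ h => h.2 h.1
  have hTs : ∀ s', Frame buildCmd s s' → HasTables P A s' := fun s' hf =>
    hT.frame hf (by decide) (by decide)
  rw [buildCmd, wp_seq, wp_assignI]
  set s₀ := s.setI 23 0 0 (IExpr.eval s (IExpr.lit 0)) with hs₀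
  have hF₀ : Frame buildCmd s s₀ :=
    Frame.seq_left (Exec.assignI (ω := ω) s 23 (.lit 0)).frame
  have hTs₀ := hTs _ hF₀
  refine wp_for_const P.n (P.M * (3 * P.d + 6) +
      P.J * P.L ^ P.R * ((P.L + 1) * (18 * 3 ^ P.L + 7) + 2) +
        P.J * (3 * P.L ^ P.R + 5) + 6) (fun x s' => IsStore P.L s' (storeFun P A x 0))
    (fun s' hf => by simpa using (hTs₀.frame hf (by decide) (by decide)).params.n) (by decide)
    ?_ ?_ ?_
  · have e30 : (s₀.setI 13 0 0 0).ints 30 = fun _ _ => 0 := by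
      rw [State.setI_ints_ne _ _ _ _ (by decide), hs₀, State.setI_ints_ne _ _ _ _ (by decide),
        hz 30 (by decide)]
    have e33 : (s₀.setI 13 0 0 0).ints 33 = fun _ _ => 0 := by
      rw [State.setI_ints_ne _ _ _ _ (by decide), hs₀, State.setI_ints_ne _ _ _ _ (by decide),
        hz 33 (by decide)]
    have e23 : (s₀.setI 13 0 0 0).ints 23 0 0 = 0 := by simp [hs₀]
    refine ⟨?_, ?_, ?_⟩
    · rw [e30, e23]
      constructor <;> simp
    · intro v _
      rw [e33]
    · intro r hr zs _
      have : storeFun P A 0 0 r zs = [] := by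
        simp [storeFun, show r ≠ 0 by omega]
      rw [this, e33]
      exact ⟨by simp, by simp⟩
  · rintro x hx s₁ hf₁ hx₁ hS₁
    have hT₁ : HasTables P A s₁ := hTs₀.frame hf₁ (by decide) (by decide)
    rw [wp_seq]
    refine wp_projectCmd hT₁.params A (P.X x) x (by decide)
      (fun s' hf => by simp [hf.ints 13 (by decide), hx₁]) hT₁.mat
      (fun u hu => hT₁.params.X x hx u hu) ?_
    intro s₂ t₂ hf₂ hy₂ ht₂
    have hT₂ : HasTables P A s₂ := hT₁.frame hf₂ (by decide) (by decide)
    have hS₂ : IsStore P.L s₂ (storeFun P A x 0) :=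
      hS₁.congr (hf₂.ints _ (by decide)) (hf₂.ints _ (by decide)) (hf₂.ints _ (by decide))
        (hf₂.ints _ (by decide))
    have hx₂ : s₂.ints 13 0 0 = x := by rw [hf₂.ints 13 (by decide), hx₁]
    refine wp_unitsCmd (J := P.J) (N := P.L ^ P.R) (L := P.L) (fun q s' T =>
      IsStore P.L s' (storeFun P A x q) ∧ T ≤ q * ((P.L + 1) * (18 * 3 ^ P.L + 7) + 2))
      (by decide) hT₂.params.J hT₂.size hT₂.params.L ?_ ⟨hS₂, by simp⟩ ?_ ?_
    · rintro q s₃ s₄ T h _ _ ⟨h1, h2⟩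
      refine ⟨h1.congr ?_ ?_ ?_ ?_, h2⟩ <;>
        exact h _ (by decide) (by decide) (by decide) (by decide)
    · rintro j hj a ha s₃ T hf₃ hr₃ ho₃ hp₃ ⟨hS₃, hTT⟩
      have hT₃ : HasTables P A s₃ := hT₂.frame hf₃ (by decide) (by decide)
      refine wp_insertCmd hT₃.params _ (by omega) x hS₃
        (by rw [hf₃.ints 13 (by decide), hx₂]) hr₃ ?_
      intro s₄ t₄ hf₄ hS₄ ht₄
      refine ⟨?_, by linarith⟩
      have hlab : nbrs (labelAt s₃) P.L =
          nbrs (unitLabel P (project P.d A (P.X x)) (j * P.L ^ P.R + a)) P.L :=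
        nbrs_congr _ fun i hi => labelAt_eq_unitLabel hT₃ hM _ (by
          rw [hf₃.reals 5 (by decide)]; exact hy₂) hj ha hi ho₃ hp₃
      rw [hlab] at hS₄
      have hqlt : j * P.L ^ P.R + a + 1 ≤ P.J * P.L ^ P.R := by
        calc j * P.L ^ P.R + a + 1 ≤ j * P.L ^ P.R + P.L ^ P.R := by omega
          _ = (j + 1) * P.L ^ P.R := by ring
          _ ≤ P.J * P.L ^ P.R := Nat.mul_le_mul_right _ hj
      exact hS₄.congr_fun fun r hr zs => storeFun_succ P A x hqlt hr zs
    · rintro s₃ T t₃ hf₃ ⟨hS₃, hTT⟩ ht₃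
      refine ⟨?_, by linarith⟩
      refine IsStore.congr (s := s₃) ?_ ?_ ?_ ?_ ?_
      rotate_left
      iterate 4 exact State.setI_ints_ne _ _ _ _ (by decide)
      exact hS₃.congr_fun fun r hr zs => storeFun_last P A x hr zs
  · intro s₁ t₁ hf₁ hS₁ ht₁ hf
    exact hQ _ _ hf (hTs _ hf) hS₁ (by linarith)

/-! ## Queries -/

/-- The point with number `x` may be reported. -/
def IsNear (P : Params) (q : ℕ → ℝ) (x : ℕ) : Prop :=
  ∑ u ∈ Finset.range P.d, (P.X x u - q u) * (P.X x u - q u) ≤ P.c * P.c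

/-- The point with number `x` is in the list of the query with projection `y` in unit `j`. -/
def Collides (P : Params) (A : ℕ → ℕ → ℝ) (y : ℕ → ℝ) (j x : ℕ) : Prop :=
  ∀ i < P.L, |unitLabel P y j i - unitLabel P (project P.d A (P.X x)) j i| ≤ 1

/-- Exactly the points in `B` have been reported, and exactly these are marked. -/
structure Reported (P : Params) (q : ℕ → ℝ) (s : State) (B : Finset ℕ) : Prop where
  out : s.out = B.image Nat.cast
  mark : ∀ x : ℕ, s.ints aMark x 0 = if x ∈ B then 1 else 0
  near : ∀ x ∈ B, x < P.n ∧ IsNear P q x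
  query : ∀ u < P.d, s.reals rQuery 0 u = q u

theorem Reported.congr {q : ℕ → ℝ} {B : Finset ℕ} (h : Reported P q s B)
    (ho : s'.out = s.out) (hm : s'.ints aMark = s.ints aMark)
    (hq : s'.reals rQuery = s.reals rQuery) : Reported P q s' B :=
  ⟨by rw [ho, h.out], by rw [hm]; exact h.mark, h.near, by rw [hq]; exact h.query⟩

-- The term `(3 d + 8) * B.card` is a potential. A newly accepted point pays for its distance
-- computation by enlarging `B`, a rejected point is charged separately, and a marked point costs
-- two steps.
open Classical in
theorem wp_checkCmd {q : ℕ → ℝ} {B : Finset ℕ} (hP : P.InState s) (hR : Reported P q s B)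
    (x : ℕ) (hx : s.ints vX 0 0 = x) (hxn : x < P.n)
    (hQ : ∀ s' t, Frame checkCmd s s' →
      Reported P q s' (B ∪ ({x} : Finset ℕ).filter (IsNear P q)) →
      t + (3 * P.d + 8) * B.card ≤ 2 + (3 * P.d + 8) * ((if IsNear P q x then 0 else 1) +
        (B ∪ ({x} : Finset ℕ).filter (IsNear P q)).card) → Q s' t) :
    wp ω checkCmd s Q := by
  refine (wp.frame (Q := fun s' t => Frame checkCmd s s' → Q s' t) ?_).mono
    fun _ _ h => h.2 h.1
  rw [checkCmd, wp_ite]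
  have hmark := hR.mark x
  constructor
  · intro hb
    have hxB : x ∉ B := by
      intro hc
      simp [hx, hmark, hc] at hb
    rw [wp_seq]
    refine wp_sumLoop P.d (fun u => (P.X x u - q u) * (P.X x u - q u)) ?_ ?_ ?_
    · intro s₁ hf
      simp [hf.ints 0 (by decide), hP.d]
    · intro u hu s₁ hf hu₁
      simp [hf.ints 13 (by decide), hf.reals 0 (by decide), hf.reals 2 (by decide), hu₁, hx,
        hR.query u hu, hP.X x hxn u hu]
    · intro s₁ t₁ hf₁ hs₁ ht₁
      have hc₁ : s₁.reals 1 0 0 = P.c := by rw [hf₁.reals 1 (by decide), hP.c]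
      have hx₁ : s₁.ints 13 0 0 = x := by rw [hf₁.ints 13 (by decide), hx]
      have hR₁ : Reported P q s₁ B :=
        hR.congr (hf₁.out (by decide)) (hf₁.ints _ (by decide)) (hf₁.reals _ (by decide))
      have hiff : Test.holds s₁ (.rle (rv 14) (cE.mul cE)) ↔ IsNear P q x := by
        simp only [Test.holds, rv_eval, RExpr.eval, cE, IExpr.eval, hs₁, hc₁, IsNear]
      rw [wp_ite]
      constructor
      · intro hb'
        have hn : IsNear P q x := hiff.mp hb'
        simp only [wp_seq, wp_emit, wp_setI]
        intro hf
        have hB : B ∪ ({x} : Finset ℕ).filter (IsNear P q) = insert x B := by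
          rw [Finset.filter_singleton, if_pos hn, Finset.union_comm]; rfl
        refine hQ _ _ hf ?_ ?_
        · rw [hB]
          refine ⟨?_, ?_, ?_, ?_⟩
          · simp [hx₁, hR₁.out]
          · intro y
            have := hR₁.mark y
            simp only [State.setI_ints, IExpr.eval, iv_eval, hx₁, Nat.cast_inj, and_true,
              true_and, this, Finset.mem_insert]
            by_cases hy : y = x <;> simp [hy]
          · intro y hy
            rcases Finset.mem_insert.mp hy with rfl | hy
            · exact ⟨hxn, hn⟩
            · exact hR.near y hy
          · exact hR₁.query
        · rw [hB, Finset.card_insert_of_notMem hxB, if_pos hn]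
          linarith
      · intro hb'
        have hn : ¬ IsNear P q x := fun h => hb' (hiff.mpr h)
        rw [wp_skip]
        intro hf
        have hB : B ∪ ({x} : Finset ℕ).filter (IsNear P q) = B := by
          rw [Finset.filter_singleton, if_neg hn, Finset.union_empty]
        refine hQ _ _ hf ?_ ?_
        · rw [hB]; exact hR₁
        · rw [hB, if_neg hn]
          linarith
  · intro hb
    have hxB : x ∈ B := by
      by_contra hc
      simp [hx, hmark, hc] at hb
    rw [wp_skip]
    intro hf
    have hn := (hR.near x hxB).2
    have hB : B ∪ ({x} : Finset ℕ).filter (IsNear P q) = B := by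
      rw [Finset.filter_singleton, if_pos hn, Finset.union_eq_left]
      simpa using hxB
    refine hQ _ _ hf ?_ ?_
    · rw [hB]; exact hR
    · rw [hB, if_pos hn]
      linarith

open Classical in
/-- Check all points of a list. -/
theorem wp_checkLoop {q : ℕ → ℝ} {B : Finset ℕ} (hP : P.InState s) (hR : Reported P q s B)
    (v : ℤ) (l : List ℕ) (hv : s.ints vNode 0 0 = v)
    (hrow : RowIs (s.ints aListLen v 0) (s.ints aList v) (l.map Nat.cast))
    (hl : ∀ x ∈ l, x < P.n)
    (hQ : ∀ s' t, Frame (forLoop vA (.get aListLen (iv vNode) (.lit 0))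
        (.seq (assignI vX (.get aList (iv vNode) (iv vA))) checkCmd)) s s' →
      Reported P q s' (B ∪ l.toFinset.filter (IsNear P q)) →
      t + (3 * P.d + 8) * B.card ≤ 2 + 5 * l.length +
        (3 * P.d + 8) * ((l.countP fun x => ¬ IsNear P q x) +
          (B ∪ l.toFinset.filter (IsNear P q)).card) → Q s' t) :
    wp ω (forLoop vA (.get aListLen (iv vNode) (.lit 0))
        (.seq (assignI vX (.get aList (iv vNode) (iv vA))) checkCmd)) s Q := by
  have hlen : s.ints 33 v 0 = l.length := by simpa using hrow.1
  refine wp_for l.length (fun a s' T =>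
    Reported P q s' (B ∪ (l.take a).toFinset.filter (IsNear P q)) ∧
    T + (3 * P.d + 8) * B.card ≤ 5 * a +
        (3 * P.d + 8) * (((l.take a).countP fun x => ¬ IsNear P q x) +
          (B ∪ (l.take a).toFinset.filter (IsNear P q)).card))
    ?_ (by decide) ?_ ?_ ?_
  · intro s₁ hf
    simp [hf.ints 29 (by decide), hf.ints 33 (by decide), hv, hlen]
  · refine ⟨?_, by simp⟩
    simp only [List.take_zero, List.toFinset_nil, Finset.filter_empty, Finset.union_empty]
    exact hR.congr rfl (State.setI_ints_ne _ _ _ _ (by decide)) rfl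
  · rintro a ha s₁ T hf₁ ha₁ ⟨hR₁, hT₁⟩
    have hP₁ : P.InState s₁ := hP.frame hf₁ (by decide) (by decide)
    have hx : IExpr.eval s₁ (IExpr.get 32 (iv 29) (iv 18)) = (l[a] : ℕ) := by
      have := hrow.2 a (by simpa using ha)
      simp only [IExpr.eval, iv_eval, ha₁, hf₁.ints 29 (by decide), hf₁.ints 32 (by decide), hv]
      rw [this]; simp
    rw [wp_seq, wp_assignI, hx]
    have hset : B ∪ (l.take (a + 1)).toFinset.filter (IsNear P q) =
        (B ∪ (l.take a).toFinset.filter (IsNear P q)) ∪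
          ({l[a]} : Finset ℕ).filter (IsNear P q) := by
      rw [List.take_succ_eq_append_getElem ha, List.toFinset_append, Finset.filter_union,
        Finset.union_assoc]
      simp
    have hcount : (l.take (a + 1)).countP (fun x => ¬ IsNear P q x) =
        (l.take a).countP (fun x => ¬ IsNear P q x) + if IsNear P q l[a] then 0 else 1 := by
      rw [List.take_succ_eq_append_getElem ha, List.countP_append]
      by_cases h : IsNear P q l[a] <;> simp [h]
    refine wp_checkCmd (s := s₁.setI 13 0 0 (l[a] : ℕ)) (P := P) (q := q)
      (B := B ∪ (l.take a).toFinset.filter (IsNear P q)) ?_ ?_ l[a] (by simp)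
      (hl _ (List.getElem_mem ha)) ?_
    · exact hP₁.frame (Exec.assignI (ω := ω) s₁ 13 (.lit (l[a] : ℕ))).frame
        (by simp [Cmd.modI, assignI]) (by simp [Cmd.modR, assignI])
    · exact hR₁.congr rfl (State.setI_ints_ne _ _ _ _ (by decide)) rfl
    · intro s₂ t₂ hf₂ hR₂ ht₂
      rw [hset, hcount]
      refine ⟨hR₂.congr rfl (State.setI_ints_ne _ _ _ _ (by decide)) rfl, ?_⟩
      linarith
  · rintro s₁ T hf₁ ⟨hR₁, hT₁⟩
    rw [List.take_length] at hR₁ hT₁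
    exact hQ _ _ hf₁ hR₁ (by linarith)

-- Walking along the labels of the query ends at a node whose list, by `map_mem_nbrs`, consists of
-- the points with neighbouring labels. A failed walk ends at `0`, with an empty list.
open Classical in
theorem wp_lookupCmd {A : ℕ → ℕ → ℝ} {q : ℕ → ℝ} {B : Finset ℕ} (hT : HasTables P A s)
    (hM : P.M = P.J * P.L) (hS : IsStore P.L s (storeFun P A P.n 0))
    (hR : Reported P q s B) (y : ℕ → ℝ) (hy : ∀ r < P.M, s.reals rProj 0 r = y r) {j a : ℕ}
    (hj : j < P.J) (ha : a < P.L ^ P.R)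
    (hr : s.ints vRoot 0 0 = -((j * P.L ^ P.R + a + 1 : ℕ) : ℤ))
    (ho : s.ints vOff 0 0 = (j * P.L : ℕ)) (hp : s.ints vP 0 0 = a)
    (l : List ℕ) (hl : l = (List.range P.n).filter (Collides P A y (j * P.L ^ P.R + a)))
    (hQ : ∀ s' t, Frame lookupCmd s s' →
      Reported P q s' (B ∪ l.toFinset.filter (IsNear P q)) →
      t + (3 * P.d + 8) * B.card ≤ 3 * P.L + 5 + 5 * l.length +
        (3 * P.d + 8) * ((l.countP fun x => ¬ IsNear P q x) +
          (B ∪ l.toFinset.filter (IsNear P q)).card) → Q s' t) :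
    wp ω lookupCmd s Q := by
  refine (wp.frame (Q := fun s' t => Frame lookupCmd s s' → Q s' t) ?_).mono
    fun _ _ h => h.2 h.1
  rw [lookupCmd, wp_seq, wp_assignI, wp_seq]
  set u := j * P.L ^ P.R + a with hu
  set s₀ := s.setI 29 0 0 (IExpr.eval s (iv 24)) with hs₀
  have ne₀ : ∀ b, b ≠ 29 → s₀.ints b = s.ints b := fun b hb => State.setI_ints_ne _ _ _ _ hb
  have hlab : ∀ i < P.L, labelAt s i = unitLabel P y u i := fun i hi =>
    labelAt_eq_unitLabel hT hM y hy hj ha hi ho hp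
  refine wp_for_const P.L 1 (fun i s' => s'.ints 29 0 0 =
    walk (s.ints 30) (-((u + 1 : ℕ) : ℤ)) ((List.range i).map (unitLabel P y u)))
    (fun s' hf => by simp [hf.ints 3 (by decide), ne₀ 3 (by decide), hT.params.L]) (by decide)
    (by rw [State.setI_ints_ne _ _ _ _ (by decide)]; simp [hs₀, hr]) ?_ ?_
  · intro i hi s₁ hf₁ hi₁ hn₁
    rw [wp_assignI]
    refine ⟨?_, le_rfl⟩
    have hl₁ : labelAt s₁ i = unitLabel P y u i := by
      rw [labelAt_congr (hf₁.reals _ (by decide)) (hf₁.reals _ (by decide))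
        (hf₁.reals _ (by decide)) (hf₁.ints _ (by decide)) (hf₁.ints _ (by decide))
        (hf₁.ints _ (by decide))]
      rw [labelAt_congr (s := s) (s' := s₀) rfl rfl rfl (ne₀ 25 (by decide)) (ne₀ 10 (by decide))
        (ne₀ 22 (by decide)), hlab i hi]
    rw [State.setI_ints_ne _ _ _ _ (by decide), List.range_succ, List.map_append, List.map_cons,
      List.map_nil, walk_concat, ← hn₁, ← hl₁]
    simp only [State.setI_ints, and_self, if_true, IExpr.eval, iv_eval, labelE_eval hi₁,
      hf₁.ints 30 (by decide), ne₀ 30 (by decide)]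
  · intro s₁ t₁ hf₁ hn₁ ht₁
    have hf₀ : Frame (assignI 29 (iv 24)) s s₀ := (Exec.assignI (ω := ω) s 29 (iv 24)).frame
    have hrow := hS.rows (-((u + 1 : ℕ) : ℤ)) (by omega) ((List.range P.L).map (unitLabel P y u))
      (by simp)
    have hlist : storeFun P A P.n 0 (-((u + 1 : ℕ) : ℤ))
        ((List.range P.L).map (unitLabel P y u)) = l.map Nat.cast := by
      have hult : u + 1 ≤ P.J * P.L ^ P.R := by
        calc u + 1 ≤ j * P.L ^ P.R + P.L ^ P.R := by omega
          _ = (j + 1) * P.L ^ P.R := by ring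
          _ ≤ P.J * P.L ^ P.R := Nat.mul_le_mul_right _ hj
      have hna : (-((u + 1 : ℕ) : ℤ)).natAbs = u + 1 := by omega
      rw [storeFun, hl, hna, if_neg (by omega)]
      congr 1
      refine List.filter_congr fun x _ => ?_
      simp only [hult, true_and, map_mem_nbrs, Nat.add_sub_cancel, Collides]
      exact decide_eq_decide.mpr Iff.rfl
    rw [hlist] at hrow
    have hP₁ : P.InState s₁ :=
      (hT.params.frame hf₀ (by decide) (by decide)).frame hf₁ (by decide) (by decide)
    refine wp_checkLoop (q := q) (B := B) hP₁ ?_ _ l hn₁ ?_ ?_ ?_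
    · exact hR.congr (hf₁.out (by decide))
        ((hf₁.ints _ (by decide)).trans (ne₀ _ (by decide))) (hf₁.reals _ (by decide))
    · rw [hf₁.ints 33 (by decide), hf₁.ints 32 (by decide), ne₀ 33 (by decide),
        ne₀ 32 (by decide)]
      exact hrow
    · intro x hx
      rw [hl] at hx
      simpa using (List.mem_filter.mp hx).1
    · intro s₂ t₂ hf₂ hR₂ ht₂ hf
      exact hQ _ _ hf hR₂ (by linarith)

open Classical in
/-- The reported points. -/
noncomputable def answer (P : Params) (A : ℕ → ℕ → ℝ) (q : ℕ → ℝ) (m : ℕ) : Finset ℕ :=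
  (Finset.range P.n).filter fun x =>
    IsNear P q x ∧ ∃ u < m, Collides P A (project P.d A q) u x

open Classical in
/-- The number of far points in the list of unit `u`. -/
noncomputable def farCount (P : Params) (A : ℕ → ℕ → ℝ) (q : ℕ → ℝ) (u : ℕ) : ℕ :=
  ((Finset.range P.n).filter fun x =>
    ¬ IsNear P q x ∧ Collides P A (project P.d A q) u x).card

open Classical in
/-- The brute force query. -/
theorem wp_queryCmd_brute {q : ℕ → ℝ} (hP : P.InState s) (hb : s.ints vBrute 0 0 = 1)
    (hR : Reported P q s ∅)
    (hQ : ∀ s' t, Reported P q s' ((Finset.range P.n).filter (IsNear P q)) →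
      t ≤ P.n * (6 * P.d + 20) + 3 → Q s' t) :
    wp ω queryCmd s Q := by
  rw [queryCmd, wp_ite]
  refine ⟨fun _ => ?_, fun hc => absurd (by simp [hb]) hc⟩
  refine wp_for P.n (fun x s' T =>
    Reported P q s' ((Finset.range x).filter (IsNear P q)) ∧
    T ≤ 4 * x + (3 * P.d + 8) * (x + ((Finset.range x).filter (IsNear P q)).card))
    (fun s' hf => by simpa using (hP.frame hf (by decide) (by decide)).n) (by decide) ?_ ?_ ?_
  · refine ⟨?_, by simp⟩
    simp only [Finset.range_zero, Finset.filter_empty]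
    exact hR.congr rfl (State.setI_ints_ne _ _ _ _ (by decide)) rfl
  · rintro x hx s₁ T hf₁ hx₁ ⟨hR₁, hT₁⟩
    have hP₁ : P.InState s₁ := hP.frame hf₁ (by decide) (by decide)
    have hset : (Finset.range (x + 1)).filter (IsNear P q) =
        (Finset.range x).filter (IsNear P q) ∪ ({x} : Finset ℕ).filter (IsNear P q) := by
      rw [Finset.range_add_one, Finset.insert_eq, Finset.union_comm, Finset.filter_union]
    refine wp_checkCmd hP₁ hR₁ x hx₁ hx ?_
    intro s₂ t₂ hf₂ hR₂ ht₂
    rw [hset]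
    refine ⟨hR₂.congr rfl (State.setI_ints_ne _ _ _ _ (by decide)) rfl, ?_⟩
    have : (if IsNear P q x then 0 else 1) ≤ 1 := by split_ifs <;> omega
    nlinarith
  · rintro s₁ T hf₁ ⟨hR₁, hT₁⟩
    refine hQ _ _ hR₁ ?_
    have : ((Finset.range P.n).filter (IsNear P q)).card ≤ P.n :=
      (Finset.card_filter_le _ _).trans (by simp)
    nlinarith

open Classical in
theorem wp_queryCmd {A : ℕ → ℕ → ℝ} {q : ℕ → ℝ} (hT : HasTables P A s)
    (hM : P.M = P.J * P.L) (hS : IsStore P.L s (storeFun P A P.n 0))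
    (hb : s.ints vBrute 0 0 = 0) (hR : Reported P q s ∅)
    (hQ : ∀ s' t, Reported P q s' (answer P A q (P.J * P.L ^ P.R)) →
      t ≤ P.M * (3 * P.d + 6) + P.J * P.L ^ P.R * (3 * P.L + 8) + 5 * P.J + 7 +
        (3 * P.d + 13) * ∑ u ∈ Finset.range (P.J * P.L ^ P.R), farCount P A q u +
        (5 * (P.J * P.L ^ P.R) + 3 * P.d + 8) * (answer P A q (P.J * P.L ^ P.R)).card → Q s' t) :
    wp ω queryCmd s Q := by
  rw [queryCmd, wp_ite]
  refine ⟨fun hc => absurd hc (by simp [hb]), fun _ => ?_⟩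
  rw [wp_seq]
  refine wp_projectCmd hT.params A q 0 (by decide) (fun _ _ => by simp) hT.mat
    (fun u hu => hR.query u hu) ?_
  intro s₁ t₁ hf₁ hy₁ ht₁
  have hT₁ : HasTables P A s₁ := hT.frame hf₁ (by decide) (by decide)
  have hS₁ : IsStore P.L s₁ (storeFun P A P.n 0) :=
    hS.congr (hf₁.ints _ (by decide)) (hf₁.ints _ (by decide)) (hf₁.ints _ (by decide))
      (hf₁.ints _ (by decide))
  have hR₁ : Reported P q s₁ ∅ :=
    hR.congr (hf₁.out (by decide)) (hf₁.ints _ (by decide)) (hf₁.reals _ (by decide))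
  set NP := P.L ^ P.R with hNP
  -- A reported point can occur in all `m` lists at five steps each, but its distance is paid for
  -- only once. A far point costs `3 d + 13` steps per occurrence.
  refine wp_unitsCmd (J := P.J) (N := NP) (L := P.L) (fun m s' T =>
    Reported P q s' (answer P A q m) ∧
    T ≤ m * (3 * P.L + 5) + (3 * P.d + 13) * ∑ u ∈ Finset.range m, farCount P A q u +
      5 * m * (answer P A q m).card + (3 * P.d + 8) * (answer P A q m).card)
    (by decide) hT₁.params.J hT₁.size hT₁.params.L ?_ ?_ ?_ ?_
  · rintro m s₂ s₃ T h hr ho ⟨h1, h2⟩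
    exact ⟨h1.congr ho (h _ (by decide) (by decide) (by decide) (by decide)) (by rw [hr]), h2⟩
  · have : answer P A q 0 = ∅ := by simp [answer]
    rw [this]
    exact ⟨hR₁, by simp⟩
  · rintro j hj a ha s₂ T hf₂ hr₂ ho₂ hp₂ ⟨hR₂, hTT⟩
    have hT₂ : HasTables P A s₂ := hT₁.frame hf₂ (by decide) (by decide)
    have hS₂ : IsStore P.L s₂ (storeFun P A P.n 0) :=
      hS₁.congr (hf₂.ints _ (by decide)) (hf₂.ints _ (by decide)) (hf₂.ints _ (by decide))
        (hf₂.ints _ (by decide))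
    refine wp_lookupCmd hT₂ hM hS₂ hR₂ (project P.d A q)
      (by rw [hf₂.reals 5 (by decide)]; exact hy₁) hj ha hr₂ ho₂ hp₂ _ rfl ?_
    intro s₃ t₃ hf₃ hR₃ ht₃
    rw [← hNP] at hR₃ ht₃
    set m := j * NP + a with hm
    set l := (List.range P.n).filter (Collides P A (project P.d A q) m) with hl
    have hset : answer P A q m ∪ l.toFinset.filter (IsNear P q) = answer P A q (m + 1) := by
      ext x
      simp only [answer, hl, Finset.mem_union, Finset.mem_filter, Finset.mem_range,
        List.mem_toFinset, List.mem_filter, List.mem_range, decide_eq_true_eq]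
      constructor
      · rintro (⟨h1, h2, v, h3, h4⟩ | ⟨⟨h1, h2⟩, h3⟩)
        · exact ⟨h1, h2, v, by omega, h4⟩
        · exact ⟨h1, h3, m, by omega, h2⟩
      · rintro ⟨h1, h2, v, h3, h4⟩
        rcases Nat.lt_succ_iff_lt_or_eq.mp h3 with h | rfl
        · exact Or.inl ⟨h1, h2, v, h, h4⟩
        · exact Or.inr ⟨⟨h1, h4⟩, h2⟩
    have hnd : l.Nodup := List.nodup_range.filter _
    have hfar : (l.countP fun x => ¬ IsNear P q x) = farCount P A q m := by
      rw [List.countP_eq_length_filter, farCount,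
        ← List.toFinset_card_of_nodup (hnd.filter _)]
      congr 1
      ext x
      simp [hl]
    have hlen : l.length ≤ farCount P A q m + (answer P A q (m + 1)).card := by
      have h1 := List.length_eq_countP_add_countP (l := l) (fun x => decide (IsNear P q x))
      have h2 : l.countP (fun x => decide (IsNear P q x)) ≤ (answer P A q (m + 1)).card := by
        rw [List.countP_eq_length_filter, ← List.toFinset_card_of_nodup (hnd.filter _)]
        apply Finset.card_le_card
        intro x
        simp only [answer, hl, Finset.mem_filter, Finset.mem_range,
          List.mem_toFinset, List.mem_filter, List.mem_range, decide_eq_true_eq]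
        rintro ⟨⟨h1, h2⟩, h3⟩
        exact ⟨h1, h3, m, by omega, h2⟩
      have h3 : l.countP (fun a => decide ¬ decide (IsNear P q a) = true) =
          farCount P A q m := by
        rw [← hfar]; congr 1; funext x; simp
      omega
    rw [hset, hfar] at ht₃
    rw [hset] at hR₃
    refine ⟨hR₃, ?_⟩
    have hmono : (answer P A q m).card ≤ (answer P A q (m + 1)).card := by
      rw [← hset]; exact Finset.card_le_card Finset.subset_union_left
    rw [Finset.sum_range_succ]
    have := Nat.mul_le_mul_left (5 * m) hmono
    nlinarith
  · rintro s₂ T t₂ hf₂ ⟨hR₂, hTT⟩ ht₂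
    refine hQ _ _ hR₂ ?_
    linarith

/-! ## The preprocessing program -/

/-- The coordinates of the points. -/
noncomputable def coords {n d : ℕ} (X : Fin n → EuclideanSpace ℝ (Fin d)) (i u : ℕ) : ℝ :=
  if h : i < n ∧ u < d then X ⟨i, h.1⟩ ⟨u, h.2⟩ else 0

/-- The window length, as a real number. -/
noncomputable def window (φ : ℝ) (ll : ℕ) : ℝ := φ * ll + 1

/-- The parameters that the preprocessing computes. -/
noncomputable def mkParams {n d : ℕ} (c φ : ℝ) (X : Fin n → EuclideanSpace ℝ (Fin d))
    (l ll L : ℕ) : Params where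
  n := n
  d := d
  l := l
  k := ⌊window φ ll⌋₊
  L := L
  R := ⌊(L : ℝ) / window φ ll⌋₊
  J := d + l
  M := (d + l) * L
  c := c
  unit := window φ ll / ((d + l : ℕ) * L)
  scale := √(128 * ((d + l : ℕ) * L))
  X := coords X

/-- The parameters if the preprocessing does nothing. -/
noncomputable def bruteParams {n d : ℕ} (c : ℝ) (X : Fin n → EuclideanSpace ℝ (Fin d)) :
    Params where
  n := n
  d := d
  l := 0
  k := 0
  L := 0
  R := 0
  J := 0
  M := 0
  c := c
  unit := 0
  scale := 0
  X := coords X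

theorem inputState_coords {n d : ℕ} (c φ : ℝ) (X : Fin n → EuclideanSpace ℝ (Fin d)) {i u : ℕ}
    (hi : i < n) (hu : u < d) : (inputState c φ X).reals rPoint i u = coords X i u := by
  simp [inputState, coords, hi, hu]

theorem wp_preCmd_brute {n d : ℕ} (c φ : ℝ) (X : Fin n → EuclideanSpace ℝ (Fin d))
    (hnd : n ≤ d)
    (hQ : ∀ s' t, (bruteParams c X).InState s' → s'.ints vBrute 0 0 = 1 →
      s'.ints aMark = (fun _ _ => 0) → t ≤ 2 → Q s' t) :
    wp ω preCmd (inputState c φ X) Q := by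
  rw [preCmd, wp_ite]
  refine ⟨fun _ => ?_, fun h => absurd ?_ h⟩
  · rw [wp_assignI]
    refine hQ _ _ ?_ (by simp) ?_ le_rfl
    · constructor <;> simp [bruteParams, inputState]
      intro i hi u hu
      simpa [inputState] using inputState_coords c φ X hi hu
    · rw [State.setI_ints_ne _ _ _ _ (by decide)]
      funext i j; simp [inputState]
  · simp [inputState, hnd]

/-- A bound for the preprocessing time. -/
def preTime (P : Params) (ll : ℕ) : ℕ :=
  (4 * P.l + 4 * ll + 4 * P.L + 3 * P.J + 30) + (P.M * (P.d * 4 + 4) + 2) +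
  ((P.l + 1) * (P.d * (P.d * (3 * (P.M + P.d) + 6) + 4) + 6) + 3 * P.d + 7) +
  (P.R * (P.L ^ P.R * (P.L * (4 * P.L + 5) + 4) + 6) + 3 * P.L + 7) +
  (P.n * (P.M * (3 * P.d + 6) + P.J * P.L ^ P.R * ((P.L + 1) * (18 * 3 ^ P.L + 7) + 2) +
        P.J * (3 * P.L ^ P.R + 5) + 8) + 3) + 3

/-- The sampled matrix. -/
noncomputable def sampled (P : Params) (ω : Tape) (r u : ℕ) : ℝ := ω (r * P.d + u) / P.scale

/-- The trace of the last Gram matrix. -/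
noncomputable def certTrace (P : Params) (A : ℕ → ℕ → ℝ) : ℝ :=
  ∑ u ∈ Finset.range P.d, gramSeq P.M P.d A (P.l + 1) u u

theorem wp_preCmd {n d : ℕ} (c φ : ℝ) (X : Fin n → EuclideanSpace ℝ (Fin d)) (l ll L : ℕ)
    (hnd : d < n) (hφ : 0 ≤ φ) (hL1 : 1 ≤ L)
    (hl : (n : ℝ) ≤ 2 ^ l) (hl' : ∀ i < l, (2 : ℝ) ^ i < n)
    (hll : (l : ℝ) ≤ 2 ^ ll) (hll' : ∀ i < ll, (2 : ℝ) ^ i < l)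
    (hL : (n : ℝ) * n ≤ (c * c / (16384 * window φ ll)) ^ L)
    (hL' : ∀ i < L, (c * c / (16384 * window φ ll)) ^ i < (n : ℝ) * n)
    (P : Params) (hPdef : P = mkParams c φ X l ll L)
    (hQ : ∀ s' t, P.InState s' → s'.ints aMark = (fun _ _ => 0) →
      t ≤ preTime P ll →
      (certTrace P (sampled P ω) ≤ 1 →
        s'.ints vBrute 0 0 = 0 ∧ HasTables P (sampled P ω) s' ∧
          IsStore P.L s' (storeFun P (sampled P ω) P.n 0)) →
      (¬ certTrace P (sampled P ω) ≤ 1 → s'.ints vBrute 0 0 = 1) → Q s' t) :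
    wp ω preCmd (inputState c φ X) Q := by
  rw [preCmd, wp_ite]
  refine ⟨fun h => absurd h (by simp [inputState]; omega), fun _ => ?_⟩
  rw [wp_seq]
  have hz : ∀ a, a ≠ 0 → (inputState c φ X).ints a = fun _ _ => 0 := by
    intro a ha; funext i j; simp [inputState, ha]
  have hK : 0 ≤ window φ ll := by unfold window; positivity
  refine wp_paramCmd n d l ll L c φ (by simp [inputState]) (by simp [inputState])
    (by simp [inputState]) (by simp [inputState]) (by simp [inputState]) hl hl' hll hll' hL hL' ?_
  intro s₁ t₁ hf₁ e1 e2 e3 e4 e5 e6 e7 e8 ht₁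
  have hP₁ : P.InState s₁ := by
    subst hPdef
    refine ⟨?_, ?_, e1, ?_, e2, ?_, e5, e6, ?_, e7, e8, ?_⟩
    · rw [hf₁.ints 0 (by decide)]; simp [inputState, mkParams]
    · rw [hf₁.ints 0 (by decide)]; simp [inputState, mkParams]
    · rw [e3]
      exact (Int.natCast_floor_eq_floor hK).symm
    · rw [e4]
      exact (Int.natCast_floor_eq_floor (div_nonneg (by positivity) hK)).symm
    · rw [hf₁.reals 1 (by decide)]; simp [inputState, mkParams]
    · rw [hf₁.reals 0 (by decide)]
      exact fun i hi u hu => inputState_coords c φ X hi hu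
  rw [wp_seq]
  refine wp_sampleCmd hP₁ (by rw [hf₁.pos (by decide)]; rfl) ?_
  intro s₂ t₂ hf₂ hA₂ ht₂
  have hP₂ : P.InState s₂ := hP₁.frame hf₂ (by decide) (by decide)
  rw [wp_seq]
  refine wp_traceCmd hP₂ (sampled P ω) hA₂ ?_
  intro s₃ t₃ hf₃ hc₃ hA₃ ht₃
  have hP₃ : P.InState s₃ := hP₂.frame hf₃ (by decide) (by decide)
  have hiff : Test.holds s₃ (.rle (rv 14) .one) ↔ certTrace P (sampled P ω) ≤ 1 := by
    simp only [Test.holds, rv_eval, RExpr.eval, hc₃, certTrace]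
  have hzero : ∀ a ∈ [6, 30, 32, 33, 34], s₃.ints a = fun _ _ => 0 := by
    intro a ha
    have h1 : ∀ a ∈ [6, 30, 32, 33, 34], a ∉ traceCmd.modI := by decide
    have h2 : ∀ a ∈ [6, 30, 32, 33, 34], a ∉ sampleCmd.modI := by decide
    have h3 : ∀ a ∈ [6, 30, 32, 33, 34], a ∉ paramCmd.modI := by decide
    rw [hf₃.ints a (h1 a ha), hf₂.ints a (h2 a ha), hf₁.ints a (h3 a ha)]
    exact hz a (by rintro rfl; revert ha; decide)
  have htot : P.J = d + l ∧ P.L = L ∧ P.l = l := by subst hPdef; exact ⟨rfl, rfl, rfl⟩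
  rw [wp_ite]
  constructor
  · intro hb
    have hb' := hiff.mp hb
    rw [wp_seq]
    refine wp_profileCmd hP₃ (by rw [htot.2.1]; exact hL1) ?_
    intro s₄ t₄ hf₄ hV₄ hsz₄ ht₄
    have hT₄ : HasTables P (sampled P ω) s₄ :=
      ⟨hP₃.frame hf₄ (by decide) (by decide), by rw [hf₄.reals 3 (by decide)]; exact hA₃, hV₄,
        hsz₄⟩
    have hz₄ : ∀ a ∈ [6, 30, 32, 33, 34], s₄.ints a = fun _ _ => 0 := by
      intro a ha
      have h1 : ∀ a ∈ [6, 30, 32, 33, 34], a ∉ profileCmd.modI := by decide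
      rw [hf₄.ints a (h1 a ha), hzero a ha]
    refine wp_buildCmd hT₄ (by subst hPdef; rfl)
      (fun a ha => hz₄ a (by simp at ha ⊢; tauto)) ?_
    intro s₅ t₅ hf₅ hT₅ hS₅ ht₅
    refine hQ _ _ hT₅.params ?_ ?_ ?_ ?_
    · rw [hf₅.ints 34 (by decide), hz₄ 34 (by decide)]
    · rw [preTime, htot.1, htot.2.1, htot.2.2]
      rw [htot.1, htot.2.1] at ht₅
      rw [htot.2.2] at ht₃
      rw [htot.2.1] at ht₄
      omega
    · intro _
      exact ⟨by rw [hf₅.ints 6 (by decide), hz₄ 6 (by decide)], hT₅, hS₅⟩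
    · intro h; exact absurd hb' h
  · intro hb
    have hb' : ¬ certTrace P (sampled P ω) ≤ 1 := fun h => hb (hiff.mpr h)
    rw [wp_assignI]
    refine hQ _ _ ?_ ?_ ?_ ?_ ?_
    · exact hP₃.frame (Exec.assignI (ω := ω) s₃ 6 (.lit 1)).frame (by decide) (by decide)
    · rw [State.setI_ints_ne _ _ _ _ (by decide), hzero 34 (by decide)]
    · rw [preTime, htot.1, htot.2.1, htot.2.2]
      rw [htot.2.2] at ht₃
      omega
    · intro h; exact absurd h hb'
    · intro _; simp

/-- The program in the statement is not run. Its write set records what `queryState` may change, so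
that the frame lemmas apply to the passage from preprocessing to a query. -/
theorem queryState_frame {d : ℕ} (s : State) (q : EuclideanSpace ℝ (Fin d)) :
    Frame (.seq (.setR rQuery (.lit 0) (.lit 0) .zero) (.emit (.lit 0))) s (queryState s q) := by
  refine ⟨fun _ _ => rfl, fun a ha => ?_, fun _ => rfl, fun h => by simp [Cmd.emits] at h⟩
  have : a ≠ 2 := by simpa [Cmd.modR] using ha
  funext i j
  simp [queryState, this]

/-- The coordinates of the query. -/
noncomputable def queryCoords {d : ℕ} (q : EuclideanSpace ℝ (Fin d)) (u : ℕ) : ℝ :=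
  if h : u < d then q ⟨u, h⟩ else 0

theorem reported_queryState {d : ℕ} {s : State} (q : EuclideanSpace ℝ (Fin d)) (hd : P.d = d)
    (hm : s.ints aMark = fun _ _ => 0) : Reported P (queryCoords q) (queryState s q) ∅ := by
  refine ⟨by simp [queryState], ?_, by simp, ?_⟩
  · intro x
    change s.ints 34 x 0 = _
    simp [hm]
  · intro u hu
    rw [hd] at hu
    simp [queryState, queryCoords, hu]

/-! ## The certificate for the norm of the matrix -/

-- In matrix notation, `⟨Bx, Bw⟩ = ⟨w, BᵀBx⟩`.
open Finset in
theorem sum_project_mul_project (h d : ℕ) (B : ℕ → ℕ → ℝ) (x w : ℕ → ℝ) :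
    ∑ r ∈ range h, project d B x r * project d B w r =
      ∑ u ∈ range d, w u * project d (gram h B) x u := by
  simp only [project, gram, mul_sum, sum_mul]
  rw [sum_comm]
  refine sum_congr rfl fun v _ => ?_
  rw [sum_comm]
  exact sum_congr rfl fun u _ => sum_congr rfl fun r _ => by ring

/-- The number of rows of the iterated Gram matrices. -/
def gramHeight (M d t : ℕ) : ℕ := if t = 0 then M else d

/-- The squared norm of the image of a vector under an iterated Gram matrix. -/
noncomputable def gramEnergy (M d : ℕ) (A : ℕ → ℕ → ℝ) (t : ℕ) (x : ℕ → ℝ) : ℝ :=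
  ∑ r ∈ Finset.range (gramHeight M d t), project d (gramSeq M d A t) x r ^ 2

theorem gramEnergy_nonneg (M d : ℕ) (A : ℕ → ℕ → ℝ) (t : ℕ) (x : ℕ → ℝ) :
    0 ≤ gramEnergy M d A t x := Finset.sum_nonneg fun _ _ => sq_nonneg _

/-- Write `G t` for the iterated Gram matrices, so `G (t+1) = (G t)ᵀ (G t)`. Then `|G t x|² = ⟨x, G
(t+1) x⟩`, and the Cauchy–Schwarz inequality applies. -/
theorem gramEnergy_sq_le (M d : ℕ) (A : ℕ → ℕ → ℝ) (t : ℕ) (x : ℕ → ℝ) :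
    gramEnergy M d A t x ^ 2 ≤ (∑ u ∈ Finset.range d, x u ^ 2) * gramEnergy M d A (t + 1) x := by
  have h : gramEnergy M d A t x =
      ∑ u ∈ Finset.range d, x u * project d (gramSeq M d A (t + 1)) x u := by
    rw [gramEnergy, gramSeq, ← gramHeight, ← sum_project_mul_project]
    exact Finset.sum_congr rfl fun _ _ => sq _
  rw [h]
  exact Finset.sum_mul_sq_le_sq_mul_sq _ _ _

/-- The trace of `G (t+1)` is the squared Frobenius norm of `G t`, which bounds the squared operator
norm. -/
theorem gramEnergy_le_trace (M d : ℕ) (A : ℕ → ℕ → ℝ) (t : ℕ) (x : ℕ → ℝ) :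
    gramEnergy M d A t x ≤
      (∑ u ∈ Finset.range d, gramSeq M d A (t + 1) u u) * ∑ u ∈ Finset.range d, x u ^ 2 := by
  simp only [gramSeq, gram, ← sq]
  rw [Finset.sum_comm, Finset.sum_mul, gramEnergy]
  exact Finset.sum_le_sum fun r _ => Finset.sum_mul_sq_le_sq_mul_sq _ _ _

/-- The certificate proves that the matrix does not increase norms. -/
theorem energy_le_of_trace_le_one {M d l : ℕ} {A : ℕ → ℕ → ℝ}
    (h : ∑ u ∈ Finset.range d, gramSeq M d A (l + 1) u u ≤ 1) (x : ℕ → ℝ) :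
    ∑ r ∈ Finset.range M, project d A x r ^ 2 ≤ ∑ u ∈ Finset.range d, x u ^ 2 := by
  have h0 : 0 ≤ ∑ u ∈ Finset.range d, x u ^ 2 := Finset.sum_nonneg fun _ _ => sq_nonneg _
  -- Descent from level `l` to level `0`: if `|G (t+1) x|² ≤ |x|²`, then `|G t x|⁴ ≤ |x|⁴`.
  have key : ∀ j, gramEnergy M d A (l - j) x ≤ ∑ u ∈ Finset.range d, x u ^ 2 := by
    intro j
    induction j with
    | zero =>
      exact (gramEnergy_le_trace M d A l x).trans (mul_le_of_le_one_left h0 h)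
    | succ j ih =>
      rcases Nat.lt_or_ge j l with hj | hj
      · have e : l - j = (l - (j + 1)) + 1 := by omega
        rw [e] at ih
        refine abs_le_of_sq_le_sq' ?_ h0 |>.2
        calc _ ≤ _ := gramEnergy_sq_le M d A _ x
          _ ≤ _ := by rw [sq]; gcongr
      · rw [show l - (j + 1) = l - j by omega]; exact ih
  simpa [gramEnergy, gramHeight, gramSeq] using key l

/-- Each Gram step squares the norm bound. With `w = G (t+1) x` one has `|w|² = ⟨G t x, G t w⟩`;
apply Cauchy–Schwarz and the bound for `t` to both factors, then cancel `|w|²`. -/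
theorem gramEnergy_le_pow {M d : ℕ} {A : ℕ → ℕ → ℝ} {κ : ℝ} (hκ : 0 ≤ κ)
    (h : ∀ x : ℕ → ℝ, ∑ r ∈ Finset.range M, project d A x r ^ 2 ≤
      κ * ∑ u ∈ Finset.range d, x u ^ 2) (t : ℕ) (x : ℕ → ℝ) :
    gramEnergy M d A t x ≤ κ ^ 2 ^ t * ∑ u ∈ Finset.range d, x u ^ 2 := by
  induction t generalizing x with
  | zero => simpa [gramEnergy, gramHeight, gramSeq] using h x
  | succ t ih =>
    set w := project d (gramSeq M d A (t + 1)) x with hw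
    have hh : gramEnergy M d A (t + 1) x = ∑ u ∈ Finset.range d, w u ^ 2 := by
      simp [gramEnergy, gramHeight, hw]
    have h1 : gramEnergy M d A (t + 1) x = ∑ r ∈ Finset.range (gramHeight M d t),
        project d (gramSeq M d A t) x r * project d (gramSeq M d A t) w r := by
      rw [sum_project_mul_project, hh]
      exact Finset.sum_congr rfl fun _ _ => sq _
    have hx : 0 ≤ ∑ u ∈ Finset.range d, x u ^ 2 := Finset.sum_nonneg fun _ _ => sq_nonneg _
    have h2 : gramEnergy M d A (t + 1) x ^ 2 ≤
        (κ ^ 2 ^ t * ∑ u ∈ Finset.range d, x u ^ 2) *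
          (κ ^ 2 ^ t * gramEnergy M d A (t + 1) x) := by
      calc _ ≤ gramEnergy M d A t x * gramEnergy M d A t w := by
            rw [h1]; exact Finset.sum_mul_sq_le_sq_mul_sq _ _ _
        _ ≤ _ := by
          rw [hh]
          exact mul_le_mul (ih x) (ih w) (gramEnergy_nonneg _ _ _ _ _) (by positivity)
    rcases (gramEnergy_nonneg M d A (t + 1) x).eq_or_lt with h0 | h0
    · rw [← h0]; positivity
    · refine le_of_mul_le_mul_right ?_ h0
      calc _ = gramEnergy M d A (t + 1) x ^ 2 := by ring
        _ ≤ _ := h2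
        _ = _ := by rw [pow_succ 2 t, pow_mul]; ring

/-- The diagonal entries are the energies of the unit vectors at level `l`, each at most `2^(-2^l)`,
and there are `d ≤ 2^(2^l)` of them. So the certificate accepts with a margin of `1/2` in the
squared norm. -/
theorem trace_le_one {M d l : ℕ} {A : ℕ → ℕ → ℝ} (hd : d ≤ 2 ^ l)
    (h : ∀ x : ℕ → ℝ, ∑ r ∈ Finset.range M, project d A x r ^ 2 ≤
      1 / 2 * ∑ u ∈ Finset.range d, x u ^ 2) :
    ∑ u ∈ Finset.range d, gramSeq M d A (l + 1) u u ≤ 1 := by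
  have h1 : ∀ u ∈ Finset.range d, gramSeq M d A (l + 1) u u ≤ (1 / 2 : ℝ) ^ 2 ^ l := by
    intro u hu
    have := gramEnergy_le_pow (by norm_num) h l (fun v => if v = u then 1 else 0)
    have e : ∑ v ∈ Finset.range d, (if v = u then (1 : ℝ) else 0) ^ 2 = 1 := by
      simp [Finset.mem_range.mp hu]
    rw [e, mul_one] at this
    refine le_of_eq_of_le ?_ this
    simp only [gramSeq, gram, gramEnergy, gramHeight, project]
    refine Finset.sum_congr rfl fun r _ => ?_
    simp [Finset.mem_range.mp hu, sq]
  calc _ ≤ ∑ u ∈ Finset.range d, (1 / 2 : ℝ) ^ 2 ^ l := Finset.sum_le_sum h1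
    _ = d * (1 / 2 : ℝ) ^ 2 ^ l := by simp
    _ ≤ 2 ^ 2 ^ l * (1 / 2 : ℝ) ^ 2 ^ l := by
      gcongr
      have : d ≤ 2 ^ 2 ^ l := hd.trans (Nat.pow_le_pow_right (by norm_num) Nat.lt_two_pow_self.le)
      exact_mod_cast this
    _ = 1 := by rw [← mul_pow]; norm_num

/-! ## Near points collide with the query -/

theorem one_le_profile (L k t a i : ℕ) : 1 ≤ profile L k t a i := by
  induction t generalizing a with
  | zero => exact le_rfl
  | succ t ih =>
    rw [profile]
    have := ih (a / L)
    split_ifs <;> linarith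

/-- All entries are at least `1`, so adding a window at most doubles each of the at most `k` entries
that it meets. -/
theorem prod_profile_le (L k t a : ℕ) :
    ∏ i ∈ Finset.range L, profile L k t a i ≤ 2 ^ (k * t) := by
  induction t generalizing a with
  | zero => simp [profile]
  | succ t ih =>
    calc ∏ i ∈ Finset.range L, profile L k (t + 1) a i
        ≤ ∏ i ∈ Finset.range L, profile L k t (a / L) i *
            (if a % L ≤ i ∧ i < a % L + k then 2 else 1) := by
          refine Finset.prod_le_prod (fun i _ => zero_le_one.trans (one_le_profile _ _ _ _ _)) ?_
          intro i _
          have := one_le_profile L k t (a / L) i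
          rw [profile]
          split_ifs <;> linarith
      _ ≤ 2 ^ (k * t) * 2 ^ k := by
          rw [Finset.prod_mul_distrib]
          refine mul_le_mul (ih _) ?_ (Finset.prod_nonneg fun _ _ => by split_ifs <;> norm_num)
            (by positivity)
          rw [Finset.prod_ite, Finset.prod_const, Finset.prod_const_one, mul_one]
          refine pow_le_pow_right₀ (by norm_num) ?_
          calc _ ≤ (Finset.Ico (a % L) (a % L + k)).card :=
                Finset.card_le_card fun i hi => by
                  simpa using (Finset.mem_filter.mp hi).2
            _ = k := by simp
      _ = _ := by rw [← pow_add]; ring_nf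

/-- A profile dominates prescribed window weights if these have a small sum. -/
theorem exists_le_profile {L k : ℕ} (hL : 0 < L) (hk : 0 < k) (t : ℕ) (e : ℕ → ℕ)
    (he : ∀ b, e b ≠ 0 → b * k < L) (hs : ∑ b ∈ Finset.range L, e b ≤ t) :
    ∃ a < L ^ t, ∀ i < L, (1 + e (i / k) : ℝ) ≤ profile L k t a i := by
  induction t generalizing e with
  | zero =>
    refine ⟨0, by simp, fun i hi => ?_⟩
    have h0 : e (i / k) = 0 := by
      simp only [nonpos_iff_eq_zero, Finset.sum_eq_zero_iff, Finset.mem_range] at hs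
      exact hs _ ((Nat.div_le_self _ _).trans_lt hi)
    simp [h0, profile]
  | succ t ih =>
    -- Remove one window from the weights. If there is slack, `b0 = 0` serves, truncated subtraction
    -- being harmless; otherwise `b0` is any index of positive weight. The new last digit is its
    -- left end `b0 * k`.
    have hex : ∃ b0 : ℕ, b0 * k < L ∧
        ∑ b ∈ Finset.range L, (if b = b0 then e b - 1 else e b) ≤ t := by
      by_cases h : ∑ b ∈ Finset.range L, e b ≤ t
      · exact ⟨0, by simpa using hL, le_trans (Finset.sum_le_sum fun b _ => by
          split_ifs <;> omega) h⟩
      · obtain ⟨b0, hb0, hne⟩ : ∃ b0 ∈ Finset.range L, e b0 ≠ 0 := by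
          by_contra hc
          push Not at hc
          rw [Finset.sum_eq_zero hc] at h
          omega
        refine ⟨b0, he _ hne, ?_⟩
        rw [← Finset.add_sum_erase _ _ hb0] at hs ⊢
        have : ∑ b ∈ (Finset.range L).erase b0, (if b = b0 then e b - 1 else e b) =
            ∑ b ∈ (Finset.range L).erase b0, e b :=
          Finset.sum_congr rfl fun b hb => if_neg (Finset.ne_of_mem_erase hb)
        rw [this, if_pos rfl]
        omega
    obtain ⟨b0, hb0, hsum⟩ := hex
    obtain ⟨a, ha, hprof⟩ := ih (fun b => if b = b0 then e b - 1 else e b)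
      (fun b hb => he b (by split_ifs at hb <;> omega)) hsum
    refine ⟨a * L + b0 * k, ?_, fun i hi => ?_⟩
    · calc a * L + b0 * k < a * L + L := by omega
        _ = (a + 1) * L := by ring
        _ ≤ L ^ t * L := Nat.mul_le_mul_right _ ha
        _ = L ^ (t + 1) := (pow_succ _ _).symm
    · have h1 : (a * L + b0 * k) / L = a := by
        rw [mul_comm, Nat.mul_add_div hL, Nat.div_eq_of_lt hb0, add_zero]
      have h2 : (a * L + b0 * k) % L = b0 * k := by
        rw [mul_comm a, Nat.mul_add_mod, Nat.mod_eq_of_lt hb0]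
      rw [profile, h1, h2]
      have h3 := hprof i hi
      by_cases hib : i / k = b0
      · have h4 : b0 * k ≤ i ∧ i < b0 * k + k := by
          rw [← hib]
          exact ⟨Nat.div_mul_le_self i k, by
            have := Nat.lt_div_mul_add (a := i) hk; omega⟩
        rw [if_pos hib] at h3
        rw [if_pos h4]
        have : (e (i / k) : ℝ) ≤ ((e (i / k) - 1 : ℕ) : ℝ) + 1 := by
          have : e (i / k) ≤ e (i / k) - 1 + 1 := by omega
          exact_mod_cast this
        linarith
      · rw [if_neg hib] at h3
        split_ifs <;> linarith

theorem abs_floor_sub_floor_le {a b : ℝ} (h : |a - b| ≤ 1) : |⌊a⌋ - ⌊b⌋| ≤ 1 := by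
  rw [abs_le] at h ⊢
  have h1 : ⌊a⌋ ≤ ⌊b + 1⌋ := Int.floor_le_floor (by linarith)
  have h2 : ⌊b⌋ ≤ ⌊a + 1⌋ := Int.floor_le_floor (by linarith)
  rw [Int.floor_add_one] at h1 h2
  constructor <;> linarith

theorem abs_sub_le_of_floor {a b : ℝ} (h : |⌊a⌋ - ⌊b⌋| ≤ 1) : |a - b| ≤ 2 := by
  rw [abs_le] at h ⊢
  have h1 : ((⌊a⌋ : ℤ) : ℝ) ≤ ⌊b⌋ + 1 := by exact_mod_cast (by linarith : ⌊a⌋ ≤ ⌊b⌋ + 1)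
  have h2 : ((⌊b⌋ : ℤ) : ℝ) ≤ ⌊a⌋ + 1 := by exact_mod_cast (by linarith : ⌊b⌋ ≤ ⌊a⌋ + 1)
  constructor <;>
    linarith [Int.floor_le a, Int.lt_floor_add_one a, Int.floor_le b, Int.lt_floor_add_one b]

theorem project_sub (d : ℕ) (A : ℕ → ℕ → ℝ) (z w : ℕ → ℝ) (r : ℕ) :
    project d A (fun u => z u - w u) r = project d A z r - project d A w r := by
  simp [project, mul_sub]

theorem sum_range_mul (f : ℕ → ℝ) (m k : ℕ) :
    ∑ r ∈ Finset.range (m * k), f r =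
      ∑ j ∈ Finset.range m, ∑ i ∈ Finset.range k, f (j * k + i) := by
  induction m with
  | zero => simp
  | succ m ih => rw [Finset.sum_range_succ, ← ih, Nat.succ_mul, Finset.sum_range_add]

/-- A point at distance at most `1` collides with the query in some unit. -/
theorem exists_collides (hM : P.M = P.J * P.L) (hJ : 0 < P.J) (hL : 0 < P.L) (hk : 0 < P.k)
    (hunit : 0 < P.unit) (hR : 1 / (P.J * P.unit) < P.R + 1) (A : ℕ → ℕ → ℝ)
    (hA : ∀ x : ℕ → ℝ, ∑ r ∈ Finset.range P.M, project P.d A x r ^ 2 ≤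
      ∑ u ∈ Finset.range P.d, x u ^ 2) (q : ℕ → ℝ) (x : ℕ)
    (hx : ∑ u ∈ Finset.range P.d, (P.X x u - q u) ^ 2 ≤ 1) :
    ∃ j < P.J * P.L ^ P.R, Collides P A (project P.d A q) j x := by
  set y : ℕ → ℝ := project P.d A (fun u => P.X x u - q u) with hy
  have hJ' : (0 : ℝ) < P.J := by exact_mod_cast hJ
  have htot : ∑ j ∈ Finset.range P.J, ∑ i ∈ Finset.range P.L, y (j * P.L + i) ^ 2 ≤ 1 := by
    refine le_trans (le_of_eq ?_) ((hA _).trans hx)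
    rw [hM, sum_range_mul]
  -- Some block carries at most the average energy.
  obtain ⟨j, hj, hjs⟩ : ∃ j ∈ Finset.range P.J,
      ∑ i ∈ Finset.range P.L, y (j * P.L + i) ^ 2 ≤ 1 / P.J := by
    refine Finset.exists_le_of_sum_le (by simpa using hJ.ne') (htot.trans (le_of_eq ?_))
    simp [hJ'.ne']
  set E : ℕ → ℝ := fun b => ∑ i ∈ (Finset.range P.L).filter (fun i => i / P.k = b),
    y (j * P.L + i) ^ 2 with hE
  have hE0 : ∀ b, 0 ≤ E b := fun b => Finset.sum_nonneg fun _ _ => sq_nonneg _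
  have hEs : ∑ b ∈ Finset.range P.L, E b ≤ 1 / P.J := by
    refine le_trans (le_of_eq ?_) hjs
    refine Finset.sum_fiberwise_of_maps_to (fun i hi => ?_) _
    exact Finset.mem_range.mpr ((Nat.div_le_self _ _).trans_lt (Finset.mem_range.mp hi))
  -- The total energy is less than `R + 1` units, so after rounding down at most `R` units remain,
  -- one for each window of a profile.
  have hes : ∑ b ∈ Finset.range P.L, ⌊E b / P.unit⌋₊ ≤ P.R := by
    have : ((∑ b ∈ Finset.range P.L, ⌊E b / P.unit⌋₊ : ℕ) : ℝ) < P.R + 1 := by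
      refine lt_of_le_of_lt ?_ hR
      push_cast
      calc _ ≤ ∑ b ∈ Finset.range P.L, E b / P.unit :=
            Finset.sum_le_sum fun b _ => Nat.floor_le (div_nonneg (hE0 b) hunit.le)
        _ ≤ 1 / P.J / P.unit := by rw [← Finset.sum_div]; gcongr
        _ = _ := by rw [div_div]
    exact Nat.lt_succ_iff.mp (by exact_mod_cast this)
  have hew : ∀ b, ⌊E b / P.unit⌋₊ ≠ 0 → b * P.k < P.L := by
    intro b hb
    by_contra hc
    refine hb ?_
    have : E b = 0 := by
      simp only [hE]
      rw [Finset.filter_eq_empty_iff.mpr, Finset.sum_empty]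
      rintro i hi rfl
      exact hc ((Nat.div_mul_le_self _ _).trans_lt (Finset.mem_range.mp hi))
    simp [this]
  obtain ⟨a, ha, hprof⟩ := exists_le_profile hL hk P.R (fun b => ⌊E b / P.unit⌋₊) hew hes
  · refine ⟨j * P.L ^ P.R + a, ?_, ?_⟩
    · calc _ < j * P.L ^ P.R + P.L ^ P.R := by omega
        _ = (j + 1) * P.L ^ P.R := by ring
        _ ≤ _ := Nat.mul_le_mul_right _ (Finset.mem_range.mp hj)
    · intro i hi
      have h1 : (j * P.L ^ P.R + a) / P.L ^ P.R = j := by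
        rw [mul_comm, Nat.mul_add_div (by omega), Nat.div_eq_of_lt ha, add_zero]
      have h2 : (j * P.L ^ P.R + a) % P.L ^ P.R = a := by
        rw [mul_comm j, Nat.mul_add_mod, Nat.mod_eq_of_lt ha]
      rw [unitLabel, unitLabel, h1, h2]
      refine abs_floor_sub_floor_le ?_
      rw [← sub_div, abs_div, abs_of_nonneg (Real.sqrt_nonneg _)]
      refine div_le_one_of_le₀ ?_ (Real.sqrt_nonneg _)
      rw [abs_sub_comm, ← project_sub, ← hy, ← Real.sqrt_sq_eq_abs]
      refine Real.sqrt_le_sqrt ?_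
      -- A coordinate has at most the energy of its window, which is below one plus the rounded
      -- number of units; the profile dominates this.
      have h3 : y (j * P.L + i) ^ 2 ≤ E (i / P.k) :=
        Finset.single_le_sum (f := fun i => y (j * P.L + i) ^ 2) (fun _ _ => sq_nonneg _)
          (by simpa using hi)
      have h4 := (Nat.lt_floor_add_one (E (i / P.k) / P.unit)).le
      rw [div_le_iff₀ hunit] at h4
      have h5 := hprof i hi
      calc _ ≤ _ := h3.trans h4
        _ ≤ _ := by
          gcongr
          linarith

/-- If labels differ by at most one, the coordinates differ by at most two cell widths. -/
theorem Collides.abs_le {A : ℕ → ℕ → ℝ} {q : ℕ → ℝ} {j a x : ℕ} (hunit : 0 < P.unit)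
    (ha : a < P.L ^ P.R) (h : Collides P A (project P.d A q) (j * P.L ^ P.R + a) x)
    {i : ℕ} (hi : i < P.L) :
    |project P.d A (fun u => P.X x u - q u) (j * P.L + i)| ≤
      2 * √(profile P.L P.k P.R a i * P.unit) := by
  have h1 : (j * P.L ^ P.R + a) / P.L ^ P.R = j := by
    rw [mul_comm, Nat.mul_add_div (by omega), Nat.div_eq_of_lt ha, add_zero]
  have h2 : (j * P.L ^ P.R + a) % P.L ^ P.R = a := by
    rw [mul_comm j, Nat.mul_add_mod, Nat.mod_eq_of_lt ha]
  have h3 := h i hi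
  rw [unitLabel, unitLabel, h1, h2] at h3
  have h4 := abs_sub_le_of_floor h3
  have hpos : 0 < √(profile P.L P.k P.R a i * P.unit) :=
    Real.sqrt_pos.mpr (mul_pos (zero_lt_one.trans_le (one_le_profile _ _ _ _ _)) hunit)
  rw [← sub_div, abs_div, abs_of_pos hpos, div_le_iff₀ hpos, abs_sub_comm, ← project_sub] at h4
  exact h4

/-! ## Gaussian rows -/

instance : IsProbabilityMeasure tapeLaw := by unfold tapeLaw; infer_instance

theorem iIndepFun_tape : iIndepFun (fun (i : ℕ) (ω : Tape) => ω i) tapeLaw :=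
  iIndepFun_infinitePi (P := fun _ : ℕ => gaussianReal 0 1) (X := fun _ x => x)
    fun _ => measurable_id

theorem map_tape (i : ℕ) : tapeLaw.map (fun ω : Tape => ω i) = gaussianReal 0 1 :=
  Measure.infinitePi_map_eval (μ := fun _ : ℕ => gaussianReal 0 1) i

/-- The inner product of a vector with one row of samples. -/
noncomputable def rowSum (d : ℕ) (z : ℕ → ℝ) (r : ℕ) (ω : Tape) : ℝ :=
  ∑ u ∈ Finset.range d, ω (r * d + u) * z u

theorem measurable_rowSum (d : ℕ) (z : ℕ → ℝ) (r : ℕ) : Measurable (rowSum d z r) := by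
  unfold rowSum
  fun_prop

theorem map_sum_tape (b d : ℕ) (z : ℕ → ℝ) :
    tapeLaw.map (fun ω : Tape => ∑ u ∈ Finset.range d, ω (b + u) * z u) =
      gaussianReal 0 (∑ u ∈ Finset.range d, z u ^ 2).toNNReal := by
  induction d with
  | zero => simp
  | succ d ih =>
    have hind : iIndepFun (fun (u : ℕ) (ω : Tape) => ω (b + u) * z u) tapeLaw :=
      (iIndepFun_tape.precomp (add_right_injective b)).comp (fun u x => x * z u)
        fun u => by fun_prop
    have h1 := hind.indepFun_finsetSum_of_notMem (fun u => by fun_prop)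
      (Finset.notMem_range_self (n := d))
    have h2 : tapeLaw.map (fun ω : Tape => ω (b + d) * z d) =
        gaussianReal 0 (z d ^ 2).toNNReal := by
      rw [← Function.comp_def (fun x => x * z d) (fun ω : Tape => ω (b + d)),
        ← Measure.map_map (by fun_prop) (by fun_prop), map_tape, gaussianReal_map_mul_const]
      congr 1
      · simp
      · ext; simp [Real.coe_toNNReal _ (sq_nonneg (z d))]
    have h3 : (∑ u ∈ Finset.range d, fun ω : Tape => ω (b + u) * z u) =
        fun ω : Tape => ∑ u ∈ Finset.range d, ω (b + u) * z u := by
      ext ω; simp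
    rw [h3] at h1
    have := gaussianReal_add_gaussianReal_of_indepFun h1 ih h2
    rw [Finset.sum_range_succ, Real.toNNReal_add (Finset.sum_nonneg fun _ _ => sq_nonneg _)
      (sq_nonneg _)]
    simp only [Finset.sum_range_succ]
    simpa [Pi.add_def] using this

theorem map_rowSum (d : ℕ) (z : ℕ → ℝ) (r : ℕ) :
    tapeLaw.map (rowSum d z r) = gaussianReal 0 (∑ u ∈ Finset.range d, z u ^ 2).toNNReal :=
  map_sum_tape (r * d) d z

/-- Functions of different rows of samples are independent. -/
theorem lintegral_prod_rowSum (d : ℕ) (z : ℕ → ℝ) (o m : ℕ) (g : ℕ → ℝ → ℝ≥0∞)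
    (hg : ∀ r, Measurable (g r)) :
    ∫⁻ ω, ∏ r ∈ Finset.range m, g r (rowSum d z (o + r) ω) ∂tapeLaw =
      ∏ r ∈ Finset.range m,
        ∫⁻ x, g r x ∂gaussianReal 0 (∑ u ∈ Finset.range d, z u ^ 2).toNNReal := by
  have hm : ∀ r, Measurable fun ω => g r (rowSum d z (o + r) ω) := fun r =>
    (hg r).comp (measurable_rowSum d z _)
  induction m with
  | zero => simp
  | succ m ih =>
    simp only [Finset.prod_range_succ]
    -- Rows before `o + m` read only samples in `S`, and row `o + m` reads only the next `d`
    -- samples; disjoint sets of samples are independent.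
    set S := Finset.range ((o + m) * d)
    set T := Finset.Ico ((o + m) * d) ((o + m) * d + d)
    have hST : Disjoint S T := by
      rw [Finset.disjoint_left]
      intro i hi hi'
      simp only [S, T, Finset.mem_range, Finset.mem_Ico] at hi hi'
      omega
    have hind := iIndepFun_tape.indepFun_finset S T hST fun i => measurable_pi_apply i
    have hrow : ∀ (U : Finset ℕ) (r : ℕ), (∀ u < d, r * d + u ∈ U) →
        ∃ φ : (U → ℝ) → ℝ, Measurable φ ∧ ∀ ω : Tape, rowSum d z r ω = φ fun i : U => ω i := by
      intro U r hU
      refine ⟨fun y => ∑ u : Fin d, y ⟨r * d + u, hU u u.2⟩ * z u, by fun_prop, fun ω => ?_⟩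
      rw [rowSum, Finset.sum_range]
    have hS : ∀ r : ℕ, ∃ φ : (S → ℝ) → ℝ, Measurable φ ∧
        (r < m → ∀ ω : Tape, rowSum d z (o + r) ω = φ fun i : S => ω i) := by
      intro r
      by_cases hr : r < m
      · obtain ⟨φ, h1, h2⟩ := hrow S (o + r) fun u hu => by
          simp only [S, Finset.mem_range]
          calc (o + r) * d + u < (o + r) * d + d := by omega
            _ = (o + r + 1) * d := by ring
            _ ≤ _ := Nat.mul_le_mul_right _ (by omega)
        exact ⟨φ, h1, fun _ => h2⟩
      · exact ⟨fun _ => 0, measurable_const, fun h => absurd h hr⟩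
    choose φ hφ hφ' using hS
    obtain ⟨ψ, hψ, hψ'⟩ := hrow T (o + m) fun u hu => by simp [T, hu]
    have hind2 := hind.comp (φ := fun y => ∏ r ∈ Finset.range m, g r (φ r y))
      (ψ := fun y => g m (ψ y))
      (Finset.measurable_fun_prod _ fun r _ => (hg r).comp (hφ r)) ((hg m).comp hψ)
    have e1 : (fun y => ∏ r ∈ Finset.range m, g r (φ r y)) ∘ (fun (a : Tape) (i : S) => a i) =
        fun ω => ∏ r ∈ Finset.range m, g r (rowSum d z (o + r) ω) := by
      funext ω
      refine Finset.prod_congr rfl fun r hr => ?_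
      rw [hφ' r (Finset.mem_range.mp hr) ω]
    have e2 : (fun y => g m (ψ y)) ∘ (fun (a : Tape) (i : T) => a i) =
        fun ω => g m (rowSum d z (o + m) ω) := by
      funext ω
      simp [hψ' ω]
    rw [e1, e2] at hind2
    rw [← ih, ← map_rowSum d z (o + m), lintegral_map (hg m) (measurable_rowSum d z _)]
    exact lintegral_mul_eq_lintegral_mul_lintegral_of_indepFun
      (Finset.measurable_fun_prod _ fun r _ => hm r) (hm m) hind2

/-- A Gaussian variable is small with small probability. -/
theorem gaussianReal_abs_le {v : NNReal} (hv : v ≠ 0) {b : ℝ} (hb : 0 ≤ b) :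
    gaussianReal 0 v {x | |x| ≤ b} ≤ ENNReal.ofReal (b / √v) := by
  have hset : {x : ℝ | |x| ≤ b} = Set.Icc (-b) b := by ext x; simp [abs_le]
  have hv' : (0 : ℝ) < v := by positivity
  rw [hset, gaussianReal_apply _ hv]
  calc ∫⁻ x in Set.Icc (-b) b, gaussianPDF 0 v x
      ≤ ∫⁻ x in Set.Icc (-b) b, ENNReal.ofReal (1 / √(2 * Real.pi * v)) := by
        refine lintegral_mono fun x => ?_
        rw [gaussianPDF, gaussianPDFReal]
        refine ENNReal.ofReal_le_ofReal ?_
        rw [one_div]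
        refine mul_le_of_le_one_right (by positivity) ?_
        rw [Real.exp_le_one_iff, neg_div, neg_nonpos]
        positivity
    _ = ENNReal.ofReal (1 / √(2 * Real.pi * v) * (b - -b)) := by
        rw [setLIntegral_const, Real.volume_Icc, ← ENNReal.ofReal_mul (by positivity)]
    _ ≤ _ := by
        refine ENNReal.ofReal_le_ofReal ?_
        -- The bound is the length `2 b` times the maximal density `1 / √(2 π v)`; it remains to use
        -- `4 ≤ 2 π`.
        have h1 : 2 * √v ≤ √(2 * Real.pi * v) := by
          rw [show (2 : ℝ) * √v = √(4 * v) by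
            rw [Real.sqrt_mul (by norm_num), show (4 : ℝ) = 2 ^ 2 by norm_num,
              Real.sqrt_sq (by norm_num)]]
          refine Real.sqrt_le_sqrt ?_
          have := Real.pi_gt_three
          nlinarith
        have h2 : 0 < √(v : ℝ) := Real.sqrt_pos.mpr hv'
        rw [div_mul_eq_mul_div, one_mul, div_le_div_iff₀ (by linarith) h2]
        nlinarith

/-- The moment generating function of the square of a Gaussian variable of variance at most `4`. -/
theorem lintegral_exp_sq_gaussianReal_le {v : NNReal} (hv : (v : ℝ) ≤ 4) :
    ∫⁻ x, ENNReal.ofReal (Real.exp (x ^ 2 / 16)) ∂gaussianReal 0 v ≤ ENNReal.ofReal (√2) := by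
  have h1 : (1 : ℝ) ≤ √2 := Real.one_le_sqrt.mpr (by norm_num)
  by_cases h0 : v = 0
  · subst h0
    simp [gaussianReal_zero_var, h1]
  have hv' : (0 : ℝ) < v := by positivity
  rw [gaussianReal_of_var_ne_zero _ h0, lintegral_withDensity_eq_lintegral_mul _
    (measurable_gaussianPDF 0 v) (by fun_prop)]
  have hb : 0 < 1 / (2 * (v : ℝ)) - 1 / 16 := by
    have : (1 : ℝ) / 8 ≤ 1 / (2 * (v : ℝ)) := by
      apply one_div_le_one_div_of_le <;> linarith
    linarith
  have e : ∀ x : ℝ, (gaussianPDF 0 v * fun x => ENNReal.ofReal (Real.exp (x ^ 2 / 16))) x =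
      ENNReal.ofReal ((√(2 * Real.pi * v))⁻¹ *
        Real.exp (-(1 / (2 * v) - 1 / 16) * x ^ 2)) := by
    intro x
    rw [Pi.mul_apply, gaussianPDF, gaussianPDFReal, ← ENNReal.ofReal_mul (by positivity),
      mul_assoc, ← Real.exp_add]
    congr 3
    field_simp
    ring
  simp only [e]
  rw [← ofReal_integral_eq_lintegral_ofReal
    ((integrable_exp_neg_mul_sq hb).const_mul _)
    (ae_of_all _ fun x => by positivity), integral_const_mul, integral_gaussian]
  refine ENNReal.ofReal_le_ofReal ?_
  rw [← Real.sqrt_inv, ← Real.sqrt_mul (by positivity)]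
  refine Real.sqrt_le_sqrt ?_
  have hπ := Real.pi_pos
  -- The expectation equals `√(8 / (8 - v))`, which is at most `√2` for `v ≤ 4`.
  have : (2 * Real.pi * (v : ℝ))⁻¹ * (Real.pi / (1 / (2 * v) - 1 / 16)) = 8 / (8 - v) := by
    have : (8 : ℝ) - v ≠ 0 := by linarith
    have h3 : (1 : ℝ) / (2 * v) - 1 / 16 = (8 - v) / (16 * v) := by
      field_simp
      ring
    rw [h3]
    field_simp
    norm_num
  rw [this, div_le_iff₀ (by linarith)]
  linarith

/-! ## Small ball and norm estimates -/

theorem measurableSet_rowSum_abs_le (d : ℕ) (z : ℕ → ℝ) (o L : ℕ) (b : ℕ → ℝ) :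
    MeasurableSet {ω : Tape | ∀ i < L, |rowSum d z (o + i) ω| ≤ b i} := by
  have : {ω : Tape | ∀ i < L, |rowSum d z (o + i) ω| ≤ b i} =
      ⋂ i, ⋂ (_ : i < L), {ω : Tape | |rowSum d z (o + i) ω| ≤ b i} := by
    ext ω; simp
  rw [this]
  exact MeasurableSet.iInter fun i => MeasurableSet.iInter fun _ =>
    measurableSet_le (measurable_rowSum d z _).abs measurable_const

/-- The probability that all entries of a Gaussian vector are small. -/
theorem tapeLaw_rowSum_abs_le (d : ℕ) (z : ℕ → ℝ) (o L : ℕ) (b : ℕ → ℝ) (hb : ∀ i, 0 ≤ b i)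
    (hz : 0 < ∑ u ∈ Finset.range d, z u ^ 2) :
    tapeLaw {ω : Tape | ∀ i < L, |rowSum d z (o + i) ω| ≤ b i} ≤
      ENNReal.ofReal (∏ i ∈ Finset.range L, b i / √(∑ u ∈ Finset.range d, z u ^ 2)) := by
  have hB : ∀ i, MeasurableSet {x : ℝ | |x| ≤ b i} := fun i =>
    measurableSet_le measurable_id.abs measurable_const
  have e : ∀ ω, ({ω : Tape | ∀ i < L, |rowSum d z (o + i) ω| ≤ b i}).indicator
      (1 : Tape → ℝ≥0∞) ω = ∏ i ∈ Finset.range L,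
        ({x : ℝ | |x| ≤ b i}).indicator (1 : ℝ → ℝ≥0∞) (rowSum d z (o + i) ω) := by
    intro ω
    by_cases h : ∀ i < L, |rowSum d z (o + i) ω| ≤ b i
    · rw [Set.indicator_of_mem (by exact h), Finset.prod_eq_one]
      · rfl
      · intro i hi
        rw [Set.indicator_of_mem (by exact h i (Finset.mem_range.mp hi))]
        rfl
    · rw [Set.indicator_of_notMem (by exact h)]
      push Not at h
      obtain ⟨i, hi, h⟩ := h
      rw [Finset.prod_eq_zero (Finset.mem_range.mpr hi)]
      exact Set.indicator_of_notMem (by simpa using h) _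
  rw [← lintegral_indicator_one (measurableSet_rowSum_abs_le d z o L b), lintegral_congr e,
    lintegral_prod_rowSum d z o L (fun i => ({x : ℝ | |x| ≤ b i}).indicator (1 : ℝ → ℝ≥0∞))
      fun i => measurable_one.indicator (hB i),
    ENNReal.ofReal_prod_of_nonneg fun i _ => div_nonneg (hb i) (Real.sqrt_nonneg _)]
  refine Finset.prod_le_prod' fun i _ => ?_
  rw [lintegral_indicator_one (hB i)]
  refine (gaussianReal_abs_le (by simpa using hz) (hb i)).trans ?_
  rw [Real.coe_toNNReal _ hz.le]

/-- The squared norm of the image of a vector under the matrix of samples. -/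
noncomputable def sampleEnergy (d M : ℕ) (x : ℕ → ℝ) (ω : Tape) : ℝ :=
  ∑ r ∈ Finset.range M, rowSum d x r ω ^ 2

/-- The rows give independent Gaussians of variance `|x|²`, so the expectation factors. The bound
`4` is the squared radius of the ball used in the norm estimate. -/
theorem lintegral_exp_sampleEnergy_le (d M : ℕ) (x : ℕ → ℝ)
    (hx : ∑ u ∈ Finset.range d, x u ^ 2 ≤ 4) :
    ∫⁻ ω, ENNReal.ofReal (Real.exp (sampleEnergy d M x ω / 16)) ∂tapeLaw ≤
      ENNReal.ofReal (√2) ^ M := by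
  have e : ∀ ω, ENNReal.ofReal (Real.exp (sampleEnergy d M x ω / 16)) =
      ∏ r ∈ Finset.range M, ENNReal.ofReal (Real.exp (rowSum d x (0 + r) ω ^ 2 / 16)) := by
    intro ω
    rw [sampleEnergy, Finset.sum_div, Real.exp_sum,
      ENNReal.ofReal_prod_of_nonneg fun _ _ => (Real.exp_pos _).le]
    simp
  rw [lintegral_congr e, lintegral_prod_rowSum d x 0 M
    (fun _ y => ENNReal.ofReal (Real.exp (y ^ 2 / 16))) fun _ => by fun_prop, Finset.prod_const,
    Finset.card_range]
  gcongr
  refine lintegral_exp_sq_gaussianReal_le ?_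
  rw [Real.coe_toNNReal _ (Finset.sum_nonneg fun _ _ => sq_nonneg _)]
  exact hx

theorem queryCoords_eq {d : ℕ} (q : EuclideanSpace ℝ (Fin d)) (u : Fin d) :
    queryCoords q u = q u := by
  simp [queryCoords]

theorem sum_queryCoords_sq {d : ℕ} (q : EuclideanSpace ℝ (Fin d)) :
    ∑ u ∈ Finset.range d, queryCoords q u ^ 2 = ‖q‖ ^ 2 := by
  rw [Finset.sum_range, EuclideanSpace.norm_sq_eq]
  exact Finset.sum_congr rfl fun u _ => by rw [queryCoords_eq, Real.norm_eq_abs, sq_abs]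

theorem sampleEnergy_queryCoords {d : ℕ} (M : ℕ) (y : EuclideanSpace ℝ (Fin d)) (ω : Tape) :
    sampleEnergy d M (queryCoords y) ω =
      ∑ r ∈ Finset.range M, (∑ u : Fin d, ω (r * d + u) * y u) ^ 2 := by
  refine Finset.sum_congr rfl fun r _ => ?_
  rw [rowSum, Finset.sum_range]
  simp only [queryCoords_eq]

theorem measurable_sampleEnergy (d M : ℕ) :
    Measurable fun p : Tape × EuclideanSpace ℝ (Fin d) =>
      sampleEnergy d M (queryCoords p.2) p.1 := by
  simp only [sampleEnergy_queryCoords]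
  fun_prop

/-- By the parallelogram law, one of `x + h` and `x - h` has at least the energy of `x`. -/
theorem sampleEnergy_add_add_sub {d : ℕ} (M : ℕ) (x h : EuclideanSpace ℝ (Fin d)) (ω : Tape) :
    2 * sampleEnergy d M (queryCoords x) ω ≤
      sampleEnergy d M (queryCoords (x + h)) ω + sampleEnergy d M (queryCoords (x - h)) ω := by
  simp only [sampleEnergy_queryCoords]
  rw [Finset.mul_sum, ← Finset.sum_add_distrib]
  refine Finset.sum_le_sum fun r _ => ?_
  simp only [PiLp.add_apply, PiLp.sub_apply, mul_add, mul_sub, Finset.sum_add_distrib,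
    Finset.sum_sub_distrib]
  nlinarith [sq_nonneg (∑ u : Fin d, ω (r * d + u) * h u)]

/-- The exponential of the energy, as a function of the samples and the vector. -/
noncomputable def expEnergy (d M : ℕ) (p : Tape × EuclideanSpace ℝ (Fin d)) : ℝ≥0∞ :=
  ENNReal.ofReal (Real.exp (sampleEnergy d M (queryCoords p.2) p.1 / 16))

theorem measurable_expEnergy (d M : ℕ) : Measurable (expEnergy d M) :=
  (Real.measurable_exp.comp ((measurable_sampleEnergy d M).div_const 16)).ennreal_ofReal

theorem lintegral_expEnergy_le (d M : ℕ) :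
    ∫⁻ ω, (∫⁻ y in Metric.ball (0 : EuclideanSpace ℝ (Fin d)) 2, expEnergy d M (ω, y)) ∂tapeLaw ≤
      ENNReal.ofReal (√2) ^ M *
        (ENNReal.ofReal (2 ^ d) * volume (Metric.ball (0 : EuclideanSpace ℝ (Fin d)) 1)) := by
  rw [lintegral_lintegral_swap (f := fun ω y => expEnergy d M (ω, y))
    (measurable_expEnergy d M).aemeasurable]
  have key : ∀ y ∈ Metric.ball (0 : EuclideanSpace ℝ (Fin d)) 2,
      ∫⁻ ω, expEnergy d M (ω, y) ∂tapeLaw ≤ ENNReal.ofReal (√2) ^ M := by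
    intro y hy
    refine lintegral_exp_sampleEnergy_le d M (queryCoords y) ?_
    rw [sum_queryCoords_sq]
    have h2 : ‖y‖ < 2 := by simpa using hy
    calc ‖y‖ ^ 2 ≤ 2 ^ 2 := by gcongr
      _ = 4 := by norm_num
  calc ∫⁻ y in Metric.ball (0 : EuclideanSpace ℝ (Fin d)) 2, (∫⁻ ω, expEnergy d M (ω, y) ∂tapeLaw)
      ≤ ∫⁻ _ in Metric.ball (0 : EuclideanSpace ℝ (Fin d)) 2, ENNReal.ofReal (√2) ^ M :=
        setLIntegral_mono' measurableSet_ball key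
    _ = _ := by
        rw [setLIntegral_const, Measure.addHaar_ball_of_pos _ _ two_pos,
          finrank_euclideanSpace_fin]

/-- A Gaussian matrix has a large norm with small probability. -/
theorem tapeLaw_sampleEnergy_gt_le (d M : ℕ) (T : ℝ) :
    tapeLaw {ω : Tape | ∃ x : ℕ → ℝ, T * ∑ u ∈ Finset.range d, x u ^ 2 < sampleEnergy d M x ω} ≤
      ENNReal.ofReal (2 ^ (d + 1) * √2 ^ M * Real.exp (-(T / 16))) := by
  set E := EuclideanSpace ℝ (Fin d)
  set e : Tape × E → ℝ≥0∞ := expEnergy d M with he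
  have hem : Measurable e := measurable_expEnergy d M
  have hem' : ∀ ω, Measurable fun y => e (ω, y) := fun ω => hem.comp measurable_prodMk_left
  set F : Tape → ℝ≥0∞ := fun ω => ∫⁻ y in Metric.ball (0 : E) 2, e (ω, y) with hF
  have hFm : Measurable F := hem.lintegral_prod_right'
  set V : ℝ≥0∞ := volume (Metric.ball (0 : E) 1) with hV
  have hV0 : V ≠ 0 := (Metric.measure_ball_pos _ _ one_pos).ne'
  have hVt : V ≠ ⊤ := measure_ball_lt_top.ne
  have hEF : ∫⁻ ω, F ω ∂tapeLaw ≤ ENNReal.ofReal (√2) ^ M * (ENNReal.ofReal (2 ^ d) * V) :=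
    lintegral_expEnergy_le d M
  set K : ℝ≥0∞ := ENNReal.ofReal (Real.exp (T / 16)) * V with hK
  have hK0 : K ≠ 0 := by simp [hK, hV0, Real.exp_pos]
  have hKt : K ≠ ⊤ := ENNReal.mul_ne_top ENNReal.ofReal_ne_top hVt
  -- Averaging over a ball replaces a union bound over a net. If a unit vector `x₀` has energy at
  -- least `T`, then for each `h` in the unit ball `x₀ + h` or `x₀ - h` does too. Both lie in the
  -- ball of radius `2`, so twice the integral over that ball is at least `exp (T / 16)` times the
  -- volume of the unit ball, and Markov's inequality applies.
  have hsub : {ω : Tape | ∃ x : ℕ → ℝ,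
      T * ∑ u ∈ Finset.range d, x u ^ 2 < sampleEnergy d M x ω} ⊆ {ω | K ≤ 2 * F ω} := by
    rintro ω ⟨x, hx⟩
    set S := ∑ u ∈ Finset.range d, x u ^ 2 with hS
    have hS0 : 0 ≤ S := Finset.sum_nonneg fun _ _ => sq_nonneg _
    have hSpos : 0 < S := by
      refine hS0.lt_of_ne fun h => ?_
      have hz : ∀ u ∈ Finset.range d, x u = 0 := fun u hu => by
        have := (Finset.sum_eq_zero_iff_of_nonneg fun u _ => sq_nonneg (x u)).mp h.symm u hu
        simpa using this
      have : sampleEnergy d M x ω = 0 := by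
        refine Finset.sum_eq_zero fun r _ => ?_
        rw [rowSum, Finset.sum_eq_zero, zero_pow two_ne_zero]
        intro u hu
        rw [hz u hu, mul_zero]
      rw [this, ← h, mul_zero] at hx
      exact lt_irrefl _ hx
    have hsq : 0 < √S := Real.sqrt_pos.mpr hSpos
    set x₀ : E := WithLp.toLp 2 fun u : Fin d => x u / √S with hx₀
    have hen : sampleEnergy d M (queryCoords x₀) ω = sampleEnergy d M x ω / S := by
      rw [sampleEnergy_queryCoords, sampleEnergy, Finset.sum_div]
      refine Finset.sum_congr rfl fun r _ => ?_
      rw [rowSum, Finset.sum_range]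
      simp only [hx₀, mul_div_assoc', ← Finset.sum_div]
      rw [div_pow, Real.sq_sqrt hS0]
    have hT₀ : T ≤ sampleEnergy d M (queryCoords x₀) ω := by
      rw [hen, le_div_iff₀ hSpos]; exact hx.le
    have hn : ‖x₀‖ = 1 := by
      have : ‖x₀‖ ^ 2 = 1 := by
        rw [EuclideanSpace.norm_sq_eq]
        simp only [hx₀, Real.norm_eq_abs, sq_abs, div_pow, Real.sq_sqrt hS0, ← Finset.sum_div]
        rw [← Finset.sum_range (fun u => x u ^ 2), div_self hSpos.ne']
      nlinarith [norm_nonneg x₀]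
    have hball : Metric.ball x₀ 1 ⊆ Metric.ball (0 : E) 2 :=
      Metric.ball_subset_ball' (by rw [dist_zero_right, hn]; norm_num)
    have h1 : ∫⁻ h in Metric.ball (0 : E) 1, e (ω, x₀ + h) ≤ F ω := by
      have hp := (measurePreserving_add_left (volume : Measure E) x₀).setLIntegral_comp_preimage
        (measurableSet_ball (x := x₀) (ε := 1)) (hem' ω)
      have : (x₀ + ·) ⁻¹' Metric.ball x₀ 1 = Metric.ball (0 : E) 1 := by
        ext h; simp
      rw [this] at hp
      rw [hp]
      exact lintegral_mono_set hball
    have h2 : ∫⁻ h in Metric.ball (0 : E) 1, e (ω, x₀ - h) ≤ F ω := by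
      have hp := (Measure.measurePreserving_sub_left (volume : Measure E) x₀).setLIntegral_comp_preimage
        (measurableSet_ball (x := x₀) (ε := 1)) (hem' ω)
      have : (fun h => x₀ - h) ⁻¹' Metric.ball x₀ 1 = Metric.ball (0 : E) 1 := by
        ext h; simp [dist_eq_norm]
      rw [this] at hp
      rw [hp]
      exact lintegral_mono_set hball
    calc K = ∫⁻ _ in Metric.ball (0 : E) 1, ENNReal.ofReal (Real.exp (T / 16)) := by
          rw [setLIntegral_const]
      _ ≤ ∫⁻ h in Metric.ball (0 : E) 1, (e (ω, x₀ + h) + e (ω, x₀ - h)) := by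
          refine lintegral_mono fun h => ?_
          have hp := sampleEnergy_add_add_sub M x₀ h ω
          rcases le_total (sampleEnergy d M (queryCoords (x₀ + h)) ω)
            (sampleEnergy d M (queryCoords (x₀ - h)) ω) with hc | hc
          · refine le_trans ?_ le_add_self
            exact ENNReal.ofReal_le_ofReal (Real.exp_le_exp.mpr (by linarith))
          · refine le_trans ?_ le_self_add
            exact ENNReal.ofReal_le_ofReal (Real.exp_le_exp.mpr (by linarith))
      _ = _ := lintegral_add_left ((hem' ω).comp (measurable_const_add x₀)) _
      _ ≤ 2 * F ω := by rw [two_mul]; exact add_le_add h1 h2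
  calc _ ≤ tapeLaw {ω | K ≤ 2 * F ω} := measure_mono hsub
    _ ≤ (∫⁻ ω, 2 * F ω ∂tapeLaw) / K :=
        meas_ge_le_lintegral_div (hFm.const_mul 2).aemeasurable hK0 hKt
    _ ≤ (2 * (ENNReal.ofReal (√2) ^ M * (ENNReal.ofReal (2 ^ d) * V))) / K := by
        rw [lintegral_const_mul _ hFm]
        gcongr
    _ = _ := by
        rw [hK, ← mul_assoc, ← mul_assoc, ENNReal.mul_div_mul_right _ _ hV0 hVt,
          ← ENNReal.ofReal_pow (Real.sqrt_nonneg _), ← ENNReal.ofReal_ofNat,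
          ← ENNReal.ofReal_mul (by norm_num), ← ENNReal.ofReal_mul (by positivity),
          ← ENNReal.ofReal_div_of_pos (Real.exp_pos _), Real.exp_neg]
        congr 1
        rw [pow_succ]
        field_simp

/-! ## The analysis of the random choices -/

/-- The relations between the parameters that the analysis uses; `K` is the real window length. -/
structure Params.Admissible (P : Params) (K : ℝ) : Prop where
  d_pos : 0 < P.d
  n_pos : 0 < P.n
  J_eq : P.J = P.d + P.l
  M_eq : P.M = P.J * P.L
  L_pos : 0 < P.L
  L_le : P.L ≤ P.l
  k_pos : 0 < P.k
  R_le : P.R ≤ P.L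
  window_le : P.k * P.R ≤ P.L
  lt_window : P.L / K < P.R + 1
  K_pos : 0 < K
  unit_eq : P.unit = K / (P.J * P.L)
  scale_eq : P.scale = √(128 * (P.J * P.L))
  n_le : (P.n : ℝ) ≤ 2 ^ P.l
  d_le : P.d ≤ P.n
  c_pos : 0 < P.c
  gap : (P.n : ℝ) * P.n ≤ (P.c * P.c / (16384 * K)) ^ P.L
  table : (P.L : ℝ) ^ P.R ≤ 4 ^ P.L

namespace Params.Admissible

variable {K : ℝ}

theorem J_pos (h : P.Admissible K) : 0 < P.J := by
  rw [h.J_eq]; exact Nat.add_pos_left h.d_pos _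

theorem JL_pos (h : P.Admissible K) : (0 : ℝ) < P.J * P.L := by
  have h1 := h.J_pos
  have h2 := h.L_pos
  positivity

theorem unit_pos (h : P.Admissible K) : 0 < P.unit := by
  rw [h.unit_eq]; exact div_pos h.K_pos h.JL_pos

theorem scale_pos (h : P.Admissible K) : 0 < P.scale := by
  rw [h.scale_eq]; exact Real.sqrt_pos.mpr (mul_pos (by norm_num) h.JL_pos)

theorem scale_sq (h : P.Admissible K) : P.scale ^ 2 = 128 * (P.J * P.L) := by
  rw [h.scale_eq, Real.sq_sqrt (mul_pos (by norm_num) h.JL_pos).le]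

/-- The numbers `J` and `L` cancel, which makes the small ball estimate independent of the
dimension. -/
theorem scale_sq_mul_unit (h : P.Admissible K) : P.scale ^ 2 * P.unit = 128 * K := by
  rw [h.scale_sq, h.unit_eq, mul_assoc, mul_div_cancel₀ _ h.JL_pos.ne']

end Params.Admissible

theorem project_sampled (P : Params) (z : ℕ → ℝ) (r : ℕ) (ω : Tape) :
    project P.d (sampled P ω) z r = rowSum P.d z r ω / P.scale := by
  rw [project, rowSum, Finset.sum_div]
  exact Finset.sum_congr rfl fun u _ => by rw [sampled]; ring

/-- The bounds on the entries of the projection that a collision in a unit implies. -/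
noncomputable def boxBound (P : Params) (a i : ℕ) : ℝ :=
  P.scale * (2 * √(profile P.L P.k P.R a i * P.unit))

theorem boxBound_nonneg {K : ℝ} (h : P.Admissible K) (a i : ℕ) : 0 ≤ boxBound P a i := by
  have := h.scale_pos
  unfold boxBound
  positivity

theorem Collides.rowSum_le {K : ℝ} (h : P.Admissible K) {q : ℕ → ℝ} {j a x : ℕ}
    (ha : a < P.L ^ P.R)
    (hc : Collides P (sampled P ω) (project P.d (sampled P ω) q) (j * P.L ^ P.R + a) x) :
    ∀ i < P.L, |rowSum P.d (fun u => P.X x u - q u) (j * P.L + i) ω| ≤ boxBound P a i := by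
  intro i hi
  have h1 := hc.abs_le h.unit_pos ha hi
  rw [project_sampled, abs_div, abs_of_pos h.scale_pos, div_le_iff₀ h.scale_pos] at h1
  rw [boxBound, mul_comm P.scale]
  exact h1

/-- The probability that a far point collides with the query in a unit. -/
theorem tapeLaw_box_le {K : ℝ} (h : P.Admissible K) {z : ℕ → ℝ} (o a : ℕ)
    (hz : P.c * P.c < ∑ u ∈ Finset.range P.d, z u ^ 2) :
    tapeLaw {ω : Tape | ∀ i < P.L, |rowSum P.d z (o + i) ω| ≤ boxBound P a i} ≤
      ENNReal.ofReal (1 / ((4 : ℝ) ^ P.L * P.n)) := by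
  have hc := h.c_pos
  have hK := h.K_pos
  have hn : (0 : ℝ) < P.n := by exact_mod_cast h.n_pos
  refine (tapeLaw_rowSum_abs_le P.d z o P.L _ (boxBound_nonneg h a)
    ((mul_pos hc hc).trans hz)).trans (ENNReal.ofReal_le_ofReal ?_)
  have hcz : P.c ≤ √(∑ u ∈ Finset.range P.d, z u ^ 2) :=
    Real.le_sqrt_of_sq_le (by rw [sq]; exact hz.le)
  have hV : ∀ i, 0 ≤ profile P.L P.k P.R a i := fun i =>
    zero_le_one.trans (one_le_profile _ _ _ _ _)
  have h1 : ∏ i ∈ Finset.range P.L, boxBound P a i / √(∑ u ∈ Finset.range P.d, z u ^ 2) ≤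
      ∏ i ∈ Finset.range P.L, boxBound P a i / P.c := by
    refine Finset.prod_le_prod (fun i _ => div_nonneg (boxBound_nonneg h a i)
      (Real.sqrt_nonneg _)) fun i _ => ?_
    exact div_le_div_of_nonneg_left (boxBound_nonneg h a i) hc hcz
  refine h1.trans ?_
  have h0 : 0 ≤ ∏ i ∈ Finset.range P.L, boxBound P a i / P.c :=
    Finset.prod_nonneg fun i _ => div_nonneg (boxBound_nonneg h a i) hc.le
  -- Squares are compared: the square of `boxBound` is `4 * 128 * K = 512 * K` times the profile,
  -- and the profile has product at most `2 ^ L`.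
  refine abs_le_of_sq_le_sq' ?_ (by positivity) |>.2
  have h2 : (∏ i ∈ Finset.range P.L, boxBound P a i / P.c) ^ 2 =
      (512 * K / (P.c * P.c)) ^ P.L * ∏ i ∈ Finset.range P.L, profile P.L P.k P.R a i := by
    rw [← Finset.prod_pow, ← Finset.card_range P.L, ← Finset.prod_const, Finset.card_range,
      ← Finset.prod_mul_distrib]
    refine Finset.prod_congr rfl fun i _ => ?_
    have h3 := h.scale_sq_mul_unit
    rw [boxBound, div_pow, mul_pow, mul_pow,
      Real.sq_sqrt (mul_nonneg (hV i) h.unit_pos.le)]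
    rw [show P.scale ^ 2 * (2 ^ 2 * (profile P.L P.k P.R a i * P.unit)) =
      4 * profile P.L P.k P.R a i * (P.scale ^ 2 * P.unit) by ring, h3]
    ring
  rw [h2]
  have h4 : ∏ i ∈ Finset.range P.L, profile P.L P.k P.R a i ≤ 2 ^ P.L :=
    (prod_profile_le _ _ _ _).trans (pow_le_pow_right₀ (by norm_num) h.window_le)
  have hg := h.gap
  -- Here `16384 = 16 * 1024`. The spare factor `16^(-L)` becomes `4^(-L)` after the square root and
  -- pays for the union over all profiles.
  have h5 : (1024 * K / (P.c * P.c)) ^ P.L * (P.c * P.c / (16384 * K)) ^ P.L =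
      (1 / 16 : ℝ) ^ P.L := by
    rw [← mul_pow]
    congr 1
    field_simp
    norm_num
  calc _ ≤ (512 * K / (P.c * P.c)) ^ P.L * 2 ^ P.L := by gcongr
    _ = (1024 * K / (P.c * P.c)) ^ P.L := by rw [← mul_pow]; congr 1; ring
    _ ≤ (1 / 16 : ℝ) ^ P.L / ((P.n : ℝ) * P.n) := by
        rw [le_div_iff₀ (by positivity), ← h5]
        gcongr
    _ = _ := by
        rw [div_pow 1 _ 2, mul_pow, one_div_pow, ← pow_mul, mul_comm P.L 2, pow_mul]
        norm_num
        ring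

open Classical in
/-- The expected number of far points in the lists of a query. -/
theorem exists_farCount_le {K : ℝ} (h : P.Admissible K) (q : ℕ → ℝ) :
    ∃ G : Tape → ℝ≥0∞, Measurable G ∧
      (∀ ω, ((∑ u ∈ Finset.range (P.J * P.L ^ P.R), farCount P (sampled P ω) q u : ℕ) : ℝ≥0∞) ≤
        G ω) ∧ ∫⁻ ω, G ω ∂tapeLaw ≤ P.J := by
  set N := P.L ^ P.R with hN
  have hNpos : 0 < N := pow_pos h.L_pos _
  set B : ℕ → ℕ → Set Tape := fun u x => {ω : Tape | ∀ i < P.L,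
    |rowSum P.d (fun v => P.X x v - q v) (u / N * P.L + i) ω| ≤ boxBound P (u % N) i} with hB
  have hBm : ∀ u x, MeasurableSet (B u x) := fun u x => measurableSet_rowSum_abs_le _ _ _ _ _
  set F := (Finset.range P.n).filter fun x => ¬ IsNear P q x with hF
  have hcard : F.card ≤ P.n := (Finset.card_filter_le _ _).trans (by simp)
  -- Collisions are counted through the larger events `B u x`, whose measurability and probability
  -- are known.
  refine ⟨fun ω => ∑ u ∈ Finset.range (P.J * N), ∑ x ∈ F, (B u x).indicator 1 ω, ?_, ?_, ?_⟩
  · exact Finset.measurable_fun_sum _ fun u _ => Finset.measurable_fun_sum _ fun x _ =>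
      measurable_one.indicator (hBm u x)
  · intro ω
    push_cast
    refine Finset.sum_le_sum fun u _ => ?_
    have : farCount P (sampled P ω) q u ≤ (F.filter fun x => ω ∈ B u x).card := by
      rw [farCount]
      refine Finset.card_le_card fun x hx => ?_
      simp only [Finset.mem_filter] at hx
      simp only [hF, Finset.mem_filter]
      refine ⟨⟨hx.1, hx.2.1⟩, ?_⟩
      refine Collides.rowSum_le h (Nat.mod_lt _ hNpos) ?_
      rw [← hN, mul_comm, Nat.div_add_mod]
      exact hx.2.2
    refine (Nat.cast_le.mpr this).trans (le_of_eq ?_)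
    rw [Finset.card_filter]
    push_cast
    exact Finset.sum_congr rfl fun x _ => by simp [Set.indicator_apply]
  · rw [lintegral_finsetSum _ fun u _ => Finset.measurable_fun_sum _ fun x _ =>
      measurable_one.indicator (hBm u x)]
    have hn : (0 : ℝ) < P.n := by exact_mod_cast h.n_pos
    calc _ ≤ ∑ u ∈ Finset.range (P.J * N), ENNReal.ofReal (1 / 4 ^ P.L) := by
          refine Finset.sum_le_sum fun u _ => ?_
          rw [lintegral_finsetSum _ fun x _ => measurable_one.indicator (hBm u x)]
          calc _ ≤ ∑ x ∈ F, ENNReal.ofReal (1 / ((4 : ℝ) ^ P.L * P.n)) := by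
                refine Finset.sum_le_sum fun x hx => ?_
                rw [lintegral_indicator_one (hBm u x)]
                refine tapeLaw_box_le h _ _ ?_
                have := (Finset.mem_filter.mp hx).2
                rw [IsNear, not_le] at this
                simpa only [sq] using this
            _ ≤ (P.n : ℝ≥0∞) * ENNReal.ofReal (1 / ((4 : ℝ) ^ P.L * P.n)) := by
                rw [Finset.sum_const, nsmul_eq_mul]
                gcongr
            _ = _ := by
                rw [← ENNReal.ofReal_natCast, ← ENNReal.ofReal_mul (by positivity)]
                congr 1
                field_simp
      _ = ENNReal.ofReal (P.J * (N * (1 / 4 ^ P.L))) := by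
          rw [Finset.sum_const, nsmul_eq_mul, Finset.card_range, ← ENNReal.ofReal_natCast,
            ← ENNReal.ofReal_mul (by positivity)]
          push_cast
          ring_nf
      _ ≤ ENNReal.ofReal P.J := by
          refine ENNReal.ofReal_le_ofReal (mul_le_of_le_one_right (by positivity) ?_)
          rw [mul_one_div, div_le_one (by positivity), hN]
          push_cast
          exact h.table
      _ = _ := ENNReal.ofReal_natCast _

/-- The certificate fails with small probability. -/
theorem tapeLaw_certTrace_gt_le {K : ℝ} (h : P.Admissible K) :
    tapeLaw {ω : Tape | ¬ certTrace P (sampled P ω) ≤ 1} ≤ ENNReal.ofReal (1 / P.n) := by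
  have hn : (0 : ℝ) < P.n := by exact_mod_cast h.n_pos
  have hMd : P.d + P.l ≤ P.M := by
    rw [h.M_eq, h.J_eq]
    exact Nat.le_mul_of_pos_right _ h.L_pos
  have hM1 : 1 ≤ P.M := by have := h.d_pos; omega
  have hsc : P.scale ^ 2 = 128 * P.M := by
    rw [h.scale_sq, h.M_eq]; push_cast; ring
  -- The threshold `64 * M` is half of `scale ^ 2`, so below it the scaled matrix has squared norm
  -- at most `1/2`.
  have hsub : {ω : Tape | ¬ certTrace P (sampled P ω) ≤ 1} ⊆
      {ω : Tape | ∃ x : ℕ → ℝ, (64 * P.M : ℝ) * ∑ u ∈ Finset.range P.d, x u ^ 2 <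
        sampleEnergy P.d P.M x ω} := by
    intro ω hω
    by_contra hc
    simp only [Set.mem_ofPred_eq, not_exists, not_lt] at hc
    refine hω (trace_le_one ?_ fun x => ?_)
    · have : (P.d : ℝ) ≤ 2 ^ P.l := le_trans (by exact_mod_cast h.d_le) h.n_le
      exact_mod_cast this
    · have h1 := hc x
      have hs := pow_pos h.scale_pos 2
      have e : ∑ r ∈ Finset.range P.M, project P.d (sampled P ω) x r ^ 2 =
          sampleEnergy P.d P.M x ω / P.scale ^ 2 := by
        rw [sampleEnergy, Finset.sum_div]
        exact Finset.sum_congr rfl fun r _ => by rw [project_sampled, div_pow]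
      rw [e, div_le_iff₀ hs, hsc]
      linarith
  refine (measure_mono hsub).trans ((tapeLaw_sampleEnergy_gt_le P.d P.M _).trans
    (ENNReal.ofReal_le_ofReal ?_))
  have h16 : (16 : ℝ) ≤ Real.exp 4 := by
    have h1 := Real.add_one_le_exp (1 : ℝ)
    have h2 : Real.exp 4 = Real.exp 1 ^ 4 := by rw [← Real.exp_nat_mul]; norm_num
    rw [h2]
    calc (16 : ℝ) = 2 ^ 4 := by norm_num
      _ ≤ _ := by gcongr; linarith
  have h2 : (√2 : ℝ) ≤ 2 := by
    rw [Real.sqrt_le_left (by norm_num)]; norm_num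
  -- Since `d + 1 ≤ 2 M`, `√2 ≤ 2` and `e⁴ ≥ 16`, the bound is at most `(8/16)^M`; finally `M ≥ l`.
  calc (2 : ℝ) ^ (P.d + 1) * √2 ^ P.M * Real.exp (-(64 * P.M / 16))
      ≤ 2 ^ (2 * P.M) * 2 ^ P.M * (1 / 16) ^ P.M := by
        have e : Real.exp (-(64 * P.M / 16)) = (1 / Real.exp 4) ^ P.M := by
          rw [one_div, ← Real.exp_neg, ← Real.exp_nat_mul]; congr 1; ring
        rw [e]
        gcongr
        · norm_num
        · omega
    _ = (1 / 2) ^ P.M := by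
        rw [pow_mul, ← mul_pow, ← mul_pow]; norm_num
    _ ≤ (1 / 2) ^ P.l := pow_le_pow_of_le_one (by norm_num) (by norm_num) (by omega)
    _ = 1 / 2 ^ P.l := by rw [one_div_pow]
    _ ≤ 1 / P.n := one_div_le_one_div_of_le hn h.n_le

/-! ## The choice of the parameters -/

theorem exists_least_pow {a : ℝ} (ha : 1 < a) (b : ℝ) :
    ∃ l : ℕ, b ≤ a ^ l ∧ ∀ i < l, a ^ i < b := by
  classical
  have h : ∃ l : ℕ, b ≤ a ^ l := (pow_unbounded_of_one_lt b ha).imp fun _ h => h.le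
  exact ⟨Nat.find h, Nat.find_spec h, fun i hi => not_le.mp (Nat.find_min h hi)⟩

theorem pred_mul_log_lt {a b : ℝ} {l : ℕ} (ha : 0 < a) (h : ∀ i < l, a ^ i < b) (hl : 0 < l) :
    ((l : ℝ) - 1) * Real.log a < Real.log b := by
  have h1 := Real.log_lt_log (pow_pos ha _) (h (l - 1) (by omega))
  rwa [Real.log_pow, Nat.cast_sub hl, Nat.cast_one] at h1

theorem half_lt_log_two : (1 : ℝ) / 2 < Real.log 2 := by
  have := Real.log_two_gt_d9
  linarith

/-- What the choice of the parameters gives. -/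
structure ParamBounds (n : ℕ) (c φ μ : ℝ) (l ll L R : ℕ) : Prop where
  l_le : (l : ℝ) ≤ 3 * Real.log n
  ll_le : ll ≤ l
  L_pos : 1 ≤ L
  L_le : L ≤ l
  clog : (n : ℝ) ≤ 2 ^ l
  clog' : ∀ i < l, (2 : ℝ) ^ i < n
  clogclog : (l : ℝ) ≤ 2 ^ ll
  clogclog' : ∀ i < ll, (2 : ℝ) ^ i < l
  gap : (n : ℝ) * n ≤ (c * c / (16384 * window φ ll)) ^ L
  gap' : ∀ i < L, (c * c / (16384 * window φ ll)) ^ i < (n : ℝ) * n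
  table : (L : ℝ) ^ R ≤ 4 ^ L
  table_le : (L : ℝ) ^ R ≤ 2 * (n : ℝ) ^ (1 / φ)
  three_pow_le : (3 : ℝ) ^ L ≤ 3 * (n : ℝ) ^ (Real.log 3 / Real.log (c / μ))

theorem log_clog_le {n l : ℕ} (hΛ : 2 ≤ Real.log n) (hl' : ∀ i < l, (2 : ℝ) ^ i < n) :
    (l : ℝ) ≤ 3 * Real.log n := by
  rcases Nat.eq_zero_or_pos l with h | h
  · subst h; simp; linarith
  · have h1 := pred_mul_log_lt two_pos hl' h
    have h2 := half_lt_log_two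
    have h3 : (0 : ℝ) ≤ (l : ℝ) - 1 := by
      have : (1 : ℝ) ≤ l := by exact_mod_cast h
      linarith
    nlinarith

theorem clog_clog_le {n l ll : ℕ} (hΛ : 2 ≤ Real.log n) (hlam : 8 ≤ Real.log (Real.log n))
    (hl : (l : ℝ) ≤ 3 * Real.log n) (hll' : ∀ i < ll, (2 : ℝ) ^ i < l) :
    (ll : ℝ) ≤ 4 * Real.log (Real.log n) := by
  rcases Nat.eq_zero_or_pos ll with h | h
  · subst h; simp; linarith
  · have h1 := pred_mul_log_lt two_pos (fun i hi => (hll' i hi).trans_le hl) h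
    rw [Real.log_mul (by norm_num) (by linarith)] at h1
    have h2 := half_lt_log_two
    have h3 : (0 : ℝ) ≤ (ll : ℝ) - 1 := by
      have : (1 : ℝ) ≤ ll := by exact_mod_cast h
      linarith
    have h4 : Real.log 3 ≤ 3 - 1 := Real.log_le_sub_one_of_pos (by norm_num)
    nlinarith

/-- The constant `600` comes from `K ≤ 5 φ log log n` and `4 * 16384 * 5 ≤ 600²`, which give `ρ ≥ 4
(c/μ)²`. The factor `4` yields `L ≤ l` and `2^L ≤ 2n`; the factor `(c/μ)²` yields the bound for
`3^L`. -/
theorem exists_paramBounds {n : ℕ} {c φ : ℝ} (hΛ : 2 ≤ Real.log n)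
    (hlam : 8 ≤ Real.log (Real.log n)) (hφ : 1 ≤ φ) (hc : threshold 600 φ n < c) :
    ∃ l ll L : ℕ, ParamBounds n c φ (threshold 600 φ n) l ll L ⌊(L : ℝ) / window φ ll⌋₊ := by
  have hn1 : (1 : ℝ) < n := by
    by_contra h
    have := Real.log_nonpos (Nat.cast_nonneg n) (not_lt.mp h)
    linarith
  have hn0 : (0 : ℝ) < n := by linarith
  set lam := Real.log (Real.log n) with hlamd
  set μ := threshold 600 φ n with hμd
  have hφlam : 0 < φ * lam := by positivity
  have hμ : 0 < μ := by
    rw [hμd, threshold]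
    exact mul_pos (by norm_num) (Real.sqrt_pos.mpr hφlam)
  have hμsq : μ * μ = 360000 * (φ * lam) := by
    rw [hμd, threshold, mul_mul_mul_comm, Real.mul_self_sqrt hφlam.le]
    norm_num
  have hc0 : 0 < c := hμ.trans hc
  obtain ⟨l, hl, hl'⟩ := exists_least_pow one_lt_two (n : ℝ)
  obtain ⟨ll, hll, hll'⟩ := exists_least_pow one_lt_two (l : ℝ)
  have hl3 := log_clog_le hΛ hl'
  have hll4 := clog_clog_le hΛ hlam hl3 hll'
  set K := window φ ll with hKd
  have hK1 : 1 ≤ K := by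
    rw [hKd, window]
    have : 0 ≤ φ * (ll : ℝ) := by positivity
    linarith
  have hK0 : 0 < K := by linarith
  have hKφ : φ * ll ≤ K := by rw [hKd, window]; linarith
  have hK5 : K ≤ 5 * (φ * lam) := by
    rw [hKd, window]
    have h1 : φ * (ll : ℝ) ≤ φ * (4 * lam) := by gcongr
    nlinarith
  set ρ := c * c / (16384 * K) with hρd
  have hρ : 4 * (c / μ) ^ 2 ≤ ρ := by
    rw [hρd, div_pow, sq μ, hμsq, mul_div_assoc', sq, div_le_div_iff₀ (by positivity)
      (by positivity)]
    have : 0 < c * c := by positivity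
    nlinarith
  have hcμ : 1 < c / μ := (one_lt_div hμ).mpr hc
  have hρ4 : 4 ≤ ρ := by nlinarith
  have hρ0 : 0 < ρ := by linarith
  obtain ⟨L, hL, hL'⟩ := exists_least_pow (by linarith : 1 < ρ) ((n : ℝ) * n)
  have hL1 : 1 ≤ L := by
    by_contra h
    have : L = 0 := by omega
    rw [this, pow_zero] at hL
    nlinarith
  have hLl : L ≤ l := by
    by_contra h
    have h1 := hL' l (by omega)
    have h2 : (n : ℝ) * n ≤ ρ ^ l := by
      calc (n : ℝ) * n ≤ 2 ^ l * 2 ^ l := by gcongr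
        _ = 4 ^ l := by rw [← mul_pow]; norm_num
        _ ≤ ρ ^ l := by gcongr
    linarith
  have h2L : (2 : ℝ) ^ L ≤ 2 * n := by
    have h1 := hL' (L - 1) (by omega)
    have h2 : ((2 : ℝ) ^ (L - 1)) ^ 2 ≤ (n : ℝ) ^ 2 := by
      calc ((2 : ℝ) ^ (L - 1)) ^ 2 = 4 ^ (L - 1) := by rw [← pow_mul, mul_comm, pow_mul]; norm_num
        _ ≤ ρ ^ (L - 1) := by gcongr
        _ ≤ (n : ℝ) ^ 2 := by rw [sq]; exact h1.le
    have h3 := (abs_le_of_sq_le_sq' h2 hn0.le).2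
    calc (2 : ℝ) ^ L = 2 ^ (L - 1 + 1) := by rw [Nat.sub_add_cancel hL1]
      _ ≤ 2 * n := by rw [pow_succ]; linarith
  set R := ⌊(L : ℝ) / K⌋₊ with hRd
  have hRK : R * K ≤ L := by
    rw [← le_div_iff₀ hK0]
    exact Nat.floor_le (by positivity)
  -- This is the purpose of the window length: `ll * R` bounds `log₂ (L^R)`, and it is at most `L /
  -- φ` because `φ * ll ≤ K` and `R * K ≤ L`.
  have hllR : φ * ((ll * R : ℕ) : ℝ) ≤ L := by
    push_cast
    calc φ * (ll * R) = R * (φ * ll) := by ring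
      _ ≤ R * K := by gcongr
      _ ≤ L := hRK
  have hLR : (L : ℝ) ^ R ≤ 2 ^ (ll * R) := by
    rw [pow_mul]
    gcongr
    exact le_trans (by exact_mod_cast hLl) hll
  refine ⟨l, ll, L, ⟨hl3, ?_, hL1, hLl, hl, hl', hll, hll', hL, hL', ?_, ?_, ?_⟩⟩
  · by_contra h
    have h1 := hll' l (by omega)
    have h2 : (l : ℝ) < 2 ^ l := by exact_mod_cast Nat.lt_two_pow_self
    linarith
  · refine hLR.trans ?_
    have h1 : ll * R ≤ L := by
      have : ((ll * R : ℕ) : ℝ) ≤ L := le_trans (le_mul_of_one_le_left (by positivity) hφ) hllR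
      exact_mod_cast this
    calc (2 : ℝ) ^ (ll * R) ≤ 2 ^ L := pow_le_pow_right₀ (by norm_num) h1
      _ ≤ 4 ^ L := by gcongr; norm_num
  · refine hLR.trans ?_
    have hφ0 : 0 < φ := by linarith
    calc (2 : ℝ) ^ (ll * R) = (2 : ℝ) ^ ((ll * R : ℕ) : ℝ) := (Real.rpow_natCast _ _).symm
      _ ≤ (2 : ℝ) ^ ((L : ℝ) * (1 / φ)) := by
          refine Real.rpow_le_rpow_of_exponent_le (by norm_num) ?_
          rw [mul_one_div, le_div_iff₀ hφ0, mul_comm]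
          exact hllR
      _ = ((2 : ℝ) ^ L) ^ (1 / φ) := by
          rw [Real.rpow_mul (by norm_num), Real.rpow_natCast]
      _ ≤ (2 * n) ^ (1 / φ) := by gcongr
      _ = 2 ^ (1 / φ) * n ^ (1 / φ) := Real.mul_rpow (by norm_num) hn0.le
      _ ≤ 2 ^ (1 : ℝ) * n ^ (1 / φ) := by
          gcongr
          · norm_num
          · rw [div_le_one hφ0]; exact hφ
      _ = _ := by rw [Real.rpow_one]
  · have h1 := hL' (L - 1) (by omega)
    have hlog : 0 < Real.log (c / μ) := Real.log_pos hcμ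
    -- By minimality of `L`, `ρ^(L-1) < n²`. Hence `L - 1 < ln n / ln (c/μ)`, and the remaining
    -- factor `3` goes into the constant.
    have h2 : ((c / μ) ^ (L - 1)) ^ 2 < (n : ℝ) ^ 2 := by
      calc ((c / μ) ^ (L - 1)) ^ 2 = ((c / μ) ^ 2) ^ (L - 1) := by
            rw [← pow_mul, mul_comm, pow_mul]
        _ ≤ ρ ^ (L - 1) := by
            gcongr
            nlinarith [sq_nonneg (c / μ)]
        _ < (n : ℝ) ^ 2 := by rw [sq]; exact h1
    have h3 : (c / μ) ^ (L - 1) < n := lt_of_pow_lt_pow_left₀ 2 hn0.le h2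
    have h4 := Real.log_lt_log (by positivity) h3
    rw [Real.log_pow] at h4
    calc (3 : ℝ) ^ L = 3 * 3 ^ (L - 1) := by rw [← pow_succ', Nat.sub_add_cancel hL1]
      _ ≤ _ := by
        gcongr
        rw [← Real.rpow_natCast, Real.rpow_def_of_pos (by norm_num),
          Real.rpow_def_of_pos hn0, Real.exp_le_exp, mul_div_assoc', le_div_iff₀ hlog]
        have h5 : 0 < Real.log 3 := Real.log_pos (by norm_num)
        nlinarith

theorem admissible_mkParams {n d l ll L : ℕ} {c φ μ : ℝ} (X : Fin n → EuclideanSpace ℝ (Fin d))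
    (hd : 0 < d) (hdn : d < n) (hφ : 0 ≤ φ) (hc : 0 < c)
    (h : ParamBounds n c φ μ l ll L ⌊(L : ℝ) / window φ ll⌋₊) :
    (mkParams c φ X l ll L).Admissible (window φ ll) := by
  have hK1 : 1 ≤ window φ ll := by
    rw [window]
    have : 0 ≤ φ * (ll : ℝ) := by positivity
    linarith
  have hK0 : 0 < window φ ll := by linarith
  have hRK : (⌊(L : ℝ) / window φ ll⌋₊ : ℝ) * window φ ll ≤ L := by
    rw [← le_div_iff₀ hK0]
    exact Nat.floor_le (by positivity)
  have hL := h.L_pos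
  refine ⟨hd, by simp only [mkParams]; omega, rfl, rfl, hL, h.L_le, ?_, ?_, ?_, ?_, hK0, rfl, rfl,
    h.clog, hdn.le, hc, h.gap, h.table⟩
  · exact Nat.floor_pos.mpr hK1
  · have : (⌊(L : ℝ) / window φ ll⌋₊ : ℝ) ≤ L :=
      le_trans (le_mul_of_one_le_right (by positivity) hK1) hRK
    exact_mod_cast this
  · have : (⌊window φ ll⌋₊ : ℝ) * ⌊(L : ℝ) / window φ ll⌋₊ ≤ L := by
      refine le_trans ?_ hRK
      rw [mul_comm]
      gcongr
      exact Nat.floor_le hK0.le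
    exact_mod_cast this
  · exact Nat.lt_floor_add_one _

/-- Everything follows from `J ≤ 2 d l` and `M ≤ 2 d l²`. The Gram matrices cost about `d³ l³`,
which fits because `d ≤ n`. -/
theorem preTime_le {P : Params} {K : ℝ} {ll : ℕ} (h : P.Admissible K) (hll : ll ≤ P.l) :
    preTime P ll ≤ 500 * (P.l ^ 3 *
      (P.d ^ 2 * P.n + P.d * P.n * (P.L ^ P.R * 3 ^ P.L))) := by
  have hd := h.d_pos
  have hLl := h.L_le
  have hRl : P.R ≤ P.l := h.R_le.trans hLl
  have hl : 0 < P.l := h.L_pos.trans_le hLl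
  have hn := h.n_pos
  have hdn := h.d_le
  have hp : 0 < P.L ^ P.R := pow_pos h.L_pos _
  have hT : 0 < 3 ^ P.L := by positivity
  have hJ : P.J ≤ 2 * (P.d * P.l) := by rw [h.J_eq]; nlinarith
  have hM : P.M ≤ 2 * (P.d * P.l ^ 2) := by
    rw [h.M_eq]
    calc P.J * P.L ≤ 2 * (P.d * P.l) * P.l := Nat.mul_le_mul hJ hLl
      _ = _ := by ring
  rw [preTime]
  generalize P.L ^ P.R = p at *
  generalize 3 ^ P.L = T at *
  generalize P.J = J at *
  generalize P.M = M at *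
  generalize P.R = R at *
  generalize P.L = L at *
  generalize P.l = l at *
  generalize P.d = d at *
  generalize P.n = n at *
  have c1 : ∀ {m : ℕ} (k : ℕ), 0 < m → k ≤ k * m := fun k hm => Nat.le_mul_of_pos_right k hm
  have hdl : 0 < d * l := by positivity
  have b1 : 4 * l + 4 * ll + 4 * L + 3 * J + 30 ≤ 48 * (l ^ 3 * (d ^ 2 * n)) := by
    have h1 : l ≤ d * l := Nat.le_mul_of_pos_left _ hd
    have h2 := c1 30 hdl
    calc _ ≤ 48 * (d * l) := by omega
      _ ≤ 48 * (d * l * (l ^ 2 * d * n)) := by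
        exact Nat.mul_le_mul_left _ (Nat.le_mul_of_pos_right _ (by positivity))
      _ = _ := by ring
  have b2 : M * (d * 4 + 4) + 2 ≤ 18 * (l ^ 3 * (d ^ 2 * n)) := by
    have h2 := c1 2 (show 0 < d ^ 2 * l ^ 2 by positivity)
    calc M * (d * 4 + 4) + 2 ≤ 2 * (d * l ^ 2) * (8 * d) + 2 * (d ^ 2 * l ^ 2) := by
          gcongr; omega
      _ = 18 * (d ^ 2 * l ^ 2) := by ring
      _ ≤ 18 * (d ^ 2 * l ^ 2 * (l * n)) := by
        exact Nat.mul_le_mul_left _ (Nat.le_mul_of_pos_right _ (by positivity))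
      _ = _ := by ring
  have b3 : (l + 1) * (d * (d * (3 * (M + d) + 6) + 4) + 6) + 3 * d + 7 ≤
      60 * (l ^ 3 * (d ^ 2 * n)) := by
    have h0 : d ≤ d * l ^ 2 := Nat.le_mul_of_pos_right _ (by positivity)
    have h1 : 3 * (M + d) + 6 ≤ 15 * (d * l ^ 2) := by
      have := c1 6 (show 0 < d * l ^ 2 by positivity)
      omega
    have h2 : d * (3 * (M + d) + 6) + 4 ≤ 19 * (d ^ 2 * l ^ 2) := by
      have := c1 4 (show 0 < d ^ 2 * l ^ 2 by positivity)
      calc _ ≤ d * (15 * (d * l ^ 2)) + 4 * (d ^ 2 * l ^ 2) := by gcongr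
        _ = _ := by ring
    have h3 : d * (d * (3 * (M + d) + 6) + 4) + 6 ≤ 25 * (d ^ 3 * l ^ 2) := by
      have := c1 6 (show 0 < d ^ 3 * l ^ 2 by positivity)
      calc _ ≤ d * (19 * (d ^ 2 * l ^ 2)) + 6 * (d ^ 3 * l ^ 2) := by gcongr
        _ = _ := by ring
    have h4 : d ≤ d * (d ^ 2 * l ^ 3) := Nat.le_mul_of_pos_right _ (by positivity)
    have h5 := c1 7 (show 0 < d * (d ^ 2 * l ^ 3) by positivity)
    calc _ ≤ (2 * l) * (25 * (d ^ 3 * l ^ 2)) + 3 * (d * (d ^ 2 * l ^ 3)) +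
          7 * (d * (d ^ 2 * l ^ 3)) := by gcongr; omega
      _ = 60 * (l ^ 3 * (d ^ 2 * d)) := by ring
      _ ≤ _ := by gcongr
  have b4 : R * (p * (L * (4 * L + 5) + 4) + 6) + 3 * L + 7 ≤
      29 * (l ^ 3 * (d * n * (p * T))) := by
    have h1 : L * (4 * L + 5) + 4 ≤ 13 * l ^ 2 := by
      have := c1 4 (show 0 < l ^ 2 by positivity)
      calc _ ≤ l * (9 * l) + 4 * l ^ 2 := by gcongr; omega
        _ = _ := by ring
    have h2 : p * (L * (4 * L + 5) + 4) + 6 ≤ 19 * (p * l ^ 2) := by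
      have := c1 6 (show 0 < p * l ^ 2 by positivity)
      calc _ ≤ p * (13 * l ^ 2) + 6 * (p * l ^ 2) := by gcongr
        _ = _ := by ring
    have h3 : l ≤ l * (p * l ^ 2) := Nat.le_mul_of_pos_right _ (by positivity)
    have h4 := c1 7 (show 0 < l * (p * l ^ 2) by positivity)
    calc _ ≤ l * (19 * (p * l ^ 2)) + 3 * (l * (p * l ^ 2)) + 7 * (l * (p * l ^ 2)) := by
          gcongr; omega
      _ = 29 * (p * l ^ 3) := by ring
      _ ≤ 29 * (p * l ^ 3 * (d * n * T)) := by
        exact Nat.mul_le_mul_left _ (Nat.le_mul_of_pos_right _ (by positivity))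
      _ = _ := by ring
  have b5 : n * (M * (3 * d + 6) + J * p * ((L + 1) * (18 * T + 7) + 2) + J * (3 * p + 5) + 8) + 3
      ≤ 29 * (l ^ 3 * (d ^ 2 * n)) + 120 * (l ^ 3 * (d * n * (p * T))) := by
    have h1 : M * (3 * d + 6) ≤ 18 * (d ^ 2 * l ^ 2) := by
      calc _ ≤ 2 * (d * l ^ 2) * (9 * d) := by gcongr; omega
        _ = _ := by ring
    have h2 : (L + 1) * (18 * T + 7) + 2 ≤ 52 * (l * T) := by
      have := c1 2 (show 0 < l * T by positivity)
      calc _ ≤ 2 * l * (25 * T) + 2 * (l * T) := by gcongr <;> omega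
        _ = _ := by ring
    have h3 : J * p * ((L + 1) * (18 * T + 7) + 2) ≤ 104 * (l ^ 2 * d * (p * T)) := by
      calc _ ≤ 2 * (d * l) * p * (52 * (l * T)) := by gcongr
        _ = _ := by ring
    have h4 : J * (3 * p + 5) ≤ 16 * (l ^ 2 * d * (p * T)) := by
      calc _ ≤ 2 * (d * l) * (8 * p) := by gcongr; omega
        _ = 16 * (d * l * p) := by ring
        _ ≤ 16 * (d * l * p * (l * T)) := by
          exact Nat.mul_le_mul_left _ (Nat.le_mul_of_pos_right _ (by positivity))
        _ = _ := by ring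
    have h5 := c1 8 (show 0 < d ^ 2 * l ^ 2 by positivity)
    have h6 := c1 3 (show 0 < n * (d ^ 2 * l ^ 2) by positivity)
    calc _ ≤ n * (18 * (d ^ 2 * l ^ 2) + 104 * (l ^ 2 * d * (p * T)) +
          16 * (l ^ 2 * d * (p * T)) + 8 * (d ^ 2 * l ^ 2)) + 3 * (n * (d ^ 2 * l ^ 2)) := by
          gcongr
      _ = 29 * (l ^ 2 * (d ^ 2 * n)) + 120 * (l ^ 2 * (d * n * (p * T))) := by ring
      _ ≤ _ := by
        gcongr <;> omega
  have b6 := c1 3 (show 0 < l ^ 3 * (d ^ 2 * n) by positivity)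
  rw [mul_add (l ^ 3)]
  omega

/-! ## Correctness of the answers -/

theorem sum_coords_sub_sq {n d : ℕ} (X : Fin n → EuclideanSpace ℝ (Fin d))
    (q : EuclideanSpace ℝ (Fin d)) (i : Fin n) :
    ∑ u ∈ Finset.range d, (coords X i u - queryCoords q u) ^ 2 = dist (X i) q ^ 2 := by
  rw [EuclideanSpace.dist_eq, Real.sq_sqrt (Finset.sum_nonneg fun _ _ => sq_nonneg _),
    Finset.sum_range]
  refine Finset.sum_congr rfl fun u _ => ?_
  rw [queryCoords_eq, Real.dist_eq, sq_abs]
  simp [coords]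

/-- The parameters describe the points `X` and the approximation factor `c`. -/
structure Params.Describes {n d : ℕ} (P : Params) (c : ℝ) (X : Fin n → EuclideanSpace ℝ (Fin d)) :
    Prop where
  n_eq : P.n = n
  d_eq : P.d = d
  c_eq : P.c = c
  X_eq : P.X = coords X

theorem isNear_iff {n d : ℕ} {c : ℝ} {X : Fin n → EuclideanSpace ℝ (Fin d)}
    (h : P.Describes c X) (hc : 0 < c) (q : EuclideanSpace ℝ (Fin d)) (i : Fin n) :
    IsNear P (queryCoords q) i ↔ dist (X i) q ≤ c := by
  rw [IsNear, h.d_eq, h.c_eq, h.X_eq]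
  simp only [← sq]
  rw [sum_coords_sub_sq, sq_le_sq₀ dist_nonneg hc.le]

open Classical in
/-- The reported points, as a set of indices. -/
noncomputable def indexSet (n : ℕ) (B : Finset ℕ) : Finset (Fin n) :=
  Finset.univ.filter fun i => (i : ℕ) ∈ B

theorem image_indexSet {n : ℕ} {B : Finset ℕ} (hB : ∀ x ∈ B, x < n) :
    B.image Nat.cast = (indexSet n B).image (fun i : Fin n => ((i : ℕ) : ℤ)) := by
  ext z
  simp only [Finset.mem_image, indexSet, Finset.mem_filter, Finset.mem_univ, true_and]
  constructor
  · rintro ⟨x, hx, rfl⟩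
    exact ⟨⟨x, hB x hx⟩, hx, rfl⟩
  · rintro ⟨i, hi, rfl⟩
    exact ⟨i, hi, rfl⟩

theorem card_indexSet {n : ℕ} {B : Finset ℕ} (hB : ∀ x ∈ B, x < n) :
    (indexSet n B).card = B.card := by
  rw [← Finset.card_image_of_injective (indexSet n B) Fin.val_injective]
  congr 1
  ext x
  simp only [Finset.mem_image, indexSet, Finset.mem_filter, Finset.mem_univ, true_and]
  exact ⟨by rintro ⟨i, hi, rfl⟩; exact hi, fun hx => ⟨⟨x, hB x hx⟩, hx, rfl⟩⟩

/-- The memory after preprocessing; `g` says that the data structure has been built. -/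
structure Prepared (P : Params) (A : ℕ → ℕ → ℝ) (g : Prop) (s : State) : Prop where
  params : P.InState s
  mark : s.ints aMark = fun _ _ => 0
  built : g → s.ints vBrute 0 0 = 0 ∧ HasTables P A s ∧ IsStore P.L s (storeFun P A P.n 0)
  brute : ¬ g → s.ints vBrute 0 0 = 1

-- The answer is correct for every tape: a point is reported only after an exact distance test, and
-- a point within distance `1` is tested either by the scan or, once the certificate holds, by
-- `exists_collides`.
open Classical in
theorem wp_query_prepared {n d : ℕ} {c K : ℝ} {X : Fin n → EuclideanSpace ℝ (Fin d)}
    {A : ℕ → ℕ → ℝ} {g : Prop} (hX : P.Describes c X) (hc : 1 ≤ c) (hs : Prepared P A g s)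
    (hg : g → P.Admissible K ∧ certTrace P A ≤ 1) (q : EuclideanSpace ℝ (Fin d)) :
    wp ω queryCmd (queryState s q) fun s' t => ∃ B : Finset (Fin n),
      s'.out = B.image (fun i : Fin n => ((i : ℕ) : ℤ)) ∧ IsAnswer c X q B ∧
      (g → t ≤ P.M * (3 * P.d + 6) + P.J * P.L ^ P.R * (3 * P.L + 8) + 5 * P.J + 7 +
        (3 * P.d + 13) *
          ∑ u ∈ Finset.range (P.J * P.L ^ P.R), farCount P A (queryCoords q) u +
        (5 * (P.J * P.L ^ P.R) + 3 * P.d + 8) * B.card) ∧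
      (¬ g → t ≤ n * (6 * d + 20) + 3) := by
  have hc0 : 0 < c := zero_lt_one.trans_le hc
  have hf := queryState_frame s q
  have hR := reported_queryState q hX.d_eq hs.mark
  have hP : P.InState (queryState s q) := hs.params.frame hf (by decide) (by decide)
  have key : ∀ B : Finset ℕ, (∀ x ∈ B, x < P.n ∧ IsNear P (queryCoords q) x) →
      (∀ i : Fin n, dist (X i) q ≤ 1 → (i : ℕ) ∈ B) →
      B.image Nat.cast = (indexSet n B).image (fun i : Fin n => ((i : ℕ) : ℤ)) ∧
        IsAnswer c X q (indexSet n B) ∧ (indexSet n B).card = B.card := by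
    intro B hB hB1
    have hBn : ∀ x ∈ B, x < n := fun x hx => hX.n_eq ▸ (hB x hx).1
    refine ⟨image_indexSet hBn, ⟨fun i hi => ?_, fun i hi => ?_⟩, card_indexSet hBn⟩
    · simp [indexSet, hB1 i hi]
    · have : (i : ℕ) ∈ B := by simpa [indexSet] using hi
      exact (isNear_iff hX hc0 q i).mp (hB _ this).2
  by_cases h : g
  · obtain ⟨h1, h2, h3⟩ := hs.built h
    obtain ⟨ha, hcert⟩ := hg h
    refine wp_queryCmd (h2.frame hf (by decide) (by decide)) ha.M_eq
      (h3.congr rfl rfl rfl rfl) h1 hR ?_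
    intro s' t hR' ht
    have hc1 : ∀ i : Fin n, dist (X i) q ≤ 1 → IsNear P (queryCoords q) i ∧
        ∃ u < P.J * P.L ^ P.R, Collides P A (project P.d A (queryCoords q)) u i := by
      intro i hi
      have hd1 : ∑ u ∈ Finset.range P.d, (P.X i u - queryCoords q u) ^ 2 ≤ 1 := by
        rw [hX.d_eq, hX.X_eq, sum_coords_sub_sq]
        exact pow_le_one₀ dist_nonneg hi
      -- The left side equals `L / K`, and `R` is its floor.
      have hR1 : 1 / (P.J * P.unit) < P.R + 1 := by
        have hJ : (0 : ℝ) < P.J := by exact_mod_cast ha.J_pos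
        have hL : (0 : ℝ) < P.L := by exact_mod_cast ha.L_pos
        have hK := ha.K_pos
        refine lt_of_eq_of_lt ?_ ha.lt_window
        rw [ha.unit_eq]
        field_simp
      refine ⟨(isNear_iff hX hc0 q i).mpr (hi.trans hc), exists_collides ha.M_eq ha.J_pos ha.L_pos ha.k_pos ha.unit_pos hR1 A
        (energy_le_of_trace_le_one hcert) _ _ hd1⟩
    obtain ⟨e1, e2, e3⟩ := key _ hR'.near (fun i hi => by
      obtain ⟨a1, a2⟩ := hc1 i hi
      simp only [answer, Finset.mem_filter, Finset.mem_range]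
      exact ⟨hX.n_eq ▸ i.2, a1, a2⟩)
    refine ⟨_, hR'.out.trans e1, e2, fun _ => ?_, fun hh => absurd h hh⟩
    rw [e3]
    exact ht
  · refine wp_queryCmd_brute hP (hs.brute h) hR ?_
    intro s' t hR' ht
    obtain ⟨e1, e2, e3⟩ := key _ hR'.near (fun i hi => by
      simp only [Finset.mem_filter, Finset.mem_range]
      refine ⟨hX.n_eq ▸ i.2, (isNear_iff hX hc0 q i).mpr (hi.trans hc)⟩)
    refine ⟨_, hR'.out.trans e1, e2, fun hh => absurd hh h, fun _ => ?_⟩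
    rw [hX.n_eq, hX.d_eq] at ht
    exact ht

/-! ## The expected running times -/

/-- Separates the programs from the probability estimates. The query time `u` and the answer size
`b` are arbitrary functions subject to pointwise bounds, so nothing is assumed about their
measurability. -/
theorem solvedBy_of_prepared {n d : ℕ} {c φ : ℝ} {A : ℝ≥0∞} {B : ℝ≥0∞ → ℝ≥0∞} (hc : 1 ≤ c)
    (H : ∀ X : Fin n → EuclideanSpace ℝ (Fin d), ∃ (P : Params) (K : ℝ) (g : Tape → Prop) (T : ℕ),
      P.Describes c X ∧ (∀ ω, g ω → P.Admissible K ∧ certTrace P (sampled P ω) ≤ 1) ∧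
      (∀ ω, wp ω preCmd (inputState c φ X) fun s t =>
        Prepared P (sampled P ω) (g ω) s ∧ t ≤ T) ∧
      (T : ℝ≥0∞) ≤ A ∧
      ∀ (q : ℕ → ℝ) (u b : Tape → ℕ),
        (∀ ω, g ω → u ω ≤ P.M * (3 * P.d + 6) + P.J * P.L ^ P.R * (3 * P.L + 8) + 5 * P.J + 7 +
          (3 * P.d + 13) *
            ∑ u ∈ Finset.range (P.J * P.L ^ P.R), farCount P (sampled P ω) q u +
          (5 * (P.J * P.L ^ P.R) + 3 * P.d + 8) * b ω) →
        (∀ ω, ¬ g ω → u ω ≤ n * (6 * d + 20) + 3) →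
        ∫⁻ ω, (u ω : ℝ≥0∞) ∂tapeLaw ≤ B (∫⁻ ω, (b ω : ℝ≥0∞) ∂tapeLaw)) :
    SolvedBy preCmd queryCmd n d c φ A B := by
  intro X
  obtain ⟨P, K, g, T, hX, hg, hpre, hT, hB⟩ := H X
  choose σ t he hs ht using hpre
  refine ⟨σ, t, he, ?_, fun q => ?_⟩
  · calc ∫⁻ ω, (t ω : ℝ≥0∞) ∂tapeLaw ≤ ∫⁻ _, (T : ℝ≥0∞) ∂tapeLaw :=
          lintegral_mono fun ω => Nat.cast_le.mpr (ht ω)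
      _ = T := by simp
      _ ≤ A := hT
  · have hq := fun ω => wp_query_prepared (ω := ω) hX hc (hs ω) (hg ω) q
    choose ρ u hu b hb1 hb2 hb3 hb4 using hq
    exact ⟨ρ, u, b, hu, hb1, hb2, hB (queryCoords q) u (fun ω => (b ω).card) hb3 hb4⟩

theorem describes_mkParams {n d : ℕ} (c φ : ℝ) (X : Fin n → EuclideanSpace ℝ (Fin d))
    (l ll L : ℕ) : (mkParams c φ X l ll L).Describes c X := ⟨rfl, rfl, rfl, rfl⟩

theorem describes_bruteParams {n d : ℕ} (c : ℝ) (X : Fin n → EuclideanSpace ℝ (Fin d)) :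
    (bruteParams c X).Describes c X := ⟨rfl, rfl, rfl, rfl⟩

/-- The expected query time, in terms of the parameters. -/
theorem lintegral_query_le {K : ℝ} (h : P.Admissible K) (q : ℕ → ℝ) (u b : Tape → ℕ)
    (hu : ∀ ω, certTrace P (sampled P ω) ≤ 1 →
      u ω ≤ P.M * (3 * P.d + 6) + P.J * P.L ^ P.R * (3 * P.L + 8) + 5 * P.J + 7 +
        (3 * P.d + 13) * ∑ u ∈ Finset.range (P.J * P.L ^ P.R), farCount P (sampled P ω) q u +
        (5 * (P.J * P.L ^ P.R) + 3 * P.d + 8) * b ω)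
    (hu' : ∀ ω, ¬ certTrace P (sampled P ω) ≤ 1 → u ω ≤ P.n * (6 * P.d + 20) + 3) :
    ∫⁻ ω, (u ω : ℝ≥0∞) ∂tapeLaw ≤
      (P.M * (3 * P.d + 6) + P.J * P.L ^ P.R * (3 * P.L + 8) + 5 * P.J + 7 +
        (3 * P.d + 13) * P.J + (6 * P.d + 23) : ℕ) +
      (5 * (P.J * P.L ^ P.R) + 3 * P.d + 8 : ℕ) * ∫⁻ ω, (b ω : ℝ≥0∞) ∂tapeLaw := by
  obtain ⟨G, hGm, hG, hGi⟩ := exists_farCount_le h q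
  set T₀ := P.M * (3 * P.d + 6) + P.J * P.L ^ P.R * (3 * P.L + 8) + 5 * P.J + 7 with hT₀
  set T₁ := 5 * (P.J * P.L ^ P.R) + 3 * P.d + 8 with hT₁
  -- The failure event is enlarged to a measurable one of the same probability. The only summand not
  -- known to be measurable is then the one with `b`, which `lintegral_add_right` permits.
  set F := toMeasurable tapeLaw {ω : Tape | ¬ certTrace P (sampled P ω) ≤ 1} with hF
  have hFm : MeasurableSet F := measurableSet_toMeasurable _ _
  have hFl : tapeLaw F ≤ ENNReal.ofReal (1 / P.n) := by
    rw [hF, measure_toMeasurable]; exact tapeLaw_certTrace_gt_le h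
  have hn : (0 : ℝ) < P.n := by exact_mod_cast h.n_pos
  set W : ℝ≥0∞ := ((P.n * (6 * P.d + 23) : ℕ) : ℝ≥0∞) with hW
  have hpt : ∀ ω, (u ω : ℝ≥0∞) ≤ (T₁ : ℝ≥0∞) * b ω +
      ((T₀ : ℝ≥0∞) + (((3 * P.d + 13 : ℕ) : ℝ≥0∞) * G ω + F.indicator (fun _ => W) ω)) := by
    intro ω
    by_cases hc : certTrace P (sampled P ω) ≤ 1
    · calc (u ω : ℝ≥0∞) ≤ ((T₀ + (3 * P.d + 13) * ∑ u ∈ Finset.range (P.J * P.L ^ P.R),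
            farCount P (sampled P ω) q u + T₁ * b ω : ℕ) : ℝ≥0∞) := by exact_mod_cast hu ω hc
        _ = (T₁ : ℝ≥0∞) * b ω + ((T₀ : ℝ≥0∞) + ((3 * P.d + 13 : ℕ) : ℝ≥0∞) *
              ((∑ u ∈ Finset.range (P.J * P.L ^ P.R),
                farCount P (sampled P ω) q u : ℕ) : ℝ≥0∞)) := by
            rw [Nat.cast_add, Nat.cast_add, Nat.cast_mul, Nat.cast_mul, add_comm]
        _ ≤ _ := by
            gcongr
            exact (mul_le_mul_right (hG ω) _).trans le_self_add
    · have hm : ω ∈ F := subset_toMeasurable _ _ hc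
      rw [Set.indicator_of_mem hm]
      calc (u ω : ℝ≥0∞) ≤ W := by
            rw [hW]
            refine Nat.cast_le.mpr ((hu' ω hc).trans ?_)
            have := h.n_pos
            nlinarith
        _ ≤ _ := le_add_left (le_add_left le_add_self)
  calc ∫⁻ ω, (u ω : ℝ≥0∞) ∂tapeLaw ≤ _ := lintegral_mono hpt
    _ = (T₁ : ℝ≥0∞) * ∫⁻ ω, (b ω : ℝ≥0∞) ∂tapeLaw + ((T₀ : ℝ≥0∞) +
          (((3 * P.d + 13 : ℕ) : ℝ≥0∞) * ∫⁻ ω, G ω ∂tapeLaw + W * tapeLaw F)) := by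
        rw [lintegral_add_right _ (by
          exact measurable_const.add ((hGm.const_mul _).add (measurable_const.indicator hFm))),
          lintegral_const_mul' _ _ (ENNReal.natCast_ne_top _), lintegral_add_left measurable_const,
          lintegral_add_left (hGm.const_mul _), lintegral_const_mul _ hGm,
          lintegral_indicator_const hFm]
        simp
    _ ≤ (T₁ : ℝ≥0∞) * ∫⁻ ω, (b ω : ℝ≥0∞) ∂tapeLaw + ((T₀ : ℝ≥0∞) +
          (((3 * P.d + 13 : ℕ) : ℝ≥0∞) * (P.J : ℝ≥0∞) + ((6 * P.d + 23 : ℕ) : ℝ≥0∞))) := by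
        gcongr
        calc W * tapeLaw F ≤ W * ENNReal.ofReal (1 / P.n) := by gcongr
          _ = _ := by
            rw [hW, ← ENNReal.ofReal_natCast, ← ENNReal.ofReal_mul (by positivity),
              ← ENNReal.ofReal_natCast]
            congr 1
            push_cast
            field_simp
    _ = _ := by push_cast; ring

theorem query_const_le {K : ℝ} (h : P.Admissible K) :
    P.M * (3 * P.d + 6) + P.J * P.L ^ P.R * (3 * P.L + 8) + 5 * P.J + 7 +
        (3 * P.d + 13) * P.J + (6 * P.d + 23) ≤
      100 * (P.l ^ 2 * (P.d ^ 2 + P.d * P.L ^ P.R)) ∧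
    5 * (P.J * P.L ^ P.R) + 3 * P.d + 8 ≤ 100 * (P.l ^ 2 * (P.d * P.L ^ P.R)) := by
  have hd := h.d_pos
  have hLl := h.L_le
  have hl : 0 < P.l := h.L_pos.trans_le hLl
  have hp : 0 < P.L ^ P.R := pow_pos h.L_pos _
  have hJ : P.J ≤ 2 * (P.d * P.l) := by rw [h.J_eq]; nlinarith
  have hM : P.M ≤ 2 * (P.d * P.l ^ 2) := by
    rw [h.M_eq]
    calc P.J * P.L ≤ 2 * (P.d * P.l) * P.l := Nat.mul_le_mul hJ hLl
      _ = _ := by ring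
  generalize P.L ^ P.R = p at *
  generalize P.J = J at *
  generalize P.M = M at *
  generalize P.L = L at *
  generalize P.l = l at *
  generalize P.d = d at *
  have hll : l ≤ l ^ 2 := Nat.le_self_pow two_ne_zero l
  have hdd : d ≤ d ^ 2 := Nat.le_self_pow two_ne_zero d
  have hJ' : J ≤ 2 * (l ^ 2 * d ^ 2) :=
    hJ.trans (Nat.mul_le_mul_left _ (by rw [mul_comm]; exact Nat.mul_le_mul hll hdd))
  have h1 : 1 ≤ l ^ 2 * d ^ 2 := Nat.succ_le_of_lt (by positivity)
  have hdl : d ≤ l ^ 2 * d ^ 2 := hdd.trans (Nat.le_mul_of_pos_left _ (by positivity))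
  have b1 : M * (3 * d + 6) ≤ 18 * (l ^ 2 * d ^ 2) := by
    calc _ ≤ 2 * (d * l ^ 2) * (9 * d) := by gcongr; omega
      _ = _ := by ring
  have b2 : J * p * (3 * L + 8) ≤ 22 * (l ^ 2 * (d * p)) := by
    calc _ ≤ 2 * (d * l) * p * (11 * l) := by gcongr; omega
      _ = _ := by ring
  have b3 : (3 * d + 13) * J ≤ 32 * (l ^ 2 * d ^ 2) := by
    calc _ ≤ 16 * d * (2 * (d * l)) := by gcongr; omega
      _ = 32 * (l * d ^ 2) := by ring
      _ ≤ _ := by gcongr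
  have b4 : J * p ≤ 2 * (l ^ 2 * (d * p)) := by
    calc _ ≤ 2 * (d * l) * p := by gcongr
      _ = 2 * (l * (d * p)) := by ring
      _ ≤ _ := by gcongr
  have b5 : d ≤ l ^ 2 * (d * p) := by
    calc d ≤ d * (l ^ 2 * p) := Nat.le_mul_of_pos_right _ (by positivity)
      _ = _ := by ring
  rw [mul_add (l ^ 2)]
  constructor <;> omega

/-- No structure is built; scanning takes at most `100 d²` steps, within the first term of the query
bound. -/
theorem solvedBy_of_le {n d : ℕ} {c φ C : ℝ} {m : ℕ} {E : ℝ} (hnd : n ≤ d) (hd : 1 ≤ d)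
    (hc : 1 ≤ c) (hC : 100 ≤ C * Real.log n ^ m) (hn : 1 ≤ n) :
    SolvedBy preCmd queryCmd n d c φ
      (ENNReal.ofReal (C * Real.log n ^ m * ((d : ℝ) ^ 2 * n + d * (n : ℝ) ^ E)))
      (fun p => ENNReal.ofReal (C * Real.log n ^ m) *
        ((d : ℝ≥0∞) ^ 2 + d * ENNReal.ofReal ((n : ℝ) ^ (1 / φ)) * (1 + p))) := by
  refine solvedBy_of_prepared hc fun X => ⟨bruteParams c X, 0, fun _ => False, 2,
    describes_bruteParams c X, fun _ h => h.elim, fun ω => ?_, ?_, ?_⟩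
  · exact wp_preCmd_brute c φ X hnd fun s' t h1 h2 h3 h4 =>
      ⟨⟨h1, h3, fun h => h.elim, fun _ => h2⟩, h4⟩
  · have hd' : (1 : ℝ) ≤ d := by exact_mod_cast hd
    have hn' : (1 : ℝ) ≤ n := by exact_mod_cast hn
    have h1 : (1 : ℝ) ≤ (d : ℝ) ^ 2 * n + d * (n : ℝ) ^ E := by
      have h2 : (1 : ℝ) ≤ (d : ℝ) ^ 2 * n := one_le_mul_of_one_le_of_one_le (one_le_pow₀ hd') hn'
      have h3 : (0 : ℝ) ≤ d * (n : ℝ) ^ E := by positivity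
      linarith
    rw [← ENNReal.ofReal_natCast]
    refine ENNReal.ofReal_le_ofReal ?_
    push_cast
    nlinarith
  · intro q u b _ hu
    have h1 : n * (6 * d + 20) + 3 ≤ 100 * d ^ 2 := by nlinarith
    calc ∫⁻ ω, (u ω : ℝ≥0∞) ∂tapeLaw ≤ ∫⁻ _, ((100 * d ^ 2 : ℕ) : ℝ≥0∞) ∂tapeLaw :=
          lintegral_mono fun ω => Nat.cast_le.mpr ((hu ω not_false).trans h1)
      _ = 100 * (d : ℝ≥0∞) ^ 2 := by simp
      _ ≤ ENNReal.ofReal (C * Real.log n ^ m) * (d : ℝ≥0∞) ^ 2 := by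
          gcongr
          rw [← ENNReal.ofReal_ofNat]
          exact ENNReal.ofReal_le_ofReal hC
      _ ≤ _ := by gcongr; exact le_self_add

/-- The constant is `81000 = 500 * 3³ * 6`: from `preTime_le`, from `l ≤ 3 log n`, and from the
factors `2` and `3` in the bounds on `L^R` and `3^L`. The query needs less. -/
theorem solvedBy_of_lt {n d : ℕ} {c φ : ℝ} (hnd : d < n) (hd : 1 ≤ d) (hφ : 1 ≤ φ)
    (hc1 : 1 ≤ c) (hΛ : 2 ≤ Real.log n) (hlam : 8 ≤ Real.log (Real.log n))
    (hc : threshold 600 φ n < c) :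
    SolvedBy preCmd queryCmd n d c φ
      (ENNReal.ofReal (81000 * Real.log n ^ 3 * ((d : ℝ) ^ 2 * n + d * (n : ℝ) ^ (1 +
        Real.log 3 / Real.log (c / threshold 600 φ n) + 1 / φ))))
      (fun p => ENNReal.ofReal (81000 * Real.log n ^ 3) *
        ((d : ℝ≥0∞) ^ 2 + d * ENNReal.ofReal ((n : ℝ) ^ (1 / φ)) * (1 + p))) := by
  obtain ⟨l, ll, L, hb⟩ := exists_paramBounds hΛ hlam hφ hc
  have hφ0 : 0 ≤ φ := by linarith
  have hc0 : 0 < c := by linarith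
  have hn0 : (0 : ℝ) < n := by exact_mod_cast (by omega : 0 < n)
  refine solvedBy_of_prepared hc1 fun X => ⟨mkParams c φ X l ll L, window φ ll,
    fun ω => certTrace (mkParams c φ X l ll L) (sampled (mkParams c φ X l ll L) ω) ≤ 1,
    preTime (mkParams c φ X l ll L) ll, describes_mkParams c φ X l ll L, fun _ h =>
    ⟨admissible_mkParams X hd hnd hφ0 hc0 hb, h⟩, fun ω => ?_, ?_, ?_⟩
  · exact wp_preCmd c φ X l ll L hnd hφ0 hb.L_pos hb.clog hb.clog' hb.clogclog hb.clogclog'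
      hb.gap hb.gap' _ rfl fun s' t h1 h2 h3 h4 h5 => ⟨⟨h1, h2, h4, h5⟩, h3⟩
  · have ha := admissible_mkParams X hd hnd hφ0 hc0 hb
    have h1 := preTime_le ha hb.ll_le
    rw [← ENNReal.ofReal_natCast]
    refine ENNReal.ofReal_le_ofReal ((Nat.cast_le.mpr h1).trans ?_)
    push_cast
    simp only [mkParams]
    set γ := Real.log 3 / Real.log (c / threshold 600 φ n) with hγ
    have hl := hb.l_le
    have ht := hb.table_le
    have h3 := hb.three_pow_le
    rw [← hγ] at h3
    have e : (n : ℝ) ^ (1 + γ + 1 / φ) = n * n ^ (1 / φ) * n ^ γ := by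
      rw [Real.rpow_add hn0, Real.rpow_add hn0, Real.rpow_one]; ring
    have hp : (0 : ℝ) ≤ (d : ℝ) ^ 2 * n := by positivity
    calc 500 * ((l : ℝ) ^ 3 * ((d : ℝ) ^ 2 * n +
          d * n * ((L : ℝ) ^ ⌊(L : ℝ) / window φ ll⌋₊ * 3 ^ L)))
        ≤ 500 * ((3 * Real.log n) ^ 3 * ((d : ℝ) ^ 2 * n +
          d * n * ((2 * (n : ℝ) ^ (1 / φ)) * (3 * (n : ℝ) ^ γ)))) := by gcongr
      _ = 13500 * Real.log n ^ 3 * ((d : ℝ) ^ 2 * n +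
          6 * (d * (n : ℝ) ^ (1 + γ + 1 / φ))) := by rw [e]; ring
      _ ≤ 13500 * Real.log n ^ 3 * (6 * ((d : ℝ) ^ 2 * n) +
          6 * (d * (n : ℝ) ^ (1 + γ + 1 / φ))) := by
        have : 0 ≤ Real.log n := by linarith
        refine mul_le_mul_of_nonneg_left ?_ (by positivity)
        linarith
      _ = _ := by ring
  · intro q u b hu hu'
    have ha := admissible_mkParams X hd hnd hφ0 hc0 hb
    refine (lintegral_query_le ha q u b hu hu').trans ?_
    obtain ⟨k1, k2⟩ := query_const_le ha
    set p := ∫⁻ ω, (b ω : ℝ≥0∞) ∂tapeLaw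
    refine (add_le_add (Nat.cast_le.mpr k1) (mul_le_mul_left (Nat.cast_le.mpr k2) _)).trans ?_
    push_cast
    simp only [mkParams]
    have ht : ((L : ℝ≥0∞) ^ ⌊(L : ℝ) / window φ ll⌋₊) ≤
        2 * ENNReal.ofReal ((n : ℝ) ^ (1 / φ)) := by
      rw [← ENNReal.ofReal_ofNat, ← ENNReal.ofReal_mul (by norm_num), ← ENNReal.ofReal_natCast,
        ← ENNReal.ofReal_pow (by positivity)]
      exact ENNReal.ofReal_le_ofReal hb.table_le
    have hl : 200 * (l : ℝ≥0∞) ^ 2 ≤ ENNReal.ofReal (81000 * Real.log n ^ 3) := by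
      rw [← ENNReal.ofReal_ofNat, ← ENNReal.ofReal_natCast, ← ENNReal.ofReal_pow (by positivity),
        ← ENNReal.ofReal_mul (by norm_num)]
      refine ENNReal.ofReal_le_ofReal ?_
      have h1 : (l : ℝ) ^ 2 ≤ (3 * Real.log n) ^ 2 := by
        have := hb.l_le
        gcongr
      have h2 : Real.log n ^ 2 ≤ Real.log n ^ 3 := pow_le_pow_right₀ (by linarith) (by norm_num)
      have h3 : 0 ≤ Real.log n ^ 2 := by positivity
      nlinarith
    generalize ENNReal.ofReal ((n : ℝ) ^ (1 / φ)) = N at *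
    generalize (L : ℝ≥0∞) ^ ⌊(L : ℝ) / window φ ll⌋₊ = z at *
    calc 100 * ((l : ℝ≥0∞) ^ 2 * ((d : ℝ≥0∞) ^ 2 + d * z)) +
          100 * ((l : ℝ≥0∞) ^ 2 * (d * z)) * p
        = 100 * (l : ℝ≥0∞) ^ 2 * ((d : ℝ≥0∞) ^ 2 + d * z * (1 + p)) := by ring
      _ ≤ 100 * (l : ℝ≥0∞) ^ 2 * (2 * (d : ℝ≥0∞) ^ 2 + d * (2 * N) * (1 + p)) := by
          gcongr
          rw [two_mul]
          exact le_self_add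
      _ = 200 * (l : ℝ≥0∞) ^ 2 * ((d : ℝ≥0∞) ^ 2 + d * N * (1 + p)) := by ring
      _ ≤ _ := by gcongr

end NearNeighbor

-- The main theorem

open NearNeighbor in
theorem mainTheorem1 :
    ∃ (D : ℝ) (pre query : RealRAM.Cmd), 0 < D ∧
      ∀ f : ℕ → ℝ, (∀ᶠ n in atTop, 0 < f n) →
        (fun n : ℕ => 1 / f n) =o[atTop] (fun _ : ℕ => (1 : ℝ)) →
        ∃ (C : ℝ) (m N : ℕ), ∀ n : ℕ, N ≤ n → ∀ d : ℕ, 1 ≤ d →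
          ∀ c : ℝ, NearNeighbor.threshold D (f n) n < c →
            NearNeighbor.SolvedBy pre query n d c (f n)
              (ENNReal.ofReal (C * Real.log n ^ m *
                ((d : ℝ) ^ 2 * n + d * (n : ℝ) ^ (1 +
                  Real.log 3 / Real.log (c / NearNeighbor.threshold D (f n) n) + 1 / f n))))
              (fun p => ENNReal.ofReal (C * Real.log n ^ m) *
                ((d : ℝ≥0∞) ^ 2 + d * ENNReal.ofReal ((n : ℝ) ^ (1 / f n)) * (1 + p))) := by
  refine ⟨600, preCmd, queryCmd, by norm_num, fun f hf hf1 => ?_⟩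
  -- Of the hypothesis `1 / f n = o(1)` only `f n ≥ 1` for large `n` is needed.
  have h1 : ∀ᶠ n in atTop, 1 ≤ f n := by
    have := hf1.bound one_pos
    filter_upwards [hf, this] with n hn hb
    simp only [norm_one, mul_one, Real.norm_eq_abs, abs_of_pos (one_div_pos.mpr hn)] at hb
    rwa [div_le_one hn] at hb
  have hlog : Tendsto (fun n : ℕ => Real.log n) atTop atTop :=
    Real.tendsto_log_atTop.comp tendsto_natCast_atTop_atTop
  have h2 : ∀ᶠ n : ℕ in atTop, 2 ≤ Real.log n := hlog.eventually_ge_atTop 2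
  have h3 : ∀ᶠ n : ℕ in atTop, 8 ≤ Real.log (Real.log n) :=
    (Real.tendsto_log_atTop.comp hlog).eventually_ge_atTop 8
  obtain ⟨N, hN⟩ := eventually_atTop.mp (h1.and (h2.and (h3.and (eventually_ge_atTop 1))))
  refine ⟨81000, 3, N, fun n hn d hd c hc => ?_⟩
  obtain ⟨hφ, hΛ, hlam, hn1⟩ := hN n hn
  -- This ensures that points within distance `1` pass the test against `c`.
  have hc1 : 1 ≤ c := by
    refine le_trans ?_ hc.le
    rw [threshold]
    have : 1 ≤ √(f n * Real.log (Real.log n)) := by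
      rw [Real.one_le_sqrt]
      nlinarith
    linarith
  rcases Nat.lt_or_ge d n with h | h
  · exact solvedBy_of_lt h hd hφ hc1 hΛ hlam hc
  · refine solvedBy_of_le h hd hc1 ?_ hn1
    have : (1 : ℝ) ≤ Real.log n ^ 3 := one_le_pow₀ (by linarith)
    linarith
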